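/- Conventions. Graphs are finite, simple and undirected. A path has at least one edge. A \emph{polygonal 2-tree} is a graph obtained as follows: every cycle is a polygonal 2-tree; and if $H$ is a polygonal 2-tree, $uv\in E(H)$, and $P$ is a path with end vertices $u,v$ such that $|E(P)|\ge 2$, $E(H)\cap E(P)=\emptyset$ and $V(H)\cap V(P)=\{u,v\}$, then $H\cup P$ is a polygonal 2-tree. An \emph{open ear decomposition} of a graph $G$ is a sequence $(P_0,\dots,P_k)$ of paths (ears) whose edge sets partition $E(G)$ such that, for each $i\ge 1$, the end vertices of $P_i$ are distinct and no internal vertex of $P_i$ lies on $P_0\cup\dots\cup P_{i-1}$. It is \emph{nested} if (1) for each $i\ge1$ there is $j<i$ such that both end vertices of $P_i$ lie on $P_j$; and (2) whenever $j<i$, $j<i'$, $i\ne i'$ and the end vertices of $P_i$ and of $P_{i'}$ all lie on $P_j$, the subpaths $Q_i,Q_{i'}$ of $P_j$ between the end vertices of $P_i$ and of $P_{i'}$, respectively, satisfy $E(Q_i)\subseteq E(Q_{i'})$ or $E(Q_{i'})\subseteq E(Q_i)$ or $E(Q_i)\cap E(Q_{i'})=\emptyset$. A nested ear decomposition is \emph{nice}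 if $P_0$ is a single edge and, for each $i\ge1$, there is $j<i$ such that the end vertices of $P_i$ are the two ends of an edge of $P_j$. For a set $\mathcal B$ of cycles let $\mathrm{size}(\mathcal B)=\sum_{C\in\mathcal B}|E(C)|$. \textbf{Theorem.} Let $G$ be a polygonal 2-tree on $n$ vertices and let $\mathcal B$ be the set of induced cycles of $G$. \begin{enumerate} \item Every nested ear decomposition $(P_0,\dots,P_k)$ of $G$ such that $P_0$ is a single edge and $|E(P_i)|\ge 2$ for all $i\ge1$ is a nice ear decomposition. \item There is an algorithm which, given $G$ by adjacency lists, computes a nested ear decomposition as in (1) (each ear given by its sequence of vertices) and the set $\mathcal B$ (each cycle listed exactly once, by its vertices in cyclic order) in $O(n)$ steps on a random access machine, in which accessing an array cell, adding or subtracting one, and comparing two numbers take unit time. The algorithm and the constant in $O(n)$ do not depend on $G$. \item $\mathrm{size}(\mathcal B)\le c\,n$ for an absolute constant $c$. \end{enumerate} -/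

import Mathlib

universe u

namespace PolyTree

/-! ### Polygonal 2-trees -/

section Graphs

variable {V : Type u} {G : SimpleGraph V}

/-- `PolygonalSub H`: the subgraph `H` of `G`, as a graph in its own right, is a polygonal 2-tree.
A cycle is one, and adding to `H` a path with at least two edges between the ends `a`, `b` of an
edge of `H`, which meets `H` in no edge and in no vertices other than `a`, `b`, gives another. -/
inductive PolygonalSub : G.Subgraph → Prop
  | cycle {a : V} (c : G.Walk a a) (hc : c.IsCycle) : PolygonalSub c.toSubgraph
  | addPath {H : G.Subgraph} {a b : V} (hH : PolygonalSub H) (hab : H.Adj a b)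
      (p : G.Walk a b) (hp : p.IsPath) (hlen : 2 ≤ p.length)
      (hE : H.edgeSet ∩ p.toSubgraph.edgeSet = ∅)
      (hV : H.verts ∩ p.toSubgraph.verts = {a, b}) :
      PolygonalSub (H ⊔ p.toSubgraph)

/-- A graph `G` is a polygonal 2-tree. All graphs in a construction of `G` are subgraphs of `G`,
so the construction can be carried out inside `G`. -/
def IsPolygonal2Tree (G : SimpleGraph V) : Prop :=
  PolygonalSub (⊤ : G.Subgraph)

/-! ### Ear decompositions -/

/-- A path with at least one edge in `G`, traversed from one of its end vertices to the other. -/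
structure Ear (G : SimpleGraph V) where
  src : V
  tgt : V
  walk : G.Walk src tgt
  isPath : walk.IsPath
  length_pos : 0 < walk.length

/-- The number of edges of an ear. -/
def Ear.length (P : Ear G) : ℕ := P.walk.length

/-- The vertices of an ear. -/
def Ear.verts (P : Ear G) : Set V := {w | w ∈ P.walk.support}

/-- The edges of an ear. -/
def Ear.edges (P : Ear G) : Set (Sym2 V) := {e | e ∈ P.walk.edges}

/-- `(P₀, …, P_k)` is an open ear decomposition of `G`. -/
structure IsOpenEarDecomposition {k : ℕ} (P : Fin (k + 1) → Ear G) : Prop where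
  /-- The edge sets of the ears partition the edge set of `G`. -/
  partition : ∀ e ∈ G.edgeSet, ∃! i, e ∈ (P i).edges
  ends_ne : ∀ i, i ≠ 0 → (P i).src ≠ (P i).tgt
  /-- Internal vertices of a later ear lie on no earlier ear. -/
  internal_new : ∀ i, i ≠ 0 → ∀ w ∈ (P i).verts, w ≠ (P i).src → w ≠ (P i).tgt →
    ∀ j < i, w ∉ (P j).verts

/-- `(P₀, …, P_k)` is a nested ear decomposition of `G`. In `nested`, `q` and `q'` are the
subpaths of `P_j` between the end vertices of `P_i` and of `P_i'` (each is unique). -/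
structure IsNestedEarDecomposition {k : ℕ} (P : Fin (k + 1) → Ear G) : Prop
    extends IsOpenEarDecomposition P where
  ends_mem : ∀ i, i ≠ 0 → ∃ j < i, (P i).src ∈ (P j).verts ∧ (P i).tgt ∈ (P j).verts
  nested : ∀ j i i', j < i → j < i' → i ≠ i' →
    (P i).src ∈ (P j).verts → (P i).tgt ∈ (P j).verts →
    (P i').src ∈ (P j).verts → (P i').tgt ∈ (P j).verts →
    ∀ (q : G.Walk (P i).src (P i).tgt) (q' : G.Walk (P i').src (P i').tgt),
      q.IsPath → q'.IsPath → {e | e ∈ q.edges} ⊆ (P j).edges → {e | e ∈ q'.edges} ⊆ (P j).edges →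
      {e | e ∈ q.edges} ⊆ {e | e ∈ q'.edges} ∨ {e | e ∈ q'.edges} ⊆ {e | e ∈ q.edges} ∨
        {e | e ∈ q.edges} ∩ {e | e ∈ q'.edges} = ∅

/-- `(P₀, …, P_k)` is a nice ear decomposition of `G`: it is nested, `P₀` is an edge, and the end
vertices of every later ear are joined by an edge of an earlier ear. -/
structure IsNiceEarDecomposition {k : ℕ} (P : Fin (k + 1) → Ear G) : Prop
    extends IsNestedEarDecomposition P where
  first_edge : (P 0).length = 1
  ends_adj : ∀ i, i ≠ 0 → ∃ j < i, s((P i).src, (P i).tgt) ∈ (P j).edges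

/-- A nested ear decomposition that starts with an edge and all of whose later ears have at least
two edges. -/
structure IsLongNestedEarDecomposition {k : ℕ} (P : Fin (k + 1) → Ear G) : Prop
    extends IsNestedEarDecomposition P where
  first_edge : (P 0).length = 1
  long : ∀ i, i ≠ 0 → 2 ≤ (P i).length

/-! ### Induced cycles -/

/-- The set of induced cycles of `G`. -/
def inducedCycles (G : SimpleGraph V) : Set G.Subgraph :=
  {C | C.IsInduced ∧ ∃ (a : V) (c : G.Walk a a), c.IsCycle ∧ C = c.toSubgraph}

/-- The size of a set of subgraphs (of a finite graph): the number of edges, counted with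
multiplicity. -/
noncomputable def size (B : Set G.Subgraph) : ℕ :=
  ∑ᶠ C ∈ B, C.edgeSet.ncard

/-- The list `l` runs once through the vertices of the cycle `C`, in cyclic order. -/
def ListsCycle (C : G.Subgraph) (l : List V) : Prop :=
  ∃ (a : V) (c : G.Walk a a), c.IsCycle ∧ C = c.toSubgraph ∧ l = c.support.tail

end Graphs

/-! ### Random access programs with a step count

Programs use scalar variables and arrays, named by natural numbers, that hold natural numbers.
An array cell is accessed in one step. Arithmetic consists of successor, predecessor and
comparison, so that a cell grows only by a constant (depending on the program) per command:
within `O(n)` steps on an input with entries `O(n)` all cells stay `O(n)`, i.e. fit into words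
of `O(log n)` bits. -/

/-- The memory: the values of the scalar variables and of the arrays. -/
structure State where
  var : ℕ → ℕ
  arr : ℕ → ℕ → ℕ

/-- Expressions. `get a e` is the entry of the array `a` at the index `e`. -/
inductive Expr
  | const (c : ℕ)
  | var (x : ℕ)
  | get (a : ℕ) (e : Expr)
  | succ (e : Expr)
  | pred (e : Expr)

/-- The value of an expression. -/
def Expr.eval (s : State) : Expr → ℕ
  | const c => c
  | var x => s.var x
  | get a e => s.arr a (e.eval s)
  | succ e => e.eval s + 1
  | pred e => e.eval s - 1

/-- The number of steps taken to evaluate an expression. -/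
def Expr.cost : Expr → ℕ
  | const _ => 1
  | var _ => 1
  | get _ e => e.cost + 1
  | succ e => e.cost + 1
  | pred e => e.cost + 1

/-- Tests. -/
inductive Test
  | lt (e f : Expr)
  | eq (e f : Expr)
  | neg (b : Test)
  | and (b c : Test)

/-- The truth value of a test. -/
def Test.eval (s : State) : Test → Bool
  | lt e f => decide (e.eval s < f.eval s)
  | eq e f => decide (e.eval s = f.eval s)
  | neg b => !(b.eval s)
  | and b c => b.eval s && c.eval s

/-- The number of steps taken to evaluate a test. -/
def Test.cost : Test → ℕ
  | lt e f => e.cost + f.cost + 1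
  | eq e f => e.cost + f.cost + 1
  | neg b => b.cost + 1
  | and b c => b.cost + c.cost + 1

/-- Programs. -/
inductive Prog
  | skip
  | assign (x : ℕ) (e : Expr)
  | store (a : ℕ) (i e : Expr)
  | seq (p q : Prog)
  | ite (b : Test) (p q : Prog)
  | loop (b : Test) (p : Prog)

/-- Assign the value `v` to the variable `x`. -/
def State.setVar (s : State) (x v : ℕ) : State where
  var := Function.update s.var x v
  arr := s.arr

/-- Write the value `v` into the array `a` at the index `i`. -/
def State.setArr (s : State) (a i v : ℕ) : State where
  var := s.var
  arr := Function.update s.arr a (Function.update (s.arr a) i v)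

/-- `Exec p s s' t`: the program `p`, started in the state `s`, halts in the state `s'` after
exactly `t` steps. -/
inductive Exec : Prog → State → State → ℕ → Prop
  | skip (s : State) : Exec Prog.skip s s 1
  | assign (s : State) (x : ℕ) (e : Expr) :
      Exec (Prog.assign x e) s (s.setVar x (e.eval s)) (e.cost + 1)
  | store (s : State) (a : ℕ) (i e : Expr) :
      Exec (Prog.store a i e) s (s.setArr a (i.eval s) (e.eval s)) (i.cost + e.cost + 1)
  | seq {p q : Prog} {s s₁ s₂ : State} {t₁ t₂ : ℕ} (h₁ : Exec p s s₁ t₁) (h₂ : Exec q s₁ s₂ t₂) :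
      Exec (Prog.seq p q) s s₂ (t₁ + t₂)
  | ite_true {b : Test} {p q : Prog} {s s₁ : State} {t : ℕ} (hb : b.eval s = true)
      (h : Exec p s s₁ t) : Exec (Prog.ite b p q) s s₁ (b.cost + 1 + t)
  | ite_false {b : Test} {p q : Prog} {s s₁ : State} {t : ℕ} (hb : b.eval s = false)
      (h : Exec q s s₁ t) : Exec (Prog.ite b p q) s s₁ (b.cost + 1 + t)
  | loop_false {b : Test} {p : Prog} {s : State} (hb : b.eval s = false) :
      Exec (Prog.loop b p) s s (b.cost + 1)
  | loop_true {b : Test} {p : Prog} {s s₁ s₂ : State} {t₁ t₂ : ℕ} (hb : b.eval s = true)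
      (h₁ : Exec p s s₁ t₁) (h₂ : Exec (Prog.loop b p) s₁ s₂ t₂) :
      Exec (Prog.loop b p) s s₂ (b.cost + 1 + t₁ + t₂)

/-! ### Input and output -/

/-- `adj` is a representation of `G` by adjacency lists: `adj v` lists the neighbours of `v`,
each once, in any order. -/
def IsAdjacencyLists {n : ℕ} (G : SimpleGraph (Fin n)) (adj : Fin n → List (Fin n)) : Prop :=
  ∀ v, (adj v).Nodup ∧ ∀ w, w ∈ adj v ↔ G.Adj v w

/-- The initial memory for adjacency lists `adj`: variable 0 holds `n`, array 1 holds the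
concatenation of the lists of the vertices `0, 1, …, n - 1`, and entry `v ≤ n` of array 0 is the
total length of the lists of the vertices before `v`, so the list of `v` occupies the cells from
entry `v` up to, not including, entry `v + 1` of array 0. Everything else is 0. -/
def inputState {n : ℕ} (adj : Fin n → List (Fin n)) : State where
  var x := if x = 0 then n else 0
  arr a i :=
    if a = 0 then (if i ≤ n then ((List.ofFn adj).take i).flatten.length else 0)
    else if a = 1 then ((List.ofFn adj).flatten.map Fin.val).getD i 0
    else 0

/-- The sequence of lists stored by: their number in the variable `x`, their concatenation in the
array `d`, and the start of the `i`-th list, which is the end of the one before, at entry `i` of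
the array `o`. -/
def State.lists (s : State) (x o d : ℕ) : List (List ℕ) :=
  (List.range (s.var x)).map fun i =>
    (List.range' (s.arr o i) (s.arr o (i + 1) - s.arr o i)).map (s.arr d)

/-- The final memory `s` holds (variable 1, arrays 2 and 3) the ears `P₀, …, P_k`, each as its
sequence of vertices. -/
def OutputsEars {n : ℕ} {G : SimpleGraph (Fin n)} (s : State) {k : ℕ}
    (P : Fin (k + 1) → Ear G) : Prop :=
  s.lists 1 2 3 = List.ofFn fun i => (P i).walk.support.map Fin.val

/-- The final memory `s` holds (variable 2, arrays 4 and 5) the elements of the set `B` of cycles,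
each exactly once, as its sequence of vertices in cyclic order. -/
def OutputsCycles {n : ℕ} {G : SimpleGraph (Fin n)} (s : State) (B : Set G.Subgraph) : Prop :=
  ∃ (b : ℕ) (C : Fin b → G.Subgraph) (l : Fin b → List (Fin n)),
    Function.Injective C ∧ Set.range C = B ∧ (∀ i, ListsCycle (C i) (l i)) ∧
    s.lists 2 4 5 = List.ofFn fun i => (l i).map Fin.val

end PolyTree

/-!
A polygonal 2-tree `G` is rooted at an edge `r₀r₁`: it arises from this edge by adding ears
`1, …, k` of length at least two, each joining the ends of an edge present before
(`PolygonalSub.rooted`, `EarSystem`). The rank of a vertex is the number of the ear that has it as an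
inner vertex, and 0 for the roots. The basic fact (`Ori.nbr`) is that an inner vertex of the ear `i` is
adjacent only to its two neighbours on this ear and to inner vertices of later ears that start at it.

*Nice decompositions.* By the basic fact, two distinct non-adjacent vertices are separated by two
others, the neighbours of one of them on its ear (`exists_separator`). The ends of an ear of a nested
ear decomposition lie on an earlier ear `P`; by induction the ends of `P` are adjacent, so `P` closes to
a cycle, and the two parts of the cycle and the ear itself are three walks without common inner
vertices. Hence the ends of the ear are adjacent (`IsLongNestedEarDecomposition.isNice`).

*Induced cycles.* An induced cycle follows the ear of its vertex of largest rank, so the induced cycles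
are just the polygons formed by an ear and the edge between its ends (`inducedCycles_eq`). The sets of
inner vertices of the ears are disjoint, so the polygons have total size at most `3 n`
(`IsPolygonal2Tree.size_inducedCycles_le`).

*The algorithm.* As a vertex has at most two neighbours that do not have larger rank, `G` has at most
`2 n` edges, and vertices can be removed one by one so that each has at most two remaining neighbours
when it is removed; storing these makes it possible to test adjacency in constant time
(`does_peel`). Then the ears for the root edge from the vertex 0 to the first vertex of its list are
removed, attached ears first (`does_emit`). A vertex of remaining degree two is an inner vertex of a remaining
ear at which no other remaining ear is attached. Such vertices are taken out of a queue; the processed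
vertices of an ear form intervals, whose ends point to each other, and an interval is the whole interior
of the ear as soon as the two vertices next to it are adjacent. Then the ear is removed, and the degrees
of its ends decrease by one. An ear attached at an inner vertex of another one is removed before the
latter, so the reverse order is a nested ear decomposition (`isLongNested_earSeq`); and every ear, read
as a cyclic sequence, is also one of the induced cycles.

The program uses the variables 0 (`n`), 3 (current vertex), 4, 5, 6 (scan of its list), 7 and 8 (head
and length of the queue), 9 (number of removed ears), 10 to 16 (auxiliary) and the arrays 6 to 11
(degrees, marks, queue and stored neighbours of the first phase; array 7 has the degrees of the second
phase) and 12 to 20 (see `EmitMem`; array 13 is the second queue). Running times are bounded with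
potentials: processing a vertex costs a constant for every entry of its list.
-/


namespace PolyTree

/-! ### Rooting a polygonal 2-tree at an edge -/

section Rooted

variable {V : Type u} {G : SimpleGraph V}

/-- `RootedPolygonal r₀ r₁ H`: the subgraph `H` arises from the edge `r₀r₁` by repeatedly adding a
path with at least two edges, all of whose inner vertices are new, between the ends of an edge. -/
inductive RootedPolygonal (r₀ r₁ : V) : G.Subgraph → Prop
  | edge (h : G.Adj r₀ r₁) : RootedPolygonal r₀ r₁ (G.subgraphOfAdj h)
  | addEar {H : G.Subgraph} {a b : V} (hH : RootedPolygonal r₀ r₁ H) (hab : H.Adj a b)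
      (p : G.Walk a b) (hp : p.IsPath) (hlen : 2 ≤ p.length)
      (hV : H.verts ∩ p.toSubgraph.verts = {a, b}) :
      RootedPolygonal r₀ r₁ (H ⊔ p.toSubgraph)

theorem RootedPolygonal.adj_root {r₀ r₁ : V} {H : G.Subgraph} (h : RootedPolygonal r₀ r₁ H) :
    H.Adj r₀ r₁ := by
  induction h with
  | edge h => simp
  | addEar _ _ p _ _ _ ih => exact Or.inl ih

/-- Two rooted polygonal graphs that meet in the root edge of the second can be glued. -/
theorem RootedPolygonal.graft {r₀ r₁ a b : V} {F K : G.Subgraph} (hK : RootedPolygonal a b K)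
    (hF : RootedPolygonal r₀ r₁ F) (hab : F.Adj a b) (hV : F.verts ∩ K.verts = {a, b}) :
    RootedPolygonal r₀ r₁ (F ⊔ K) := by
  induction hK with
  | edge h =>
    rwa [sup_eq_left.2 (SimpleGraph.subgraphOfAdj_le_of_adj F hab)]
  | @addEar K a' b' hK hab' p hp hlen hV' ih =>
    have haK : a ∈ K.verts := hK.adj_root.fst_mem
    have hbK : b ∈ K.verts := hK.adj_root.snd_mem
    have hFK : F.verts ∩ K.verts = {a, b} := by
      apply Set.Subset.antisymm
      · intro w hw
        rw [← hV]
        exact ⟨hw.1, Or.inl hw.2⟩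
      · rintro w (rfl | rfl)
        · exact ⟨hab.fst_mem, haK⟩
        · exact ⟨hab.snd_mem, hbK⟩
    rw [← sup_assoc]
    refine RootedPolygonal.addEar (ih hFK) (Or.inr hab') p hp hlen ?_
    apply Set.Subset.antisymm
    · rintro w ⟨hw | hw, hwp⟩
      · have : w ∈ F.verts ∩ (K ⊔ p.toSubgraph).verts := ⟨hw, Or.inr hwp⟩
        rw [hV] at this
        rw [← hV']
        rcases this with rfl | rfl
        · exact ⟨haK, hwp⟩
        · exact ⟨hbK, hwp⟩
      · rw [← hV']
        exact ⟨hw, hwp⟩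
    · intro w hw
      rw [← hV'] at hw
      exact ⟨Or.inr hw.1, hw.2⟩

/-- A cycle arises from its first edge by adding the rest of the cycle. -/
theorem RootedPolygonal.of_cycle_snd {r₀ : V} (c : G.Walk r₀ r₀) (hc : c.IsCycle) :
    RootedPolygonal r₀ c.snd c.toSubgraph := by
  cases c with
  | nil => exact absurd hc (by simp)
  | @cons _ y _ h q =>
    rw [SimpleGraph.Walk.cons_isCycle_iff] at hc
    have hlen : 2 ≤ q.length := by
      by_contra hlt
      have hne : q.length ≠ 0 := fun h0 => h.ne (SimpleGraph.Walk.eq_of_length_eq_zero h0).symm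
      have h1 : q.length = 1 := by omega
      apply hc.2
      cases q with
      | nil => simp at h1
      | cons h' q' =>
        cases q' with
        | nil => simp [Sym2.eq_swap]
        | cons _ _ => simp at h1
    have := (RootedPolygonal.edge h).addEar (a := y) (b := r₀) (by simp [Sym2.eq_swap]) q hc.1
      hlen (by
        ext w
        simp only [SimpleGraph.subgraphOfAdj_verts, SimpleGraph.Walk.verts_toSubgraph,
          Set.mem_inter_iff, Set.mem_insert_iff, Set.mem_singleton_iff, Set.mem_ofPred_eq]
        constructor
        · tauto
        · rintro (rfl | rfl) <;> simp)
    simpa using this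

theorem RootedPolygonal.of_cycle {a r₀ r₁ : V} (c : G.Walk a a) (hc : c.IsCycle)
    (h : c.toSubgraph.Adj r₀ r₁) : RootedPolygonal r₀ r₁ c.toSubgraph := by
  classical
  have hmem : r₀ ∈ c.support := by simpa using h.fst_mem
  have hr := hc.rotate hmem
  rw [← SimpleGraph.Walk.toSubgraph_rotate c hmem] at h ⊢
  have hN := hr.neighborSet_toSubgraph_endpoint
  have h1 : r₁ ∈ (c.rotate r₀ hmem).toSubgraph.neighborSet r₀ := h
  rw [hN] at h1
  rcases h1 with h1 | h1
  · rw [h1]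
    exact of_cycle_snd _ hr
  · rw [Set.mem_singleton_iff, ← SimpleGraph.Walk.snd_reverse] at h1
    rw [h1, ← SimpleGraph.Walk.toSubgraph_reverse]
    exact of_cycle_snd _ hr.reverse

/-- Every edge of a polygonal 2-tree may serve as its root. If the root lies on the path `p` added
last, along the edge `ab`, the polygon `p + ab` is built first and the rest, rooted at `ab`, is
glued to it. -/
theorem PolygonalSub.rooted {H : G.Subgraph} (hH : PolygonalSub H) :
    ∀ r₀ r₁ : V, H.Adj r₀ r₁ → RootedPolygonal r₀ r₁ H := by
  induction hH with
  | cycle c hc => exact fun r₀ r₁ h => .of_cycle c hc h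
  | @addPath H a b hH hab p hp hlen hE hV ih =>
    rintro r₀ r₁ (h | h)
    · exact (ih _ _ h).addEar hab p hp hlen hV
    · have hc : (SimpleGraph.Walk.cons hab.symm.adj_sub p).IsCycle := by
        rw [SimpleGraph.Walk.cons_isCycle_iff]
        refine ⟨hp, fun hm => ?_⟩
        have : s(b, a) ∈ H.edgeSet ∩ p.toSubgraph.edgeSet :=
          ⟨by simpa using hab.symm, by simpa using hm⟩
        rw [hE] at this
        exact this
      have hF : RootedPolygonal r₀ r₁ (SimpleGraph.Walk.cons hab.symm.adj_sub p).toSubgraph :=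
        .of_cycle _ hc (by simpa using Or.inr h)
      have hg := (ih a b hab).graft hF (by simp [Sym2.eq_swap]) (by
        ext w
        rw [← hV]
        simp only [SimpleGraph.Walk.verts_toSubgraph, Set.mem_inter_iff, Set.mem_ofPred_eq,
          SimpleGraph.Walk.support_cons, List.mem_cons]
        constructor
        · rintro ⟨rfl | h1, h2⟩
          · exact ⟨h2, by simp⟩
          · exact ⟨h2, h1⟩
        · tauto)
      convert hg using 1
      simp only [SimpleGraph.Walk.toSubgraph]
      rw [sup_comm, sup_comm (G.subgraphOfAdj _), sup_assoc,
        sup_eq_right.2 (SimpleGraph.subgraphOfAdj_le_of_adj H hab.symm)]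

theorem PolygonalSub.exists_adj {H : G.Subgraph} (hH : PolygonalSub H) : ∃ a b, H.Adj a b := by
  induction hH with
  | @cycle a c hc => exact ⟨a, c.snd, SimpleGraph.Walk.toSubgraph_adj_snd _ hc.not_nil⟩
  | addPath _ hab => exact ⟨_, _, Or.inl hab⟩

end Rooted

/-! ### Rooted ear structures -/

/-- A rooted ear structure on the vertex set `S` with adjacency relation `R`: the root edge `r₀r₁`
and the ears `1, …, k`, where the ear `i` has the vertices `pt i 0, …, pt i (len i)`. The rank of a
vertex is the number of the ear that has it as an inner vertex, and `0` for the two roots; every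
ear joins two adjacent vertices of smaller rank. The values of `len` and `pt` at other arguments are
irrelevant. -/
structure EarSystem {V : Type u} (S : Set V) (R : V → V → Prop) (r₀ r₁ : V) where
  k : ℕ
  len : ℕ → ℕ
  pt : ℕ → ℕ → V
  rk : V → ℕ
  root_ne : r₀ ≠ r₁
  mem_root₀ : r₀ ∈ S
  mem_root₁ : r₁ ∈ S
  rk_root₀ : rk r₀ = 0
  rk_root₁ : rk r₁ = 0
  two_le : ∀ i, 1 ≤ i → i ≤ k → 2 ≤ len i
  pt_mem : ∀ i j, 1 ≤ i → i ≤ k → j ≤ len i → pt i j ∈ S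
  rk_pt : ∀ i j, 1 ≤ i → i ≤ k → 0 < j → j < len i → rk (pt i j) = i
  rk_fst : ∀ i, 1 ≤ i → i ≤ k → rk (pt i 0) < i
  rk_lst : ∀ i, 1 ≤ i → i ≤ k → rk (pt i (len i)) < i
  inj : ∀ i, 1 ≤ i → i ≤ k → ∀ a b, a ≤ len i → b ≤ len i → pt i a = pt i b → a = b
  cover : ∀ v ∈ S, v = r₀ ∨ v = r₁ ∨ ∃ i j, 1 ≤ i ∧ i ≤ k ∧ 0 < j ∧ j < len i ∧ v = pt i j
  ends_adj : ∀ i, 1 ≤ i → i ≤ k → R (pt i 0) (pt i (len i))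
  adj_iff : ∀ x y, R x y ↔ s(x, y) = s(r₀, r₁) ∨
    ∃ i j, 1 ≤ i ∧ i ≤ k ∧ j < len i ∧ s(x, y) = s(pt i j, pt i (j + 1))

namespace EarSystem

section Construction

variable {V : Type u} {G : SimpleGraph V}

/-- The rooted ear structure of a single edge. -/
def ofEdge {r₀ r₁ : V} (h : G.Adj r₀ r₁) :
    EarSystem (G.subgraphOfAdj h).verts (G.subgraphOfAdj h).Adj r₀ r₁ where
  k := 0
  len := 0
  pt _ _ := r₀
  rk := 0
  root_ne := h.ne
  mem_root₀ := by simp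
  mem_root₁ := by simp
  rk_root₀ := rfl
  rk_root₁ := rfl
  two_le := by omega
  pt_mem := by omega
  rk_pt := by omega
  rk_fst := by omega
  rk_lst := by omega
  inj := by omega
  cover v hv := by
    rcases hv with hv | hv
    · exact Or.inl hv
    · exact Or.inr (Or.inl hv)
  ends_adj := by omega
  adj_iff x y := by
    simp only [SimpleGraph.subgraphOfAdj_adj]
    constructor
    · intro h
      exact Or.inl h.symm
    · rintro (h | ⟨i, j, h1, h2, _⟩)
      · exact h.symm
      · omega

open Classical in
/-- The rooted ear structure with one more ear, which gets the number `k + 1`. -/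
noncomputable def addEar {r₀ r₁ : V} {H : G.Subgraph} (E : EarSystem H.verts H.Adj r₀ r₁) {a b : V}
    (hrk : ∀ v ∈ H.verts, E.rk v ≤ E.k)
    (hab : H.Adj a b) (p : G.Walk a b) (hp : p.IsPath) (hlen : 2 ≤ p.length)
    (hV : H.verts ∩ p.toSubgraph.verts = {a, b}) :
    EarSystem (H ⊔ p.toSubgraph).verts (H ⊔ p.toSubgraph).Adj r₀ r₁ :=
  have hget : ∀ j, 0 < j → j < p.length → p.getVert j ∉ H.verts := by
    intro j h0 hj hm
    have : p.getVert j ∈ H.verts ∩ p.toSubgraph.verts := ⟨hm, by simp⟩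
    rw [hV] at this
    rcases this with h | h
    · have := hp.getVert_injOn (x₁ := j) (x₂ := 0) hj.le (Nat.zero_le _) (by simpa using h)
      omega
    · have := hp.getVert_injOn (x₁ := j) (x₂ := p.length) hj.le (le_refl p.length) (by simpa using h)
      omega
  { k := E.k + 1
    len := fun i => if i = E.k + 1 then p.length else E.len i
    pt := fun i j => if i = E.k + 1 then p.getVert j else E.pt i j
    rk := fun v => if v ∈ H.verts then E.rk v else E.k + 1
    root_ne := E.root_ne
    mem_root₀ := Or.inl E.mem_root₀
    mem_root₁ := Or.inl E.mem_root₁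
    rk_root₀ := by rw [if_pos E.mem_root₀, E.rk_root₀]
    rk_root₁ := by rw [if_pos E.mem_root₁, E.rk_root₁]
    two_le := by
      intro i h1 h2
      by_cases h : i = E.k + 1
      · simpa [h]
      · simpa [h] using E.two_le i h1 (by omega)
    pt_mem := by
      intro i j h1 h2
      by_cases h : i = E.k + 1
      · intro _
        simp [h]
      · simp only [h, if_false]
        intro hj
        exact Or.inl (E.pt_mem i j h1 (by omega) hj)
    rk_pt := by
      intro i j h1 h2 h0
      by_cases h : i = E.k + 1
      · simp only [h, if_true]
        intro hj
        rw [if_neg (hget j h0 hj)]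
      · simp only [h, if_false]
        intro hj
        rw [if_pos (E.pt_mem i j h1 (by omega) hj.le)]
        exact E.rk_pt i j h1 (by omega) h0 hj
    rk_fst := by
      intro i h1 h2
      by_cases h : i = E.k + 1
      · simp only [h, if_true, SimpleGraph.Walk.getVert_zero]
        rw [if_pos hab.fst_mem]
        exact Nat.lt_succ_of_le (hrk _ hab.fst_mem)
      · simp only [h, if_false]
        rw [if_pos (E.pt_mem i 0 h1 (by omega) (Nat.zero_le _))]
        exact E.rk_fst i h1 (by omega)
    rk_lst := by
      intro i h1 h2
      by_cases h : i = E.k + 1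
      · simp only [h, if_true, SimpleGraph.Walk.getVert_length]
        rw [if_pos hab.snd_mem]
        exact Nat.lt_succ_of_le (hrk _ hab.snd_mem)
      · simp only [h, if_false]
        rw [if_pos (E.pt_mem i _ h1 (by omega) le_rfl)]
        exact E.rk_lst i h1 (by omega)
    inj := by
      intro i h1 h2 s t
      by_cases h : i = E.k + 1
      · simp only [h, if_true]
        exact fun hs ht he => hp.getVert_injOn hs ht he
      · simp only [h, if_false]
        exact E.inj i h1 (by omega) s t
    cover := by
      rintro v (hv | hv)
      · rcases E.cover v hv with h | h | ⟨i, j, h1, h2, h3, h4, h5⟩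
        · exact Or.inl h
        · exact Or.inr (Or.inl h)
        · refine Or.inr (Or.inr ⟨i, j, h1, by omega, h3, ?_⟩)
          have : i ≠ E.k + 1 := by omega
          simpa [this] using ⟨h4, h5⟩
      · by_cases hvH : v ∈ H.verts
        · rcases E.cover v hvH with h | h | ⟨i, j, h1, h2, h3, h4, h5⟩
          · exact Or.inl h
          · exact Or.inr (Or.inl h)
          · refine Or.inr (Or.inr ⟨i, j, h1, by omega, h3, ?_⟩)
            have : i ≠ E.k + 1 := by omega
            simpa [this] using ⟨h4, h5⟩
        · rw [SimpleGraph.Walk.verts_toSubgraph] at hv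
          obtain ⟨j, hj, hjl⟩ := (SimpleGraph.Walk.mem_support_iff_exists_getVert).1 hv
          refine Or.inr (Or.inr ⟨E.k + 1, j, by omega, le_rfl, ?_, ?_⟩)
          · rcases Nat.eq_zero_or_pos j with h0 | h0
            · subst h0
              exact absurd (by simpa [← hj] using hab.fst_mem) hvH
            · exact h0
          · simp only [if_true]
            refine ⟨lt_of_le_of_ne hjl ?_, hj.symm⟩
            rintro rfl
            exact absurd (by simpa [← hj] using hab.snd_mem) hvH
    ends_adj := by
      intro i h1 h2
      by_cases h : i = E.k + 1
      · simp only [h, if_true, SimpleGraph.Walk.getVert_zero, SimpleGraph.Walk.getVert_length]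
        exact Or.inl hab
      · simp only [h, if_false]
        exact Or.inl (E.ends_adj i h1 (by omega))
    adj_iff := by
      intro x y
      rw [SimpleGraph.Subgraph.sup_adj, E.adj_iff, SimpleGraph.Walk.toSubgraph_adj_iff]
      constructor
      · rintro ((h | ⟨i, j, h1, h2, h3⟩) | ⟨j, h1, h2⟩)
        · exact Or.inl h
        · refine Or.inr ⟨i, j, h1, by omega, ?_⟩
          have : i ≠ E.k + 1 := by omega
          simpa only [this, if_false] using h3
        · refine Or.inr ⟨E.k + 1, j, by omega, le_rfl, ?_⟩
          simpa only [if_true] using ⟨h2, h1.symm⟩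
      · rintro (h | ⟨i, j, h1, h2, h3⟩)
        · exact Or.inl (Or.inl h)
        · by_cases h : i = E.k + 1
          · simp only [h, if_true] at h3
            exact Or.inr ⟨j, h3.2.symm, h3.1⟩
          · simp only [h, if_false] at h3
            exact Or.inl (Or.inr ⟨i, j, h1, by omega, h3⟩) }

theorem rk_le {S : Set V} {R : V → V → Prop} {r₀ r₁ : V} (E : EarSystem S R r₀ r₁) {v : V}
    (hv : v ∈ S) : E.rk v ≤ E.k := by
  rcases E.cover v hv with rfl | rfl | ⟨i, j, h1, h2, h3, h4, rfl⟩
  · simp [E.rk_root₀]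
  · simp [E.rk_root₁]
  · rwa [E.rk_pt i j h1 h2 h3 h4]

end Construction

end EarSystem

section

variable {V : Type u} {G : SimpleGraph V}

theorem RootedPolygonal.nonempty_earSystem {r₀ r₁ : V} {H : G.Subgraph}
    (h : RootedPolygonal r₀ r₁ H) : Nonempty (EarSystem H.verts H.Adj r₀ r₁) := by
  induction h with
  | edge h => exact ⟨.ofEdge h⟩
  | addEar _ hab p hp hlen hV ih =>
    obtain ⟨E⟩ := ih
    exact ⟨E.addEar (fun _ => E.rk_le) hab p hp hlen hV⟩

/-- The rooted ear structure of a polygonal 2-tree at any of its edges. -/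
theorem IsPolygonal2Tree.nonempty_earSystem (hG : IsPolygonal2Tree G) {r₀ r₁ : V}
    (h : G.Adj r₀ r₁) : Nonempty (EarSystem Set.univ G.Adj r₀ r₁) :=
  (PolygonalSub.rooted hG r₀ r₁ h).nonempty_earSystem

theorem IsPolygonal2Tree.exists_adj (hG : IsPolygonal2Tree G) : ∃ a b, G.Adj a b :=
  PolygonalSub.exists_adj hG

end

/-! ### Ears, ranks and adjacency -/

namespace EarSystem

section Basics

variable {V : Type u} {G : SimpleGraph V} {r₀ r₁ : V} (E : EarSystem Set.univ G.Adj r₀ r₁)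

/-- The sequence `c` runs through the vertices of the ear `i`, in one of the two directions. -/
def Ori (i : ℕ) (c : ℕ → V) : Prop :=
  1 ≤ i ∧ i ≤ E.k ∧
    ((∀ t ≤ E.len i, c t = E.pt i t) ∨ ∀ t ≤ E.len i, c t = E.pt i (E.len i - t))

variable {E} {i : ℕ} {c : ℕ → V}

theorem ori_pt (h1 : 1 ≤ i) (h2 : i ≤ E.k) : E.Ori i (E.pt i) :=
  ⟨h1, h2, Or.inl fun _ _ => rfl⟩

theorem Ori.rev (h : E.Ori i c) : E.Ori i (fun t => c (E.len i - t)) := by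
  obtain ⟨h1, h2, h | h⟩ := h
  · exact ⟨h1, h2, Or.inr fun t _ => h _ (Nat.sub_le _ _)⟩
  · refine ⟨h1, h2, Or.inl fun t ht => ?_⟩
    have := h (E.len i - t) (Nat.sub_le _ _)
    rwa [Nat.sub_sub_self ht] at this

theorem Ori.two_le (h : E.Ori i c) : 2 ≤ E.len i := E.two_le i h.1 h.2.1

theorem Ori.rk_inner (h : E.Ori i c) {t : ℕ} (h0 : 0 < t) (ht : t < E.len i) :
    E.rk (c t) = i := by
  obtain ⟨h1, h2, h | h⟩ := h
  · rw [h t ht.le, E.rk_pt i t h1 h2 h0 ht]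
  · rw [h t ht.le, E.rk_pt i _ h1 h2 (by omega) (by omega)]

theorem Ori.rk_fst (h : E.Ori i c) : E.rk (c 0) < i := by
  obtain ⟨h1, h2, h | h⟩ := h
  · rw [h 0 (Nat.zero_le _)]
    exact E.rk_fst i h1 h2
  · rw [h 0 (Nat.zero_le _)]
    exact E.rk_lst i h1 h2

theorem Ori.rk_lst (h : E.Ori i c) : E.rk (c (E.len i)) < i := by
  simpa using h.rev.rk_fst

theorem Ori.rk_le (h : E.Ori i c) {t : ℕ} (ht : t ≤ E.len i) : E.rk (c t) ≤ i := by
  rcases Nat.eq_zero_or_pos t with rfl | h0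
  · exact h.rk_fst.le
  · rcases ht.eq_or_lt with rfl | h1
    · exact h.rk_lst.le
    · exact (h.rk_inner h0 h1).le

theorem Ori.inj (h : E.Ori i c) {a b : ℕ} (ha : a ≤ E.len i) (hb : b ≤ E.len i)
    (hab : c a = c b) : a = b := by
  obtain ⟨h1, h2, h | h⟩ := h
  · rw [h a ha, h b hb] at hab
    exact E.inj i h1 h2 a b ha hb hab
  · rw [h a ha, h b hb] at hab
    have := E.inj i h1 h2 _ _ (Nat.sub_le _ _) (Nat.sub_le _ _) hab
    omega

theorem Ori.adj_succ (h : E.Ori i c) {t : ℕ} (ht : t < E.len i) : G.Adj (c t) (c (t + 1)) := by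
  obtain ⟨h1, h2, h | h⟩ := h
  · rw [h t ht.le, h (t + 1) ht, E.adj_iff]
    exact Or.inr ⟨i, t, h1, h2, ht, rfl⟩
  · rw [h t ht.le, h (t + 1) ht, E.adj_iff]
    refine Or.inr ⟨i, E.len i - (t + 1), h1, h2, by omega, ?_⟩
    rw [show E.len i - (t + 1) + 1 = E.len i - t by omega, Sym2.eq_swap]

theorem Ori.ends_adj (h : E.Ori i c) : G.Adj (c 0) (c (E.len i)) := by
  obtain ⟨h1, h2, h | h⟩ := h
  · rw [h 0 (Nat.zero_le _), h _ le_rfl]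
    exact E.ends_adj i h1 h2
  · rw [h 0 (Nat.zero_le _), h _ le_rfl, Nat.sub_self, Nat.sub_zero]
    exact (E.ends_adj i h1 h2).symm

/-- An ear has just two directions. -/
theorem Ori.eq_or_rev (h : E.Ori i c) {c' : ℕ → V} (h' : E.Ori i c') :
    (∀ t ≤ E.len i, c' t = c t) ∨ ∀ t ≤ E.len i, c' t = c (E.len i - t) := by
  obtain ⟨-, -, h | h⟩ := h <;> obtain ⟨-, -, h' | h'⟩ := h'
  · exact Or.inl fun t ht => by rw [h t ht, h' t ht]
  · exact Or.inr fun t ht => by rw [h _ (Nat.sub_le _ _), h' t ht]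
  · exact Or.inr fun t ht => by rw [h _ (Nat.sub_le _ _), h' t ht, Nat.sub_sub_self ht]
  · exact Or.inl fun t ht => by rw [h t ht, h' t ht]

variable (E)

theorem exists_ori_of_ne {v : V} (h0 : v ≠ r₀) (h1 : v ≠ r₁) :
    ∃ i c t, E.Ori i c ∧ 0 < t ∧ t < E.len i ∧ v = c t := by
  rcases E.cover v (Set.mem_univ _) with h | h | ⟨i, j, h1, h2, h3, h4, h5⟩
  · exact absurd h h0
  · exact absurd h h1
  · exact ⟨i, _, j, ori_pt h1 h2, h3, h4, h5⟩

theorem root_of_rk_eq_zero {v : V} (h : E.rk v = 0) : v = r₀ ∨ v = r₁ := by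
  by_contra hv
  rw [not_or] at hv
  obtain ⟨i, c, t, hc, h0, ht, rfl⟩ := E.exists_ori_of_ne hv.1 hv.2
  rw [hc.rk_inner h0 ht] at h
  exact absurd hc.1 (by omega)

theorem exists_ori_of_rk_ne {v : V} (h : E.rk v ≠ 0) :
    ∃ c t, E.Ori (E.rk v) c ∧ 0 < t ∧ t < E.len (E.rk v) ∧ v = c t := by
  obtain ⟨i, c, t, hc, h0, ht, hv⟩ := E.exists_ori_of_ne (v := v)
    (by rintro rfl; exact h E.rk_root₀) (by rintro rfl; exact h E.rk_root₁)
  have : E.rk v = i := by rw [hv, hc.rk_inner h0 ht]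
  subst this
  exact ⟨c, t, hc, h0, ht, hv⟩

theorem adj_root (E : EarSystem Set.univ G.Adj r₀ r₁) : G.Adj r₀ r₁ := (E.adj_iff _ _).2 (Or.inl rfl)

theorem adj_cases {x y : V} (h : G.Adj x y) :
    s(x, y) = s(r₀, r₁) ∨ ∃ i c t, E.Ori i c ∧ t < E.len i ∧ x = c t ∧ y = c (t + 1) := by
  rcases (E.adj_iff _ _).1 h with h | ⟨i, j, h1, h2, hj, h⟩
  · exact Or.inl h
  · right
    rw [Sym2.eq_iff] at h
    rcases h with ⟨hx, hy⟩ | ⟨hx, hy⟩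
    · exact ⟨i, _, j, ori_pt h1 h2, hj, hx, hy⟩
    · refine ⟨i, _, E.len i - (j + 1), (ori_pt h1 h2).rev, by omega, ?_, ?_⟩
      · rw [hx]
        congr 1
        omega
      · rw [hy]
        congr 1
        omega

/-- Every edge lies on the ear whose number is the larger rank of its two ends. -/
theorem adj_cases_max {x y : V} (h : G.Adj x y) :
    (E.rk x = 0 ∧ E.rk y = 0 ∧ s(x, y) = s(r₀, r₁)) ∨
      ∃ c t, E.Ori (max (E.rk x) (E.rk y)) c ∧ t < E.len (max (E.rk x) (E.rk y)) ∧
        x = c t ∧ y = c (t + 1) := by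
  rcases E.adj_cases h with h | ⟨i, c, t, hc, ht, hx, hy⟩
  · left
    rcases Sym2.eq_iff.1 h with ⟨rfl, rfl⟩ | ⟨rfl, rfl⟩
    · exact ⟨E.rk_root₀, E.rk_root₁, h⟩
    · exact ⟨E.rk_root₁, E.rk_root₀, h⟩
  · right
    have : max (E.rk x) (E.rk y) = i := by
      have h2 := hc.two_le
      have hx1 := hc.rk_le ht.le
      have hy1 := hc.rk_le ht
      rw [← hx] at hx1
      rw [← hy] at hy1
      rcases Nat.eq_zero_or_pos t with h0 | h0
      · have : E.rk y = i := by
          rw [hy]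
          exact hc.rk_inner (by omega) (by omega)
        omega
      · have : E.rk x = i := by
          rw [hx]
          exact hc.rk_inner h0 ht
        omega
    rw [this]
    exact ⟨c, t, hc, ht, hx, hy⟩

variable {E}

theorem Ori.max_rk (hc : E.Ori i c) {t : ℕ} (ht : t < E.len i) :
    max (E.rk (c t)) (E.rk (c (t + 1))) = i := by
  have h2 := hc.two_le
  have hx1 := hc.rk_le ht.le
  have hy1 := hc.rk_le (t := t + 1) ht
  rcases Nat.eq_zero_or_pos t with h0 | h0
  · have := hc.rk_inner (t := t + 1) (by omega) (by omega)
    omega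
  · have := hc.rk_inner h0 ht
    omega

/-- The neighbours of a vertex: a root is adjacent to the other root, an inner vertex of an ear to
its neighbours on that ear, and every vertex to the first inner vertices of the ears that start
at it. -/
theorem adj_cases_fst {x y : V} (h : G.Adj x y) :
    s(x, y) = s(r₀, r₁) ∨
      (∃ c t, E.Ori (E.rk x) c ∧ 0 < t ∧ t < E.len (E.rk x) ∧ x = c t ∧ y = c (t + 1)) ∨
      ∃ i c, E.Ori i c ∧ E.rk x < i ∧ x = c 0 ∧ y = c 1 := by
  rcases E.adj_cases h with h | ⟨i, c, t, hc, ht, hx, hy⟩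
  · exact Or.inl h
  · right
    rcases Nat.eq_zero_or_pos t with rfl | h0
    · exact Or.inr ⟨i, c, hc, by rw [hx]; exact hc.rk_fst, hx, hy⟩
    · have : E.rk x = i := by rw [hx, hc.rk_inner h0 ht]
      subst this
      exact Or.inl ⟨c, t, hc, h0, ht, hx, hy⟩

/-- Of two vertices of an ear that are not consecutive on it, only the two ends are adjacent. -/
theorem Ori.adj_imp (hc : E.Ori i c) {a b : ℕ} (hab : a < b) (hb : b ≤ E.len i)
    (h : G.Adj (c a) (c b)) : b = a + 1 ∨ (a = 0 ∧ b = E.len i) := by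
  by_cases h1 : E.rk (c a) < i ∧ E.rk (c b) < i
  · right
    have ha : ¬(0 < a ∧ a < E.len i) := fun h' => absurd (hc.rk_inner h'.1 h'.2) (by omega)
    have hb : ¬(0 < b ∧ b < E.len i) := fun h' => absurd (hc.rk_inner h'.1 h'.2) (by omega)
    omega
  · left
    have hra := hc.rk_le (t := a) (by omega)
    have hrb := hc.rk_le hb
    have hm : max (E.rk (c a)) (E.rk (c b)) = i := by omega
    have hpos := hc.1
    rcases E.adj_cases_max h with h | ⟨c', t, hc', ht, hx, hy⟩
    · omega
    · rw [hm] at hc' ht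
      rcases hc.eq_or_rev hc' with he | he
      · rw [he _ ht.le] at hx
        rw [he _ ht] at hy
        have := hc.inj (by omega) (by omega) hx
        have := hc.inj (by omega) (by omega) hy
        omega
      · rw [he _ ht.le] at hx
        rw [he _ ht] at hy
        have := hc.inj (by omega) (by omega) hx
        have := hc.inj (by omega) (by omega) hy
        omega

/-- The neighbours of an inner vertex of an ear. -/
theorem Ori.nbr (hc : E.Ori i c) {t : ℕ} (h0 : 0 < t) (ht : t < E.len i) {w : V}
    (h : G.Adj (c t) w) :
    w = c (t - 1) ∨ w = c (t + 1) ∨ ∃ i' c', i < i' ∧ E.Ori i' c' ∧ c' 0 = c t ∧ w = c' 1 := by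
  have hr := hc.rk_inner h0 ht
  rcases E.adj_cases_fst h with h | ⟨c', t', hc', h0', ht', hx, hy⟩ | ⟨i', c', hc', hlt, hx, hy⟩
  · have := hc.1
    rcases Sym2.eq_iff.1 h with ⟨h, -⟩ | ⟨h, -⟩
    · rw [h, E.rk_root₀] at hr
      omega
    · rw [h, E.rk_root₁] at hr
      omega
  · rw [hr] at hc' ht'
    rcases hc.eq_or_rev hc' with he | he
    · rw [he _ ht'.le] at hx
      rw [he _ ht'] at hy
      have := hc.inj (by omega) (by omega) hx
      subst this
      exact Or.inr (Or.inl hy)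
    · rw [he _ ht'.le] at hx
      rw [he _ ht'] at hy
      have := hc.inj (by omega) (by omega) hx
      left
      rw [hy]
      congr 1
      omega
  · exact Or.inr (Or.inr ⟨i', c', by omega, hc', hx.symm, hy⟩)

theorem Ori.adj_pred (hc : E.Ori i c) {t : ℕ} (h0 : 0 < t) (ht : t ≤ E.len i) :
    G.Adj (c t) (c (t - 1)) := by
  have := hc.adj_succ (t := t - 1) (by omega)
  rw [Nat.sub_add_cancel h0] at this
  exact this.symm

/-! ### Separating non-adjacent vertices -/

/-- The descendants of `u`: `u` itself and the inner vertices of the ears with numbers larger than the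
rank of `u` that have an end among the descendants. -/
inductive Desc (E : EarSystem Set.univ G.Adj r₀ r₁) (u : V) : V → Prop
  | self : Desc E u u
  | step {i : ℕ} {c : ℕ → V} {t : ℕ} (hc : E.Ori i c) (hi : E.rk u < i) (h : Desc E u (c 0))
      (h0 : 0 < t) (ht : t < E.len i) : Desc E u (c t)

theorem Desc.eq_or_lt {u v : V} (h : Desc E u v) : v = u ∨ E.rk u < E.rk v := by
  cases h with
  | self => exact Or.inl rfl
  | step hc hi _ h0 ht => exact Or.inr (by rwa [hc.rk_inner h0 ht])

/-- An edge leaves the set of descendants of the inner vertex `c t` only to `c (t - 1)` or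
`c (t + 1)`. If an end of an ear is a descendant and the other end is not, the edge joining the two ends
is an edge of the same kind with smaller ranks, so the claim follows by induction. -/
theorem Desc.closed (hc : E.Ori i c) {t : ℕ} (h0 : 0 < t) (ht : t < E.len i) :
    ∀ (m : ℕ) (p q : V), max (E.rk p) (E.rk q) ≤ m → Desc E (c t) p → G.Adj p q →
      Desc E (c t) q ∨ q = c (t - 1) ∨ q = c (t + 1) := by
  have hr := hc.rk_inner h0 ht
  intro m
  induction m using Nat.strong_induction_on with
  | _ m ih =>
    intro p q hm hp hpq
    cases hp with
    | self =>
      rcases hc.nbr h0 ht hpq with h | h | ⟨i', c', hlt, hc', h1, h2⟩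
      · exact Or.inr (Or.inl h)
      · exact Or.inr (Or.inr h)
      · left
        rw [h2]
        exact .step hc' (by omega) (by rw [h1]; exact .self) (by omega)
          (by have := hc'.two_le; omega)
    | @step i' c' t' hc' hi hd h0' ht' =>
      have hr' := hc'.rk_inner h0' ht'
      have hfst := hc'.rk_fst
      have hlst := hc'.rk_lst
      have key : ∀ s, s ≤ E.len i' → q = c' s → Desc E (c t) q ∨ q = c (t - 1) ∨ q = c (t + 1) := by
        intro s hs hq
        subst hq
        rcases Nat.eq_zero_or_pos s with rfl | hs0
        · exact Or.inl hd
        · rcases hs.eq_or_lt with rfl | hs1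
          · exact ih (max (E.rk (c' 0)) (E.rk (c' (E.len i')))) (by omega) _ _ le_rfl hd
              hc'.ends_adj
          · exact Or.inl (.step hc' hi hd hs0 hs1)
      rcases hc'.nbr h0' ht' hpq with h | h | ⟨i'', c'', hlt, hc'', h1, h2⟩
      · exact key _ (by omega) h
      · exact key _ (by omega) h
      · left
        rw [h2]
        exact .step hc'' (by omega) (by rw [h1]; exact .step hc' hi hd h0' ht') (by omega)
          (by have := hc''.two_le; omega)

variable (E)

/-- Two distinct non-adjacent vertices of a polygonal 2-tree are separated by two vertices: every
path between them passes through one of the two. For the vertex of larger rank, take its two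
neighbours on its own ear. -/
theorem exists_separator (E : EarSystem Set.univ G.Adj r₀ r₁) {u v : V} (huv : u ≠ v) (hadj : ¬G.Adj u v) :
    ∃ x y : V, x ≠ u ∧ x ≠ v ∧ y ≠ u ∧ y ≠ v ∧
      ∀ q : G.Walk u v, x ∈ q.support ∨ y ∈ q.support := by
  wlog hle : E.rk v ≤ E.rk u generalizing u v
  · obtain ⟨x, y, h1, h2, h3, h4, h⟩ :=
      this huv.symm (fun h => hadj h.symm) (by omega)
    refine ⟨x, y, h2, h1, h4, h3, fun q => ?_⟩
    simpa using h q.reverse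
  have hu : E.rk u ≠ 0 := by
    intro h0
    rcases E.root_of_rk_eq_zero h0 with rfl | rfl <;>
    rcases E.root_of_rk_eq_zero (by omega : E.rk v = 0) with rfl | rfl
    · exact huv rfl
    · exact hadj E.adj_root
    · exact hadj E.adj_root.symm
    · exact huv rfl
  obtain ⟨c, t, hc, h0, ht, hut⟩ := E.exists_ori_of_rk_ne hu
  have hp := hc.adj_pred h0 ht.le
  have hs := hc.adj_succ ht
  rw [← hut] at hp hs
  refine ⟨c (t - 1), c (t + 1), hp.ne', fun h => hadj (h ▸ hp), hs.ne', fun h => hadj (h ▸ hs), ?_⟩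
  have key : ∀ {a : V} (q : G.Walk a v), Desc E u a →
      c (t - 1) ∈ q.support ∨ c (t + 1) ∈ q.support := by
    intro a q
    induction q with
    | nil =>
      intro hd
      rcases hd.eq_or_lt with h | h
      · exact absurd h.symm huv
      · omega
    | @cons a b _ hab q ih =>
      intro hd
      have := Desc.closed hc h0 ht _ a b le_rfl (by rwa [← hut]) hab
      rw [← hut] at this
      rcases this with h | h | h
      · exact (ih huv hadj hle h).imp (List.mem_cons_of_mem _) (List.mem_cons_of_mem _)
      · left
        rw [← h]
        simp
      · right
        rw [← h]
        simp
  exact fun q => key q .self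

end Basics

end EarSystem

/-! ### Nested ear decompositions are nice -/

section Nice

variable {V : Type u} {G : SimpleGraph V}

open SimpleGraph

theorem exists_two_walks_of_append {a b u v : V} (A : G.Walk a u) (B : G.Walk u v) (C : G.Walk v b)
    (hp : (A.append (B.append C)).IsPath) (hab : G.Adj a b) :
    ∃ q₁ q₂ : G.Walk u v, (∀ w ∈ q₁.support, w ∈ q₂.support → w = u ∨ w = v) ∧
      (∀ w ∈ q₁.support, w ∈ (A.append (B.append C)).support) ∧
      ∀ w ∈ q₂.support, w ∈ (A.append (B.append C)).support := by
  have hA := hp.support_nodup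
  rw [Walk.support_append] at hA
  have hB := (hp.of_append_right).support_nodup
  rw [Walk.support_append] at hB
  refine ⟨B, A.reverse.append (Walk.cons hab C.reverse), ?_, ?_, ?_⟩
  · intro w h1 h2
    simp only [Walk.mem_support_append_iff, Walk.support_reverse, List.mem_reverse,
      Walk.support_cons, List.mem_cons] at h2
    have hAB : w ∈ A.support → w = u := by
      intro hw
      by_contra hne
      have : w ∈ (B.append C).support := by simp [h1]
      rw [Walk.mem_support_iff] at this
      exact List.disjoint_of_nodup_append hA hw (this.resolve_left hne)
    have hBC : w ∈ C.support → w = v := by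
      intro hw
      by_contra hne
      rw [Walk.mem_support_iff] at hw
      exact List.disjoint_of_nodup_append hB h1 (hw.resolve_left hne)
    rcases h2 with h | rfl | h
    · exact Or.inl (hAB h)
    · exact Or.inl (hAB (by simp))
    · exact Or.inr (hBC h)
  · intro w h
    simp [h]
  · intro w h
    simp only [Walk.mem_support_append_iff, Walk.support_reverse, List.mem_reverse,
      Walk.support_cons, List.mem_cons] at h ⊢
    rcases h with h | rfl | h
    · exact Or.inl h
    · exact Or.inl (by simp)
    · exact Or.inr (Or.inr h)

/-- A path with adjacent ends closes to a cycle, which consists of two walks between any two of its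
vertices that share no inner vertex. -/
theorem exists_two_walks {a b u v : V} (p : G.Walk a b) (hp : p.IsPath) (hab : G.Adj a b)
    (hu : u ∈ p.support) (hv : v ∈ p.support) :
    ∃ q₁ q₂ : G.Walk u v, (∀ w ∈ q₁.support, w ∈ q₂.support → w = u ∨ w = v) ∧
      (∀ w ∈ q₁.support, w ∈ p.support) ∧ ∀ w ∈ q₂.support, w ∈ p.support := by
  classical
  have hpu := p.take_spec hu
  rw [← hpu, Walk.mem_support_append_iff] at hv
  rcases hv with hv | hv
  · have h2 := (p.takeUntil u hu).take_spec hv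
    have h3 : ((p.takeUntil u hu).takeUntil v hv).append
        (((p.takeUntil u hu).dropUntil v hv).append (p.dropUntil u hu)) = p := by
      rw [Walk.append_assoc, h2, hpu]
    obtain ⟨q₁, q₂, h⟩ := exists_two_walks_of_append _ _ _ (h3.symm ▸ hp) hab
    rw [h3] at h
    refine ⟨q₁.reverse, q₂.reverse, ?_, ?_, ?_⟩
    · intro w
      simpa [or_comm] using h.1 w
    · simpa using h.2.1
    · simpa using h.2.2
  · have h2 := (p.dropUntil u hu).take_spec hv
    have h3 : (p.takeUntil u hu).append (((p.dropUntil u hu).takeUntil v hv).append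
        ((p.dropUntil u hu).dropUntil v hv)) = p := by
      rw [h2, hpu]
    obtain ⟨q₁, q₂, h⟩ := exists_two_walks_of_append _ _ _ (h3.symm ▸ hp) hab
    rw [h3] at h
    exact ⟨q₁, q₂, h⟩

/-- If the ends `u`, `v` of an ear lie on an earlier ear `P`, then
`u` and `v` are joined by three walks without common inner vertices: the ear itself and the two
parts of the cycle that `P` and an edge joining the ends of `P` form. Hence `u` and `v` are
adjacent, and the edge `uv` cannot lie on a later ear. -/
theorem IsLongNestedEarDecomposition.isNice (hG : IsPolygonal2Tree G) {k : ℕ}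
    {D : Fin (k + 1) → Ear G} (hD : IsLongNestedEarDecomposition D) :
    IsNiceEarDecomposition D := by
  obtain ⟨r₀, r₁, hr⟩ := hG.exists_adj
  obtain ⟨E⟩ := hG.nonempty_earSystem hr
  refine { hD.toIsNestedEarDecomposition with first_edge := hD.first_edge, ends_adj := ?_ }
  intro i
  induction i using WellFoundedLT.induction with
  | _ i ih =>
    intro hi
    obtain ⟨j, hj, hu, hv⟩ := hD.ends_mem i hi
    have hne := hD.ends_ne i hi
    have hadjj : G.Adj (D j).src (D j).tgt := by
      by_cases hj0 : j = 0
      · rw [hj0]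
        exact Walk.adj_of_length_eq_one hD.first_edge
      · obtain ⟨j', -, h⟩ := ih j hj hj0
        exact (D j').walk.adj_of_mem_edges h
    have hadj : G.Adj (D i).src (D i).tgt := by
      by_contra hnot
      obtain ⟨x, y, hxu, hxv, hyu, hyv, hsep⟩ := E.exists_separator hne hnot
      obtain ⟨q₁, q₂, hq, hq₁, hq₂⟩ :=
        exists_two_walks (D j).walk (D j).isPath hadjj hu hv
      have h1 := hsep (D i).walk
      have h2 := hsep q₁
      have h3 := hsep q₂
      -- Three walks without common inner vertices cannot be separated by the two vertices `x`, `y`.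
      have key : ∀ z, z ≠ (D i).src → z ≠ (D i).tgt → (z ∈ (D i).walk.support → z ∉ q₁.support) ∧
          (z ∈ (D i).walk.support → z ∉ q₂.support) ∧ (z ∈ q₁.support → z ∉ q₂.support) := by
        intro z hz1 hz2
        refine ⟨fun h h' => ?_, fun h h' => ?_, fun h h' => ?_⟩
        · exact hD.internal_new i hi z h hz1 hz2 j hj (hq₁ z h')
        · exact hD.internal_new i hi z h hz1 hz2 j hj (hq₂ z h')
        · exact (hq z h h').elim hz1 hz2
      have hx := key x hxu hxv
      have hy := key y hyu hyv
      rcases h1 with h1 | h1 <;> rcases h2 with h2 | h2 <;> rcases h3 with h3 | h3 <;>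
        first
        | exact hx.1 h1 h2
        | exact hy.1 h1 h2
        | exact hx.2.1 h1 h3
        | exact hy.2.1 h1 h3
        | exact hx.2.2 h2 h3
        | exact hy.2.2 h2 h3
    obtain ⟨m, hm, -⟩ := hD.partition s((D i).src, (D i).tgt) hadj
    have hm' : s((D i).src, (D i).tgt) ∈ (D m).walk.edges := hm
    -- A path with at least two edges does not contain the edge between its own ends, which rules out
    -- `m = i`; if `i < m`, the ends of `D i` would be those of `D m`.
    rcases lt_trichotomy m i with h | h | h
    · exact ⟨m, h, hm⟩
    · subst h
      have := (D m).isPath.length_eq_one_of_mem_edges hm'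
      have h2 : 2 ≤ (D m).walk.length := hD.long m hi
      omega
    · have hm0 : m ≠ 0 := by
        rintro rfl
        exact absurd h (Fin.not_lt_zero _)
      have h2 : 2 ≤ (D m).walk.length := hD.long m hm0
      have hsu : (D i).src = (D m).src ∨ (D i).src = (D m).tgt := by
        by_contra hc
        rw [not_or] at hc
        exact hD.internal_new m hm0 _ ((D m).walk.fst_mem_support_of_mem_edges hm') hc.1 hc.2 i h
          (D i).walk.start_mem_support
      have hsv : (D i).tgt = (D m).src ∨ (D i).tgt = (D m).tgt := by
        by_contra hc
        rw [not_or] at hc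
        exact hD.internal_new m hm0 _ ((D m).walk.snd_mem_support_of_mem_edges hm') hc.1 hc.2 i h
          (D i).walk.end_mem_support
      have he : s((D i).src, (D i).tgt) = s((D m).src, (D m).tgt) := by
        rcases hsu with h1 | h1 <;> rcases hsv with h2 | h2
        · exact absurd (h1.trans h2.symm) hne
        · rw [h1, h2]
        · rw [h1, h2, Sym2.eq_swap]
        · exact absurd (h1.trans h2.symm) hne
      rw [he] at hm'
      have := (D m).isPath.length_eq_one_of_mem_edges hm'
      omega

end Nice

/-! ### Induced cycles -/

open SimpleGraph

section Walks

variable {V : Type u} {G : SimpleGraph V}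

/-- The walk through `c 0, …, c m`. -/
def walkOf (c : ℕ → V) : (m : ℕ) → (∀ t < m, G.Adj (c t) (c (t + 1))) → G.Walk (c 0) (c m)
  | 0, _ => .nil
  | m + 1, h => (walkOf c m fun t ht => h t (by omega)).concat (h m (by omega))

theorem support_walkOf (c : ℕ → V) (m : ℕ) (h : ∀ t < m, G.Adj (c t) (c (t + 1))) :
    (walkOf c m h).support = (List.range (m + 1)).map c := by
  induction m with
  | zero => simp [walkOf]
  | succ m ih =>
    rw [walkOf, Walk.support_concat, ih, List.range_succ (n := m + 1), List.map_append]
    simp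

theorem edges_walkOf (c : ℕ → V) (m : ℕ) (h : ∀ t < m, G.Adj (c t) (c (t + 1))) :
    (walkOf c m h).edges = (List.range m).map fun t => s(c t, c (t + 1)) := by
  induction m with
  | zero => simp [walkOf]
  | succ m ih =>
    rw [walkOf, Walk.edges_concat, ih, List.range_succ, List.map_append]
    simp

theorem length_walkOf (c : ℕ → V) (m : ℕ) (h : ∀ t < m, G.Adj (c t) (c (t + 1))) :
    (walkOf c m h).length = m := by
  induction m with
  | zero => simp [walkOf]
  | succ m ih => rw [walkOf, Walk.length_concat, ih]

end Walks

namespace EarSystem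

section Cycles

variable {V : Type u} {G : SimpleGraph V} {r₀ r₁ : V} {E : EarSystem Set.univ G.Adj r₀ r₁}
  {i : ℕ} {c : ℕ → V}

/-- The ear `i` as a walk in the direction given by `c`. -/
def Ori.walk (hc : E.Ori i c) : G.Walk (c 0) (c (E.len i)) :=
  walkOf c (E.len i) fun _ ht => hc.adj_succ ht

theorem Ori.support_walk (hc : E.Ori i c) :
    hc.walk.support = (List.range (E.len i + 1)).map c := support_walkOf _ _ _

theorem Ori.length_walk (hc : E.Ori i c) : hc.walk.length = E.len i := length_walkOf _ _ _

theorem Ori.mem_support_walk (hc : E.Ori i c) {v : V} :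
    v ∈ hc.walk.support ↔ ∃ t ≤ E.len i, v = c t := by
  rw [hc.support_walk]
  simp [eq_comm]

theorem Ori.mem_edges_walk (hc : E.Ori i c) {e : Sym2 V} :
    e ∈ hc.walk.edges ↔ ∃ t < E.len i, e = s(c t, c (t + 1)) := by
  rw [Ori.walk, edges_walkOf]
  simp [eq_comm]

theorem Ori.isPath_walk (hc : E.Ori i c) : hc.walk.IsPath := by
  rw [Walk.isPath_def, hc.support_walk]
  refine List.Nodup.map_on ?_ List.nodup_range
  intro a ha b hb hab
  exact hc.inj (by simpa [Nat.lt_succ_iff] using ha) (by simpa [Nat.lt_succ_iff] using hb) hab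

/-- The closed walk that consists of the edge joining the ends of the ear `i` and of this ear. -/
def Ori.closed (hc : E.Ori i c) : G.Walk (c (E.len i)) (c (E.len i)) :=
  .cons hc.ends_adj.symm hc.walk

theorem Ori.isCycle_closed (hc : E.Ori i c) : hc.closed.IsCycle := by
  rw [Ori.closed, Walk.cons_isCycle_iff]
  refine ⟨hc.isPath_walk, fun h => ?_⟩
  rw [Sym2.eq_swap] at h
  have := hc.isPath_walk.length_eq_one_of_mem_edges h
  have := hc.two_le
  have := hc.length_walk
  omega

variable (E) in
/-- The polygon of the ear `i`: the subgraph induced by the vertices of the ear. -/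
def cyc (i : ℕ) : G.Subgraph := (⊤ : G.Subgraph).induce {v | ∃ t ≤ E.len i, v = E.pt i t}

theorem Ori.mem_verts_cyc (hc : E.Ori i c) {v : V} :
    v ∈ (E.cyc i).verts ↔ ∃ t ≤ E.len i, v = c t := by
  change (∃ t ≤ E.len i, v = E.pt i t) ↔ _
  obtain ⟨-, -, h | h⟩ := hc
  · constructor
    · rintro ⟨t, ht, rfl⟩
      exact ⟨t, ht, (h t ht).symm⟩
    · rintro ⟨t, ht, rfl⟩
      exact ⟨t, ht, h t ht⟩
  · constructor
    · rintro ⟨t, ht, rfl⟩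
      refine ⟨E.len i - t, Nat.sub_le _ _, ?_⟩
      rw [h _ (Nat.sub_le _ _), Nat.sub_sub_self ht]
    · rintro ⟨t, ht, rfl⟩
      exact ⟨E.len i - t, Nat.sub_le _ _, h t ht⟩

theorem Ori.cyc_eq (hc : E.Ori i c) : E.cyc i = hc.closed.toSubgraph := by
  have hv : (E.cyc i).verts = hc.closed.toSubgraph.verts := by
    ext v
    rw [hc.mem_verts_cyc, Walk.verts_toSubgraph, Set.mem_ofPred_eq, Ori.closed,
      Walk.support_cons, List.mem_cons, hc.mem_support_walk]
    constructor
    · exact Or.inr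
    · rintro (h | h)
      · exact ⟨_, le_rfl, h⟩
      · exact h
  refine Subgraph.ext hv ?_
  ext x y
  rw [Walk.adj_toSubgraph_iff_mem_edges, Ori.closed, Walk.edges_cons, List.mem_cons,
    hc.mem_edges_walk]
  constructor
  · rintro ⟨hx, hy, hxy⟩
    obtain ⟨a, ha, rfl⟩ := hc.mem_verts_cyc.1 hx
    obtain ⟨b, hb, rfl⟩ := hc.mem_verts_cyc.1 hy
    replace hxy : G.Adj (c a) (c b) := hxy
    rcases lt_trichotomy a b with h | h | h
    · rcases hc.adj_imp h hb hxy with rfl | ⟨rfl, rfl⟩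
      · exact Or.inr ⟨a, by omega, rfl⟩
      · exact Or.inl Sym2.eq_swap
    · subst h
      exact absurd hxy (G.irrefl)
    · rcases hc.adj_imp h ha hxy.symm with rfl | ⟨rfl, rfl⟩
      · exact Or.inr ⟨b, by omega, Sym2.eq_swap⟩
      · exact Or.inl rfl
  · have key : ∀ a b, a ≤ E.len i → b ≤ E.len i → G.Adj (c a) (c b) →
        (E.cyc i).Adj (c a) (c b) := fun a b ha hb h =>
      ⟨hc.mem_verts_cyc.2 ⟨a, ha, rfl⟩, hc.mem_verts_cyc.2 ⟨b, hb, rfl⟩, h⟩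
    rintro (h | ⟨t, ht, h⟩)
    · rcases Sym2.eq_iff.1 h with ⟨rfl, rfl⟩ | ⟨rfl, rfl⟩
      · exact key _ _ le_rfl (Nat.zero_le _) hc.ends_adj.symm
      · exact key _ _ (Nat.zero_le _) le_rfl hc.ends_adj
    · rcases Sym2.eq_iff.1 h with ⟨rfl, rfl⟩ | ⟨rfl, rfl⟩
      · exact key _ _ ht.le ht (hc.adj_succ ht)
      · exact key _ _ ht ht.le (hc.adj_succ ht).symm

theorem cyc_mem_inducedCycles (h1 : 1 ≤ i) (h2 : i ≤ E.k) : E.cyc i ∈ inducedCycles G := by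
  have hc := E.ori_pt h1 h2
  exact ⟨fun _ hu _ hv h => ⟨hu, hv, h⟩, _, hc.closed, hc.isCycle_closed, hc.cyc_eq⟩

/-- The number of an ear is the largest rank on its polygon. -/
theorem cyc_injOn : Set.InjOn E.cyc (Set.Icc 1 E.k) := by
  have key : ∀ i j, i ∈ Set.Icc 1 E.k → j ∈ Set.Icc 1 E.k → E.cyc i = E.cyc j → i ≤ j := by
    intro i j hi hj h
    have hc := E.ori_pt hi.1 hi.2
    have h2 := hc.two_le
    have hm : E.pt i 1 ∈ (E.cyc i).verts := hc.mem_verts_cyc.2 ⟨1, by omega, rfl⟩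
    rw [h, (E.ori_pt hj.1 hj.2).mem_verts_cyc] at hm
    obtain ⟨t, ht, he⟩ := hm
    have h3 := (E.ori_pt hj.1 hj.2).rk_le ht
    rwa [← he, hc.rk_inner (by omega) (by omega)] at h3
  exact fun i hi j hj h => le_antisymm (key i j hi hj h) (key j i hj hi h.symm)

/-- Every induced cycle is the polygon of the ear whose number is the largest rank `i` of its
vertices: an inner vertex of the ear `i` has only two neighbours of rank at most `i`, so the cycle
follows the whole ear, and being induced it contains the edge that joins the two ends. -/
theorem exists_eq_cyc {C : G.Subgraph} (hC : C ∈ inducedCycles G)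
    (E : EarSystem Set.univ G.Adj r₀ r₁) : ∃ i, 1 ≤ i ∧ i ≤ E.k ∧ C = E.cyc i := by
  obtain ⟨hind, a, w, hw, hCw⟩ := hC
  have hnb : ∀ x ∈ C.verts, (C.neighborSet x).ncard = 2 := by
    intro x hx
    rw [hCw] at hx ⊢
    exact hw.ncard_neighborSet_toSubgraph_eq_two (by simpa using hx)
  have hfin : C.verts.Finite := by
    rw [hCw, Walk.verts_toSubgraph]
    exact List.finite_toSet w.support
  have hne : C.verts.Nonempty := ⟨a, by simp [hCw]⟩
  obtain ⟨v, hv, hmax⟩ := Set.exists_max_image C.verts E.rk hfin hne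
  have hfinN : ∀ x, (C.neighborSet x).Finite := fun x =>
    hfin.subset fun y hy => C.edge_vert hy.symm
  have hv0 : E.rk v ≠ 0 := by
    intro h0
    have hall : ∀ x ∈ C.verts, x = r₀ ∨ x = r₁ := fun x hx =>
      E.root_of_rk_eq_zero (by have := hmax x hx; omega)
    have hsub : C.neighborSet v ⊆ ({r₀, r₁} : Set V) \ {v} := by
      intro x hx
      exact ⟨hall x (C.edge_vert hx.symm), fun h => (C.adj_sub hx).ne h.symm⟩
    have h2 := Set.ncard_le_ncard hsub (Set.toFinite _)
    rw [hnb v hv] at h2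
    have h3 := Set.ncard_sdiff_singleton_lt_of_mem (s := {r₀, r₁}) (a := v) (hall v hv)
      (Set.toFinite _)
    have h4 := Set.ncard_insert_le r₀ {r₁}
    rw [Set.ncard_singleton] at h4
    omega
  obtain ⟨c, t, hc, h0, ht, hvt⟩ := E.exists_ori_of_rk_ne hv0
  set i := E.rk v with hi
  have hinner : ∀ s, 0 < s → s < E.len i → c s ∈ C.verts →
      C.neighborSet (c s) = {c (s - 1), c (s + 1)} := by
    intro s hs0 hs hm
    refine Set.eq_of_subset_of_ncard_le ?_ ?_ (Set.toFinite _)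
    · intro x hx
      rcases hc.nbr hs0 hs (C.adj_sub hx) with h | h | ⟨i', c', hlt, hc', -, h⟩
      · exact Or.inl h
      · exact Or.inr h
      · exfalso
        have h2 := hc'.two_le
        have h3 := hmax x (C.edge_vert hx.symm)
        rw [h, hc'.rk_inner (by omega) (by omega)] at h3
        omega
    · rw [hnb _ hm]
      have := Set.ncard_insert_le (c (s - 1)) {c (s + 1)}
      rw [Set.ncard_singleton] at this
      omega
  have hvC : c t ∈ C.verts := hvt ▸ hv
  -- Starting at `v`, the cycle follows the ear in both directions.
  have hup : ∀ d, t + d ≤ E.len i → c (t + d) ∈ C.verts := by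
    intro d
    induction d with
    | zero => exact fun _ => hvC
    | succ d ih =>
      intro hd
      have h1 := hinner (t + d) (by omega) (by omega) (ih (by omega))
      have : c (t + d + 1) ∈ C.neighborSet (c (t + d)) := by simp [h1]
      exact C.edge_vert this.symm
  have hdown : ∀ d, d ≤ t → c (t - d) ∈ C.verts := by
    intro d
    induction d with
    | zero => exact fun _ => hvC
    | succ d ih =>
      intro hd
      have h1 := hinner (t - d) (by omega) (by omega) (ih (by omega))
      have : c (t - d - 1) ∈ C.neighborSet (c (t - d)) := by simp [h1]
      rw [show t - (d + 1) = t - d - 1 by omega]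
      exact C.edge_vert this.symm
  have hall : ∀ s ≤ E.len i, c s ∈ C.verts := by
    intro s hs
    rcases le_total s t with h | h
    · have := hdown (t - s) (by omega)
      rwa [Nat.sub_sub_self h] at this
    · have := hup (s - t) (by omega)
      rwa [Nat.add_sub_cancel' h] at this
  have h2 := hc.two_le
  have hends : ∀ x y, C.Adj (c x) (c y) → ∀ z, C.Adj (c x) (c z) → c y ≠ c z →
      C.neighborSet (c x) = {c y, c z} := by
    intro x y hxy z hxz hyz
    symm
    refine Set.eq_of_subset_of_ncard_le ?_ ?_ (hfinN _)
    · rintro w (rfl | rfl)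
      · exact hxy
      · exact hxz
    · rw [hnb _ (C.edge_vert hxy), Set.ncard_pair hyz]
  have hadj : ∀ x y, x ≤ E.len i → y ≤ E.len i → G.Adj (c x) (c y) → C.Adj (c x) (c y) :=
    fun x y hx hy h => hind (hall x hx) (hall y hy) h
  -- The cycle cannot leave the ear; at the two ends, the edge between them is the second edge.
  have hclosed : ∀ s ≤ E.len i, ∀ y, C.Adj (c s) y → ∃ r ≤ E.len i, y = c r := by
    intro s hs y hy
    have hy' : y ∈ C.neighborSet (c s) := hy
    rcases Nat.eq_zero_or_pos s with rfl | hs0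
    · rw [hends 0 1 (hadj _ _ (by omega) (by omega) (hc.adj_succ (by omega))) (E.len i)
        (hadj _ _ (by omega) le_rfl hc.ends_adj)
        (fun h => by have := hc.inj (by omega) le_rfl h; omega)] at hy'
      rcases hy' with h | h
      · exact ⟨1, by omega, h⟩
      · exact ⟨_, le_rfl, h⟩
    · rcases hs.eq_or_lt with rfl | hs1
      · rw [hends (E.len i) 0 (hadj _ _ le_rfl (by omega) hc.ends_adj.symm) (E.len i - 1)
          (hadj _ _ le_rfl (by omega) (hc.adj_pred (by omega) le_rfl))
          (fun h => by have := hc.inj (by omega) (by omega) h; omega)] at hy'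
        rcases hy' with h | h
        · exact ⟨0, by omega, h⟩
        · exact ⟨_, by omega, h⟩
      · rw [hinner s hs0 hs1 (hall s hs)] at hy'
        rcases hy' with h | h
        · exact ⟨_, by omega, h⟩
        · exact ⟨_, by omega, h⟩
  refine ⟨i, hc.1, hc.2.1, ?_⟩
  have hverts : C.verts = (E.cyc i).verts := by
    apply Set.Subset.antisymm
    · intro y hy
      rw [hc.mem_verts_cyc]
      have hconn : C.Connected := by
        rw [hCw]
        exact w.toSubgraph_connected
      obtain ⟨q⟩ := hconn.coe.preconnected ⟨c t, hvC⟩ ⟨y, hy⟩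
      have key : ∀ {x z : C.verts} (q : C.coe.Walk x z), (∃ r ≤ E.len i, (x : V) = c r) →
          ∃ r ≤ E.len i, (z : V) = c r := by
        intro x z q
        induction q with
        | nil => exact id
        | cons h _ ih =>
          rintro ⟨r, hr, hx⟩
          apply ih
          apply hclosed r hr
          rw [← hx]
          exact h
      exact key q ⟨t, ht.le, rfl⟩
    · intro y hy
      obtain ⟨s, hs, rfl⟩ := hc.mem_verts_cyc.1 hy
      exact hall s hs
  refine Subgraph.ext hverts ?_
  ext x y
  constructor
  · intro h
    exact ⟨hverts.subset (C.edge_vert h), hverts.subset (C.edge_vert h.symm), C.adj_sub h⟩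
  · rintro ⟨hx, hy, h⟩
    exact hind (hverts.symm ▸ hx) (hverts.symm ▸ hy) h

theorem inducedCycles_eq (E : EarSystem Set.univ G.Adj r₀ r₁) :
    inducedCycles G = E.cyc '' Set.Icc 1 E.k := by
  ext C
  constructor
  · intro h
    obtain ⟨i, h1, h2, rfl⟩ := exists_eq_cyc h E
    exact ⟨i, ⟨h1, h2⟩, rfl⟩
  · rintro ⟨i, hi, rfl⟩
    exact cyc_mem_inducedCycles hi.1 hi.2

theorem ncard_edgeSet_cyc_le (h1 : 1 ≤ i) (h2 : i ≤ E.k) :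
    (E.cyc i).edgeSet.ncard ≤ E.len i + 1 := by
  classical
  have hc := E.ori_pt h1 h2
  have : (E.cyc i).edgeSet = (hc.closed.edges.toFinset : Set (Sym2 V)) := by
    ext e
    rw [hc.cyc_eq]
    simp
  rw [this, Set.ncard_coe_finset]
  refine (List.toFinset_card_le _).trans ?_
  rw [Walk.length_edges, Ori.closed, Walk.length_cons, hc.length_walk]

/-- The sets of inner vertices of the ears are disjoint. -/
theorem sum_len_le [Fintype V] (E : EarSystem Set.univ G.Adj r₀ r₁) :
    ∑ i ∈ Finset.Icc 1 E.k, (E.len i - 1) ≤ Fintype.card V := by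
  classical
  have : ∑ i ∈ Finset.Icc 1 E.k, (E.len i - 1) =
      ((Finset.Icc 1 E.k).sigma fun i => Finset.Ioo 0 (E.len i)).card := by
    simp [Finset.card_sigma]
  rw [this, ← Finset.card_univ]
  refine Finset.card_le_card_of_injOn (fun x => E.pt x.1 x.2) (fun _ _ => Finset.mem_univ _) ?_
  rintro ⟨i, s⟩ hx ⟨j, t⟩ hy h
  simp only [Finset.coe_sigma, Set.mem_sigma_iff, Finset.coe_Icc, Set.mem_Icc, Finset.coe_Ioo,
    Set.mem_Ioo] at hx hy h
  have hi := E.ori_pt hx.1.1 hx.1.2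
  have h1 := hi.rk_inner hx.2.1 hx.2.2
  have h2 := (E.ori_pt hy.1.1 hy.1.2).rk_inner hy.2.1 hy.2.2
  rw [h, h2] at h1
  subst h1
  rw [hi.inj hx.2.2.le hy.2.2.le h]

theorem sum_len_add_one_le [Fintype V] (E : EarSystem Set.univ G.Adj r₀ r₁) :
    ∑ i ∈ Finset.Icc 1 E.k, (E.len i + 1) ≤ 3 * Fintype.card V := by
  refine le_trans ?_ (Nat.mul_le_mul_left 3 E.sum_len_le)
  rw [Finset.mul_sum]
  refine Finset.sum_le_sum fun i hi => ?_
  rw [Finset.mem_Icc] at hi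
  have := E.two_le i hi.1 hi.2
  omega

end Cycles

end EarSystem

/-- A linear bound for the total size: a polygon with `ℓ + 1` edges has `ℓ - 1` inner vertices on its
ear, and `ℓ + 1 ≤ 3 (ℓ - 1)`. -/
theorem IsPolygonal2Tree.size_inducedCycles_le {V : Type u} [Fintype V] {G : SimpleGraph V}
    (hG : IsPolygonal2Tree G) : size (inducedCycles G) ≤ 3 * Fintype.card V := by
  obtain ⟨r₀, r₁, hr⟩ := hG.exists_adj
  obtain ⟨E⟩ := hG.nonempty_earSystem hr
  rw [size, E.inducedCycles_eq, finsum_mem_image EarSystem.cyc_injOn]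
  rw [← Finset.coe_Icc, finsum_mem_coe_finset]
  refine le_trans (Finset.sum_le_sum fun i hi => ?_) E.sum_len_add_one_le
  rw [Finset.mem_Icc] at hi
  exact EarSystem.ncard_edgeSet_cyc_le hi.1 hi.2

/-! ### Ear decompositions from an order of the ears -/

open SimpleGraph

/-- The edge sets of the subpaths in the nesting condition are single edges or the whole ear; such sets
are always nested or disjoint. -/
theorem nested_of_eq_singleton_or_eq {α : Type*} {A B T : Set α} {a b : α} (hA : A = {a} ∨ A = T)
    (hB : B = {b} ∨ B = T) (hAT : A ⊆ T) (hBT : B ⊆ T) : A ⊆ B ∨ B ⊆ A ∨ A ∩ B = ∅ := by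
  rcases hA with rfl | rfl
  · rcases hB with rfl | rfl
    · by_cases h : a = b
      · exact Or.inl (by rw [h])
      · exact Or.inr (Or.inr (Set.singleton_inter_eq_empty.2 h))
    · exact Or.inl hAT
  · exact Or.inr (Or.inl hBT)

namespace EarSystem

section Decomposition

variable {V : Type u} {G : SimpleGraph V} {r₀ r₁ : V} {E : EarSystem Set.univ G.Adj r₀ r₁}
  {i : ℕ} {c : ℕ → V}

/-- The ear `i`, traversed in the direction given by `c`. -/
def Ori.toEar (hc : E.Ori i c) : Ear G where
  src := c 0
  tgt := c (E.len i)
  walk := hc.walk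
  isPath := hc.isPath_walk
  length_pos := by
    rw [hc.length_walk]
    have := hc.two_le
    omega

variable (E) in
/-- The root edge as an ear. -/
def rootEar : Ear G where
  src := r₀
  tgt := r₁
  walk := .cons E.adj_root .nil
  isPath := by simpa using E.root_ne
  length_pos := by simp

/-- The subpath of an ear between two adjacent vertices of the ear is a single edge or the whole
ear. -/
theorem Ori.subpath (hc : E.Ori i c) {u v : V} (q : G.Walk u v) (hq : q.IsPath)
    (hu : u ∈ hc.walk.support) (hv : v ∈ hc.walk.support) (huv : G.Adj u v)
    (hsub : ∀ e ∈ q.edges, e ∈ hc.walk.edges) :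
    (∀ e, e ∈ q.edges ↔ e = s(u, v)) ∨ ∀ e, e ∈ q.edges ↔ e ∈ hc.walk.edges := by
  obtain ⟨a, ha, rfl⟩ := hc.mem_support_walk.1 hu
  obtain ⟨b, hb, rfl⟩ := hc.mem_support_walk.1 hv
  wlog hab : a < b generalizing a b
  · have hne : a ≠ b := by
      rintro rfl
      exact G.irrefl huv
    have := this b hb hv a ha hu q.reverse hq.reverse huv.symm (by simpa using hsub) (by omega)
    simpa [Sym2.eq_swap] using this
  -- The edge from `c s` to `c (s + 1)` is the only edge of the ear that leaves `{c 0, …, c s}`.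
  have hcut : ∀ s, a ≤ s → s < b → s(c s, c (s + 1)) ∈ q.edges := by
    intro s hs1 hs2
    obtain ⟨d, hd, h1, h2⟩ := q.exists_boundary_dart {x | ∃ r ≤ s, x = c r} ⟨a, hs1, rfl⟩ (by
      rintro ⟨r, hr, h⟩
      have := hc.inj hb (by omega) h
      omega)
    have hde : d.edge ∈ q.edges := List.mem_map_of_mem hd
    obtain ⟨t, ht, hdt⟩ := hc.mem_edges_walk.1 (hsub _ hde)
    obtain ⟨r, hr, h1⟩ := h1
    have h2' : ∀ r' ≤ s, d.snd ≠ c r' := fun r' hr' h => h2 ⟨r', hr', h⟩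
    have hd' : s(d.fst, d.snd) = s(c t, c (t + 1)) := hdt
    have hts : t = s := by
      rcases Sym2.eq_iff.1 hd' with ⟨h3, h4⟩ | ⟨h3, h4⟩
      · have := hc.inj (by omega) (by omega) (h1.symm.trans h3)
        have : ¬t + 1 ≤ s := fun h => h2' _ h h4
        omega
      · have := hc.inj (by omega) (by omega) (h1.symm.trans h3)
        exact absurd h4 (h2' _ (by omega))
    rw [hdt, hts] at hde
    exact hde
  rcases hc.adj_imp hab hb huv with rfl | ⟨rfl, rfl⟩
  · left
    have hm := hcut a le_rfl (by omega)
    have := hq.eq_adj_toWalk_of_mem_edges hm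
    rw [this]
    intro e
    simp
  · right
    intro e
    refine ⟨hsub e, fun he => ?_⟩
    obtain ⟨t, ht, rfl⟩ := hc.mem_edges_walk.1 he
    exact hcut t (Nat.zero_le _) ht

variable (E) in
/-- The root edge followed by the ears `σ 0, σ 1, …`, traversed in the directions `c 0, c 1, …`. -/
def earSeq {m : ℕ} {σ : Fin m → ℕ} {c : Fin m → ℕ → V} (hc : ∀ e, E.Ori (σ e) (c e)) :
    Fin (m + 1) → Ear G :=
  Fin.cons E.rootEar fun e => (hc e).toEar

section

variable {m : ℕ} {σ : Fin m → ℕ} {c : Fin m → ℕ → V} (hc : ∀ e, E.Ori (σ e) (c e))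

theorem earSeq_zero : E.earSeq hc 0 = E.rootEar := rfl

theorem mem_edges_earSeq (j : Fin (m + 1)) {x y : V} (h : s(x, y) ∈ (E.earSeq hc j).edges) :
    max (E.rk x) (E.rk y) = (Fin.cons 0 σ : Fin (m + 1) → ℕ) j := by
  induction j using Fin.cases with
  | zero =>
    have h' : s(x, y) = s(r₀, r₁) := by simpa [earSeq_zero, rootEar, Ear.edges] using h
    rcases Sym2.eq_iff.1 h' with ⟨rfl, rfl⟩ | ⟨rfl, rfl⟩ <;> simp [E.rk_root₀, E.rk_root₁]
  | succ e =>
    obtain ⟨t, ht, h'⟩ := (hc e).mem_edges_walk.1 h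
    have := (hc e).max_rk ht
    rcases Sym2.eq_iff.1 h' with ⟨rfl, rfl⟩ | ⟨rfl, rfl⟩
    · simpa using this
    · simpa [max_comm] using this

theorem exists_mem_edges_earSeq (hsurj : ∀ i, 1 ≤ i → i ≤ E.k → ∃ e, σ e = i) {x y : V}
    (h : G.Adj x y) : ∃ j, s(x, y) ∈ (E.earSeq hc j).edges := by
  rcases E.adj_cases_max h with ⟨-, -, h⟩ | ⟨c', t, hc', ht, rfl, rfl⟩
  · refine ⟨0, ?_⟩
    rw [h]
    simp [earSeq_zero, rootEar, Ear.edges]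
  · obtain ⟨e, he⟩ := hsurj _ hc'.1 hc'.2.1
    refine ⟨e.succ, (hc e).mem_edges_walk.2 ?_⟩
    rw [he]
    have hce := hc e
    rw [he] at hce
    rcases hce.eq_or_rev hc' with hr | hr
    · exact ⟨t, ht, by rw [← hr _ ht.le, ← hr _ ht]⟩
    · refine ⟨E.len (max (E.rk (c' t)) (E.rk (c' (t + 1)))) - (t + 1), by omega, ?_⟩
      have h1 := hr t ht.le
      have h2 := hr (t + 1) ht
      rw [show E.len (max (E.rk (c' t)) (E.rk (c' (t + 1)))) - (t + 1) + 1 =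
        E.len (max (E.rk (c' t)) (E.rk (c' (t + 1)))) - t by omega, ← h1, ← h2, Sym2.eq_swap]

/-- The root edge followed by all ears is a nested ear decomposition if an ear that has an end at
an inner vertex of another ear comes after this ear. As the ends of every ear are adjacent, the subpath
of an ear between them is a single edge or the whole ear, whence the nesting condition. -/
theorem isLongNested_earSeq (hinj : Function.Injective σ)
    (hsurj : ∀ i, 1 ≤ i → i ≤ E.k → ∃ e, σ e = i)
    (horder : ∀ e e' : Fin m, (E.rk (c e 0) = σ e' ∨ E.rk (c e (E.len (σ e))) = σ e') → e' < e) :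
    IsLongNestedEarDecomposition (E.earSeq hc) := by
  have hτ : Function.Injective (Fin.cons 0 σ : Fin (m + 1) → ℕ) := by
    rw [Fin.cons_injective_iff]
    refine ⟨?_, hinj⟩
    rintro ⟨e, he⟩
    have := (hc e).1
    omega
  have hends : ∀ e, G.Adj (c e 0) (c e (E.len (σ e))) := fun e => (hc e).ends_adj
  have hquot : ∀ (j : Fin (m + 1)) (e : Fin m), (c e 0) ∈ (E.earSeq hc j).verts →
      (c e (E.len (σ e))) ∈ (E.earSeq hc j).verts →
      ∀ q : G.Walk (c e 0) (c e (E.len (σ e))), q.IsPath →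
      {e | e ∈ q.edges} ⊆ (E.earSeq hc j).edges →
      {e | e ∈ q.edges} = {s(c e 0, c e (E.len (σ e)))} ∨
        {e | e ∈ q.edges} = (E.earSeq hc j).edges := by
    intro j e h1 h2 q hq hsub
    induction j using Fin.cases with
    | zero =>
      right
      refine Set.Subset.antisymm hsub ?_
      have hroot : (E.earSeq hc 0).edges = {s(r₀, r₁)} := by
        ext
        simp [earSeq_zero, rootEar, Ear.edges]
      rw [hroot] at hsub ⊢
      rw [Set.singleton_subset_iff]
      obtain ⟨x, hx⟩ := List.exists_mem_of_ne_nil q.edges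
        (fun h => Walk.not_nil_of_ne (hends e).ne (Walk.edges_eq_nil.1 h))
      rw [← show x = s(r₀, r₁) from hsub hx]
      exact hx
    | succ e' =>
      rcases (hc e').subpath q hq h1 h2 (hends e) hsub with h | h
      · left
        ext x
        exact h x
      · right
        ext x
        exact h x
  refine { partition := ?_, ends_ne := ?_, internal_new := ?_, ends_mem := ?_, nested := ?_,
           first_edge := ?_, long := ?_ }
  · intro e
    induction e using Sym2.ind with
    | _ x y =>
      intro h
      obtain ⟨j, hj⟩ := exists_mem_edges_earSeq hc hsurj h
      refine ⟨j, hj, fun j' hj' => hτ ?_⟩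
      rw [← mem_edges_earSeq hc j hj, ← mem_edges_earSeq hc j' hj']
  · intro i
    induction i using Fin.cases with
    | zero => exact fun h => absurd rfl h
    | succ e => exact fun _ => (hends e).ne
  · intro i
    induction i using Fin.cases with
    | zero => exact fun h => absurd rfl h
    | succ e =>
      intro _ w hw hws hwt j hj hwj
      obtain ⟨t, ht, rfl⟩ := (hc e).mem_support_walk.1 hw
      have ht0 : 0 < t := Nat.pos_of_ne_zero fun h => hws (by rw [h]; rfl)
      have ht1 : t < E.len (σ e) := lt_of_le_of_ne ht fun h => hwt (by rw [h]; rfl)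
      have hr := (hc e).rk_inner ht0 ht1
      induction j using Fin.cases with
      | zero =>
        have h' : c e t = r₀ ∨ c e t = r₁ := by
          simpa [earSeq_zero, rootEar, Ear.verts] using hwj
        have := (hc e).1
        rcases h' with h' | h'
        · rw [h', E.rk_root₀] at hr
          omega
        · rw [h', E.rk_root₁] at hr
          omega
      | succ e' =>
        obtain ⟨s, hs, h⟩ := (hc e').mem_support_walk.1 hwj
        have hlt : e' < e := by simpa using hj
        by_cases hs' : 0 < s ∧ s < E.len (σ e')
        · rw [h, (hc e').rk_inner hs'.1 hs'.2] at hr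
          exact absurd (hinj hr) hlt.ne
        · have hend : E.rk (c e' 0) = σ e ∨ E.rk (c e' (E.len (σ e'))) = σ e := by
            rcases Nat.eq_zero_or_pos s with rfl | h0
            · left
              rw [← h, hr]
            · right
              rw [show E.len (σ e') = s by omega, ← h, hr]
          exact absurd (horder e' e hend) (by omega)
  · intro i
    induction i using Fin.cases with
    | zero => exact fun h => absurd rfl h
    | succ e =>
      intro _
      obtain ⟨j, hj⟩ := exists_mem_edges_earSeq hc hsurj (hends e)
      refine ⟨j, ?_, Walk.fst_mem_support_of_mem_edges _ hj,
        Walk.snd_mem_support_of_mem_edges _ hj⟩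
      have hm := mem_edges_earSeq hc j hj
      induction j using Fin.cases with
      | zero => exact Fin.succ_pos e
      | succ e' =>
        rw [Fin.cons_succ] at hm
        have := horder e e' (by omega)
        simpa using this
  · intro j i i'
    induction i using Fin.cases with
    | zero => exact fun h => absurd h (Fin.not_lt_zero _)
    | succ e =>
      induction i' using Fin.cases with
      | zero => exact fun _ h => absurd h (Fin.not_lt_zero _)
      | succ e' =>
        intro _ _ _ h1 h2 h3 h4 q q' hq hq' hs hs'
        exact nested_of_eq_singleton_or_eq (hquot j e h1 h2 q hq hs) (hquot j e' h3 h4 q' hq' hs') hs hs'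
  · simp [earSeq_zero, rootEar, Ear.length]
  · intro i
    induction i using Fin.cases with
    | zero => exact fun h => absurd rfl h
    | succ e =>
      intro _
      have h1 : (E.earSeq hc e.succ).length = E.len (σ e) := (hc e).length_walk
      rw [h1]
      exact (hc e).two_le

end

end Decomposition

end EarSystem

/-! ### Reasoning about programs -/

/-- The program `p`, started in the state `s`, halts after at most `c` steps in a state that
satisfies `Q`. -/
def Does (p : Prog) (s : State) (c : ℕ) (Q : State → Prop) : Prop :=
  ∃ s' t, Exec p s s' t ∧ t ≤ c ∧ Q s'

theorem Does.mono {p : Prog} {s : State} {c c' : ℕ} {Q Q' : State → Prop} (h : Does p s c Q)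
    (hc : c ≤ c') (hQ : ∀ s', Q s' → Q' s') : Does p s c' Q' := by
  obtain ⟨s', t, h1, h2, h3⟩ := h
  exact ⟨s', t, h1, h2.trans hc, hQ s' h3⟩

theorem Does.seq {p q : Prog} {s : State} {c d : ℕ} {Q R : State → Prop} (hp : Does p s c Q)
    (hq : ∀ s', Q s' → Does q s' d R) : Does (p.seq q) s (c + d) R := by
  obtain ⟨s₁, t₁, h1, h2, h3⟩ := hp
  obtain ⟨s₂, t₂, h4, h5, h6⟩ := hq s₁ h3
  exact ⟨s₂, t₁ + t₂, .seq h1 h4, by omega, h6⟩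

/-- The rule for loops: `I` is the invariant, for a ghost value of type `α`, and the potential `Φ`
pays for the steps. The ghost value is not determined by the state; here it is mostly the content of a
queue, or the number of rounds. -/
theorem Does.loop {α : Type*} {b : Test} {p : Prog} (I : α → State → Prop) (Φ : α → ℕ)
    (h : ∀ a s, I a s → b.eval s = true →
      ∃ d, Does p s d fun s' => ∃ a', I a' s' ∧ Φ a' + d + b.cost + 1 ≤ Φ a) :
    ∀ a s, I a s → Does (.loop b p) s (Φ a + b.cost + 1) fun s' =>
      ∃ a', I a' s' ∧ b.eval s' = false := by
  suffices ∀ m a s, Φ a ≤ m → I a s → Does (.loop b p) s (Φ a + b.cost + 1) fun s' =>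
      ∃ a', I a' s' ∧ b.eval s' = false from fun a s => this _ a s le_rfl
  intro m
  induction m using Nat.strong_induction_on with
  | _ m ih =>
    intro a s hm hI
    cases hb : b.eval s with
    | false => exact ⟨s, _, .loop_false hb, by omega, a, hI, hb⟩
    | true =>
      obtain ⟨d, s₁, t₁, h1, h2, a₁, h3, h4⟩ := h a s hI hb
      obtain ⟨s₂, t₂, h5, h6, h7⟩ := ih (Φ a₁) (by omega) a₁ s₁ le_rfl h3
      exact ⟨s₂, _, .loop_true hb h1 h5, by omega, h7⟩

/-- Run the programs of a list one after the other. -/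
def Prog.block : List Prog → Prog
  | [] => .skip
  | p :: l => .seq p (block l)

attribute [simp] Prog.block Expr.eval Test.eval Expr.cost Test.cost

theorem Does.block_nil {s : State} {Q : State → Prop} (h : Q s) : Does (.block []) s 1 Q :=
  ⟨s, 1, .skip s, le_rfl, h⟩

/-- The final state of a program without loops. -/
@[simp] def Prog.run : Prog → State → State
  | skip, s => s
  | assign x e, s => s.setVar x (e.eval s)
  | store a i e, s => s.setArr a (i.eval s) (e.eval s)
  | seq p q, s => q.run (p.run s)
  | ite b p q, s => if b.eval s = true then p.run s else q.run s
  | loop _ _, s => s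

/-- The program contains no loop. -/
@[simp] def Prog.Straight : Prog → Prop
  | skip => True
  | assign _ _ => True
  | store _ _ _ => True
  | seq p q => p.Straight ∧ q.Straight
  | ite _ p q => p.Straight ∧ q.Straight
  | loop _ _ => False

/-- A bound for the number of steps of a program without loops. -/
@[simp] def Prog.bound : Prog → ℕ
  | skip => 1
  | assign _ e => e.cost + 1
  | store _ i e => i.cost + e.cost + 1
  | seq p q => p.bound + q.bound
  | ite b p q => b.cost + 1 + (p.bound + q.bound)
  | loop _ _ => 0

theorem does_run (p : Prog) (hp : p.Straight) (s : State) :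
    Does p s p.bound fun s' => s' = p.run s := by
  induction p generalizing s with
  | skip => exact ⟨s, 1, .skip s, le_rfl, rfl⟩
  | assign x e => exact ⟨_, _, .assign s x e, le_rfl, rfl⟩
  | store a i e => exact ⟨_, _, .store s a i e, le_rfl, rfl⟩
  | seq p q ihp ihq =>
    refine (ihp hp.1 s).seq fun s' hs' => ?_
    subst hs'
    exact ihq hp.2 _
  | ite b p q ihp ihq =>
    cases hb : b.eval s with
    | true =>
      obtain ⟨s', t, h1, h2, h3⟩ := ihp hp.1 s
      exact ⟨s', _, .ite_true hb h1, by simp only [Prog.bound]; omega, by simp [hb, h3]⟩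
    | false =>
      obtain ⟨s', t, h1, h2, h3⟩ := ihq hp.2 s
      exact ⟨s', _, .ite_false hb h1, by simp only [Prog.bound]; omega, by simp [hb, h3]⟩
  | loop b p => exact hp.elim

/-- A program without loops satisfies what its final state satisfies. -/
theorem Does.of_run {p : Prog} (hp : p.Straight) {s : State} {c : ℕ} {Q : State → Prop}
    (hc : p.bound ≤ c) (h : Q (p.run s)) : Does p s c Q :=
  (does_run p hp s).mono hc fun _ hs => hs ▸ h

@[simp] theorem State.setVar_var (s : State) (x v y : ℕ) :
    (s.setVar x v).var y = if y = x then v else s.var y := by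
  simp [State.setVar, Function.update_apply]

@[simp] theorem State.setVar_arr (s : State) (x v : ℕ) : (s.setVar x v).arr = s.arr := rfl

@[simp] theorem State.setArr_var (s : State) (a i v : ℕ) : (s.setArr a i v).var = s.var := rfl

@[simp] theorem State.setArr_arr (s : State) (a i v b : ℕ) :
    (s.setArr a i v).arr b = if b = a then Function.update (s.arr a) i v else s.arr b := by
  simp only [State.setArr, Function.update_apply]

/-! ### Scanning an adjacency list -/

namespace Algo

/-- Scan the list of the vertex in variable 3. Afterwards variable 5 holds one more than the last
neighbour `w` with `fl[w] = 0`, and variable 6 the same for the last but one; `0` if there is none. -/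
def scan (fl : ℕ) : Prog :=
  .block [
    .assign 5 (.const 0),
    .assign 6 (.const 0),
    .assign 4 (.get 0 (.var 3)),
    .loop (.lt (.var 4) (.get 0 (.succ (.var 3)))) (.block [
      .ite (.eq (.get fl (.get 1 (.var 4))) (.const 0))
        (.block [.assign 6 (.var 5), .assign 5 (.succ (.get 1 (.var 4)))]) .skip,
      .assign 4 (.succ (.var 4))])]

/-- One more than the last and the last but one element of a list; `0` if there is none. -/
def lastTwo (l : List ℕ) : ℕ × ℕ := l.foldl (fun ab w => (w + 1, ab.1)) (0, 0)

theorem lastTwo_append_singleton (l : List ℕ) (w : ℕ) :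
    lastTwo (l ++ [w]) = (w + 1, (lastTwo l).1) := by
  simp [lastTwo]

theorem does_scan {fl : ℕ} {s : State} {o : ℕ} {l : List ℕ} (h0 : s.arr 0 (s.var 3) = o)
    (h1 : s.arr 0 (s.var 3 + 1) = o + l.length) (h2 : ∀ j (hj : j < l.length), s.arr 1 (o + j) = l[j]) :
    Does (scan fl) s (40 * l.length + 20) fun s' => s'.arr = s.arr ∧
      (∀ x, x ≠ 4 → x ≠ 5 → x ≠ 6 → s'.var x = s.var x) ∧
      (s'.var 5, s'.var 6) = lastTwo (l.filter fun w => s.arr fl w = 0) := by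
  have hloop := Does.loop (b := .lt (.var 4) (.get 0 (.succ (.var 3)))) (p := .block [
      .ite (.eq (.get fl (.get 1 (.var 4))) (.const 0))
        (.block [.assign 6 (.var 5), .assign 5 (.succ (.get 1 (.var 4)))]) .skip,
      .assign 4 (.succ (.var 4))])
    (fun (j : ℕ) s' => j ≤ l.length ∧ s'.arr = s.arr ∧
      (∀ x, x ≠ 4 → x ≠ 5 → x ≠ 6 → s'.var x = s.var x) ∧ s'.var 4 = o + j ∧
      (s'.var 5, s'.var 6) = lastTwo ((l.take j).filter fun w => s.arr fl w = 0))
    (fun j => 40 * (l.length - j)) (by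
      rintro j s' ⟨hj, harr, hfr, h4, h56⟩ hb
      have h3 : s'.var 3 = s.var 3 := hfr 3 (by decide) (by decide) (by decide)
      have hlt : j < l.length := by
        simpa [h4, harr, h3, h1] using hb
      refine ⟨33, Does.of_run (by simp) (by
        simp) ⟨j + 1, ⟨hlt, ?_⟩, ?_⟩⟩
      · have hl := h2 j hlt
        rw [← List.take_concat_get' l j hlt, List.filter_append]
        obtain ⟨h5, h6⟩ := Prod.ext_iff.1 h56
        simp only at h5 h6
        by_cases hf : s.arr fl l[j] = 0
        · have : [l[j]].filter (fun w => s.arr fl w = 0) = [l[j]] := by simp [hf]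
          rw [this, lastTwo_append_singleton]
          simp +contextual [hl, hf, harr, hfr, h4, h5, ← Nat.add_assoc]
        · have : [l[j]].filter (fun w => s.arr fl w = 0) = [] := by simp [hf]
          rw [this, List.append_nil]
          simp +contextual [hl, hf, harr, hfr, h4, h56, ← Nat.add_assoc]
      · simp
        omega)
  refine ((Does.of_run (p := .assign 5 (.const 0)) trivial le_rfl rfl).seq fun s₁ hs₁ =>
    (Does.of_run (p := .assign 6 (.const 0)) trivial le_rfl rfl).seq fun s₂ hs₂ =>
    (Does.of_run (p := .assign 4 (.get 0 (.var 3))) trivial le_rfl rfl).seq fun s₃ hs₃ =>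
    (hloop 0 s₃ ?_).seq fun s₄ hs₄ => Does.block_nil ?_).mono ?_ fun _ h => h
  · subst hs₁ hs₂ hs₃
    simp +contextual [h0, lastTwo]
  · obtain ⟨j, ⟨hj, harr, hfr, h4, h56⟩, hb⟩ := hs₄
    have h3 : s₄.var 3 = s.var 3 := hfr 3 (by decide) (by decide) (by decide)
    have hge : l.length ≤ j := by
      simpa [h4, harr, h3, h1] using hb
    rw [List.take_of_length_le hge] at h56
    exact ⟨harr, hfr, h56⟩
  · simp
    omega

end Algo

namespace EarSystem

/-! ### Degrees -/

section Degrees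

variable {V : Type u} [Fintype V] {G : SimpleGraph V} {r₀ r₁ : V}

open Classical in
/-- Every vertex has at most two neighbours that do not have larger rank. -/
theorem card_nbr_le_two (E : EarSystem Set.univ G.Adj r₀ r₁) (v : V) :
    (Finset.univ.filter fun w => G.Adj v w ∧ E.rk w ≤ E.rk v).card ≤ 2 := by
  by_cases h : E.rk v = 0
  · refine (Finset.card_le_card (t := {r₀, r₁}) ?_).trans Finset.card_le_two
    intro w hw
    simp only [Finset.mem_filter, Finset.mem_univ, true_and] at hw
    simpa using E.root_of_rk_eq_zero (v := w) (by omega)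
  · obtain ⟨c, t, hc, h0, ht, hv⟩ := E.exists_ori_of_rk_ne h
    refine (Finset.card_le_card (t := {c (t - 1), c (t + 1)}) ?_).trans Finset.card_le_two
    intro w hw
    simp only [Finset.mem_filter, Finset.mem_univ, true_and] at hw
    have hadj := hw.1
    rw [hv] at hadj
    rcases hc.nbr h0 ht hadj with h | h | ⟨i', c', hlt, hc', h1, h2⟩
    · simp [h]
    · simp [h]
    · have := hc'.rk_inner (t := 1) (by omega) (by have := hc'.two_le; omega)
      rw [← h2] at this
      omega

open Classical in
/-- The sum of the degrees is at most `4 n`. -/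
theorem sum_degree_le (E : EarSystem Set.univ G.Adj r₀ r₁) :
    ∑ v, (Finset.univ.filter fun w => G.Adj v w).card ≤ 4 * Fintype.card V := by
  have h1 : ∀ v, (Finset.univ.filter fun w => G.Adj v w).card ≤
      (Finset.univ.filter fun w => G.Adj v w ∧ E.rk w ≤ E.rk v).card +
        (Finset.univ.filter fun w => G.Adj w v ∧ E.rk v ≤ E.rk w).card := by
    intro v
    refine le_trans (Finset.card_le_card ?_) (Finset.card_union_le _ _)
    intro w hw
    simp only [Finset.mem_filter, Finset.mem_univ, true_and, Finset.mem_union] at hw ⊢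
    rcases le_total (E.rk w) (E.rk v) with h | h
    · exact Or.inl ⟨hw, h⟩
    · exact Or.inr ⟨hw.symm, h⟩
  have h2 : ∑ v, (Finset.univ.filter fun w => G.Adj w v ∧ E.rk v ≤ E.rk w).card =
      ∑ v, (Finset.univ.filter fun w => G.Adj v w ∧ E.rk w ≤ E.rk v).card := by
    simp only [Finset.card_filter]
    exact Finset.sum_comm
  have h3 : ∑ v, (Finset.univ.filter fun w => G.Adj v w ∧ E.rk w ≤ E.rk v).card ≤
      ∑ _v : V, 2 := Finset.sum_le_sum fun v _ => E.card_nbr_le_two v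
  have h4 := Finset.sum_le_sum fun v (_ : v ∈ Finset.univ) => h1 v
  rw [Finset.sum_add_distrib, h2] at h4
  simp only [Finset.sum_const, Finset.card_univ, smul_eq_mul] at h3
  omega

end Degrees

end EarSystem

namespace Algo

/-! ### Queues -/

/-- Count in the arrays 6 and 7 how often every vertex occurs in the adjacency lists. -/
def countDegrees : Prog :=
  .block [
    .assign 4 (.const 0),
    .loop (.lt (.var 4) (.get 0 (.var 0))) (.block [
      .store 6 (.get 1 (.var 4)) (.succ (.get 6 (.get 1 (.var 4)))),
      .store 7 (.get 1 (.var 4)) (.succ (.get 7 (.get 1 (.var 4)))),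
      .assign 4 (.succ (.var 4))])]

/-- Fill the queue in the array `q`, whose length is in variable 8, with all vertices `v` such that
`d[v] ≤ 2`. -/
def fill (d q : ℕ) : Prog :=
  .block [
    .assign 3 (.const 0),
    .assign 8 (.const 0),
    .loop (.lt (.var 3) (.var 0)) (.block [
      .ite (.lt (.get d (.var 3)) (.const 3))
        (.block [.store q (.var 8) (.var 3), .assign 8 (.succ (.var 8))]) .skip,
      .assign 3 (.succ (.var 3))])]

/-- Decrease `d[v]` for the vertex `v` in the variable `x`, and put `v` into the queue if this makes
`d[v]` equal to 2. -/
def decPush (d q x : ℕ) : Prog :=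
  .block [
    .store d (.var x) (.pred (.get d (.var x))),
    .ite (.eq (.get d (.var x)) (.const 2))
      (.block [.store q (.var 8) (.var x), .assign 8 (.succ (.var 8))]) .skip]

/-- The list `F` is the concatenation of the adjacency lists. -/
theorem does_countDegrees {s : State} {F : List ℕ} (h0 : s.arr 0 (s.var 0) = F.length)
    (h1 : ∀ j (hj : j < F.length), s.arr 1 j = F[j]) (h6 : ∀ w, s.arr 6 w = 0)
    (h7 : ∀ w, s.arr 7 w = 0) :
    Does countDegrees s (40 * F.length + 20) fun s' =>
      (∀ a, a ≠ 6 → a ≠ 7 → s'.arr a = s.arr a) ∧ (∀ x, x ≠ 4 → s'.var x = s.var x) ∧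
      (∀ w, s'.arr 6 w = F.count w) ∧ ∀ w, s'.arr 7 w = F.count w := by
  have hloop := Does.loop (b := .lt (.var 4) (.get 0 (.var 0))) (p := .block [
      .store 6 (.get 1 (.var 4)) (.succ (.get 6 (.get 1 (.var 4)))),
      .store 7 (.get 1 (.var 4)) (.succ (.get 7 (.get 1 (.var 4)))),
      .assign 4 (.succ (.var 4))])
    (fun (j : ℕ) s' => j ≤ F.length ∧ (∀ a, a ≠ 6 → a ≠ 7 → s'.arr a = s.arr a) ∧
      (∀ x, x ≠ 4 → s'.var x = s.var x) ∧ s'.var 4 = j ∧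
      (∀ w, s'.arr 6 w = (F.take j).count w) ∧ ∀ w, s'.arr 7 w = (F.take j).count w)
    (fun j => 40 * (F.length - j)) (by
      rintro j s' ⟨hj, harr, hfr, h4, hc6, hc7⟩ hb
      have ha0 : s'.arr 0 = s.arr 0 := harr 0 (by decide) (by decide)
      have ha1 : s'.arr 1 = s.arr 1 := harr 1 (by decide) (by decide)
      have hv0 : s'.var 0 = s.var 0 := hfr 0 (by decide)
      have hlt : j < F.length := by
        simpa [h4, ha0, hv0, h0] using hb
      refine ⟨33, Does.of_run (by simp) (by
        simp) ⟨j + 1, ⟨hlt, ?_⟩, ?_⟩⟩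
      · have hl := h1 j hlt
        have hcount : ∀ w, (F.take (j + 1)).count w =
            if w = F[j] then (F.take j).count F[j] + 1 else (F.take j).count w := by
          intro w
          rw [← List.take_concat_get' F j hlt, List.count_append, List.count_singleton']
          split_ifs with h h' h'
          · rw [h]
          · exact absurd h.symm h'
          · exact absurd h'.symm h
          · rfl
        simp +contextual [hl, harr, hfr, h4, hcount, hc6, hc7, Function.update_apply]
      · simp
        omega)
  refine ((Does.of_run (p := .assign 4 (.const 0)) trivial le_rfl rfl).seq fun s₁ hs₁ =>
    (hloop 0 s₁ ?_).seq fun s₄ hs₄ => Does.block_nil ?_).mono ?_ fun _ h => h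
  · subst hs₁
    simp +contextual [h6, h7]
  · obtain ⟨j, ⟨hj, harr, hfr, h4, hc6, hc7⟩, hb⟩ := hs₄
    have ha0 : s₄.arr 0 = s.arr 0 := harr 0 (by decide) (by decide)
    have hv0 : s₄.var 0 = s.var 0 := hfr 0 (by decide)
    have hge : F.length ≤ j := by
      simpa [h4, ha0, hv0, h0] using hb
    rw [List.take_of_length_le hge] at hc6 hc7
    exact ⟨harr, hfr, hc6, hc7⟩
  · simp
    omega

variable {n : ℕ}

/-- The array `q` holds the queue `Q`, which contains just the vertices `v` with `d[v] ≤ 2`. -/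
structure Queue (d q : ℕ) (s : State) (Q : List (Fin n)) : Prop where
  nodup : Q.Nodup
  len : s.var 8 = Q.length
  get : ∀ i (hi : i < Q.length), s.arr q i = Q[i]
  mem : ∀ v : Fin n, v ∈ Q ↔ s.arr d v ≤ 2

theorem does_fill {d q : ℕ} (hdq : d ≠ q) {s : State} (h0 : s.var 0 = n) :
    Does (fill d q) s (30 * n + 20) fun s' => (∀ a, a ≠ q → s'.arr a = s.arr a) ∧
      (∀ x, x ≠ 3 → x ≠ 8 → s'.var x = s.var x) ∧ ∃ Q : List (Fin n), Queue d q s' Q := by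
  have hloop := Does.loop (b := .lt (.var 3) (.var 0)) (p := .block [
      .ite (.lt (.get d (.var 3)) (.const 3))
        (.block [.store q (.var 8) (.var 3), .assign 8 (.succ (.var 8))]) .skip,
      .assign 3 (.succ (.var 3))])
    (fun (j : ℕ) s' => j ≤ n ∧ (∀ a, a ≠ q → s'.arr a = s.arr a) ∧
      (∀ x, x ≠ 3 → x ≠ 8 → s'.var x = s.var x) ∧ s'.var 3 = j ∧
      ∃ Q : List (Fin n), Q.Nodup ∧ s'.var 8 = Q.length ∧
        (∀ i (hi : i < Q.length), s'.arr q i = Q[i]) ∧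
        ∀ v : Fin n, v ∈ Q ↔ (v : ℕ) < j ∧ s.arr d v ≤ 2)
    (fun j => 30 * (n - j)) (by
      rintro j s' ⟨hj, harr, hfr, h3, Q, hQ1, hQ2, hQ3, hQ4⟩ hb
      have hv0 : s'.var 0 = n := by rw [hfr 0 (by decide) (by decide), h0]
      have hd : s'.arr d = s.arr d := harr d hdq
      have hlt : j < n := by
        simpa [h3, hv0] using hb
      refine ⟨23, Does.of_run (by simp) (by
        simp) ⟨j + 1, ⟨hlt, ?_⟩, ?_⟩⟩
      · by_cases hdj : s.arr d j ≤ 2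
        · have hdj' : s.arr d j < 3 := by omega
          refine ⟨?_, ?_, ?_, Q ++ [⟨j, hlt⟩], ?_, ?_, ?_, ?_⟩
          · simp +contextual [harr, hd, h3, hdj']
          · simp +contextual [hfr, hd, h3, hdj']
          · simp [hd, h3, hdj']
          · rw [List.nodup_append]
            refine ⟨hQ1, by simp, ?_⟩
            rintro v hv w hw rfl
            have := (hQ4 v).1 hv
            rw [List.mem_singleton] at hw
            subst hw
            exact absurd this.1 (lt_irrefl _)
          · simp [hd, h3, hdj', hQ2]
          · intro i hi
            rw [List.getElem_append]
            simp only [List.length_append, List.length_singleton] at hi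
            split_ifs with hi'
            · simp [hd, h3, hdj', hQ2, hi'.ne, hQ3 i hi']
            · have : i = Q.length := by omega
              simp [hd, h3, hdj', hQ2, this]
          · intro v
            rw [List.mem_append, hQ4, List.mem_singleton, Fin.ext_iff]
            constructor
            · rintro (⟨h, h'⟩ | h)
              · exact ⟨by omega, h'⟩
              · simp only at h
                rw [h]
                exact ⟨by omega, hdj⟩
            · rintro ⟨h, h'⟩
              rcases Nat.lt_succ_iff_lt_or_eq.1 h with h | h
              · exact Or.inl ⟨h, h'⟩
              · exact Or.inr h
        · have hdj' : ¬s.arr d j < 3 := by omega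
          refine ⟨?_, ?_, ?_, Q, hQ1, ?_, ?_, ?_⟩
          · simp +contextual [harr, hd, h3, hdj']
          · simp +contextual [hfr, hd, h3, hdj']
          · simp [hd, h3, hdj']
          · simp [hd, h3, hdj', hQ2]
          · intro i hi
            simp [hd, h3, hdj', hQ3 i hi]
          · intro v
            rw [hQ4]
            constructor
            · rintro ⟨h, h'⟩
              exact ⟨by omega, h'⟩
            · rintro ⟨h, h'⟩
              refine ⟨lt_of_le_of_ne (by omega) ?_, h'⟩
              intro h
              rw [h] at h'
              exact hdj h'
      · simp
        omega)
  refine ((Does.of_run (p := .assign 3 (.const 0)) trivial le_rfl rfl).seq fun s₁ hs₁ =>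
    (Does.of_run (p := .assign 8 (.const 0)) trivial le_rfl rfl).seq fun s₂ hs₂ =>
    (hloop 0 s₂ ?_).seq fun s₄ hs₄ => Does.block_nil ?_).mono ?_ fun _ h => h
  · subst hs₁ hs₂
    refine ⟨Nat.zero_le _, ?_, ?_, ?_, [], List.nodup_nil, ?_, ?_, ?_⟩ <;>
    simp +contextual
  · obtain ⟨j, ⟨hj, harr, hfr, h3, Q, hQ1, hQ2, hQ3, hQ4⟩, hb⟩ := hs₄
    have hv0 : s₄.var 0 = n := by rw [hfr 0 (by decide) (by decide), h0]
    have hge : n ≤ j := by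
      simpa [h3, hv0] using hb
    refine ⟨harr, hfr, Q, hQ1, hQ2, hQ3, fun v => ?_⟩
    rw [hQ4, harr d hdq]
    exact ⟨fun h => h.2, fun h => ⟨by omega, h⟩⟩
  · simp
    omega

/-- Since `d[v]` passes the value 2 at most once while it decreases, no vertex is put into the queue
twice. -/
theorem Queue.decPush {d q x : ℕ} (hdq : d ≠ q) {s : State} {Q : List (Fin n)}
    (hQ : Queue d q s Q) {u : Fin n} (hu : s.var x = u) :
    (∀ y, y ≠ 8 → ((decPush d q x).run s).var y = s.var y) ∧
      (∀ a, a ≠ d → a ≠ q → ((decPush d q x).run s).arr a = s.arr a) ∧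
      (∀ v : Fin n, ((decPush d q x).run s).arr d v =
        if v = u then s.arr d u - 1 else s.arr d v) ∧
      ∃ R, Queue d q ((decPush d q x).run s) (Q ++ R) := by
  have hmem := hQ.mem u
  have hupd : ∀ v : Fin n, Function.update (s.arr d) (u : ℕ) (s.arr d u - 1) (v : ℕ) =
      if v = u then s.arr d u - 1 else s.arr d v := by
    intro v
    simp [Function.update_apply, Fin.ext_iff]
  by_cases h3 : s.arr d u - 1 = 2
  · refine ⟨?_, ?_, ?_, [u], ?_⟩
    · simp +contextual [Algo.decPush, hu, h3]
    · simp +contextual [Algo.decPush, hu, h3]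
    · intro v
      rw [← hupd]
      simp [Algo.decPush, hu, h3, hdq]
    · refine ⟨?_, ?_, ?_, ?_⟩
      · rw [List.nodup_append]
        refine ⟨hQ.nodup, by simp, ?_⟩
        rintro v hv w hw rfl
        rw [List.mem_singleton] at hw
        subst hw
        have := hmem.1 hv
        omega
      · simp [Algo.decPush, hu, h3, hQ.len]
      · intro i hi
        rw [List.getElem_append]
        simp only [List.length_append, List.length_singleton] at hi
        split_ifs with hi'
        · simp [Algo.decPush, hu, h3, hQ.len, hdq.symm, hi'.ne, hQ.get i hi']
        · have : i = Q.length := by omega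
          simp [Algo.decPush, hu, h3, hQ.len, this]
      · intro v
        have : ((Algo.decPush d q x).run s).arr d v = if v = u then s.arr d u - 1 else s.arr d v := by
          rw [← hupd]
          simp [Algo.decPush, hu, h3, hdq]
        rw [this, List.mem_append, List.mem_singleton, hQ.mem]
        split_ifs with h
        · simp [h, h3]
        · simp [h]
  · refine ⟨?_, ?_, ?_, [], ?_⟩
    · simp [Algo.decPush, hu, h3]
    · simp +contextual [Algo.decPush, hu, h3]
    · intro v
      rw [← hupd]
      simp [Algo.decPush, hu, h3]
    · rw [List.append_nil]
      refine ⟨hQ.nodup, ?_, ?_, ?_⟩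
      · simp [Algo.decPush, hu, h3, hQ.len]
      · intro i hi
        simp [Algo.decPush, hu, h3, hdq.symm, hQ.get i hi]
      · intro v
        have : ((Algo.decPush d q x).run s).arr d v = if v = u then s.arr d u - 1 else s.arr d v := by
          rw [← hupd]
          simp [Algo.decPush, hu, h3]
        rw [this, hQ.mem]
        split_ifs with h
        · subst h
          omega
        · rfl

theorem straight_decPush (d q x : ℕ) : (decPush d q x).Straight := by
  simp [decPush]

theorem bound_decPush (d q x : ℕ) : (decPush d q x).bound ≤ 20 := by
  simp [decPush]

end Algo

namespace Algo

variable {n : ℕ}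

/-! ### Adjacency tests in constant time -/

/-- The memory holds the number of vertices and the adjacency lists. -/
structure HasGraph (adj : Fin n → List (Fin n)) (s : State) : Prop where
  var0 : s.var 0 = n
  off : ∀ v : Fin n, s.arr 0 (v + 1) = s.arr 0 v + (adj v).length
  get : ∀ (v : Fin n) (j : ℕ) (hj : j < (adj v).length), s.arr 1 (s.arr 0 v + j) = (adj v)[j]

theorem HasGraph.congr {adj : Fin n → List (Fin n)} {s s' : State} (h : HasGraph adj s)
    (h0 : s'.var 0 = s.var 0) (h1 : s'.arr 0 = s.arr 0) (h2 : s'.arr 1 = s.arr 1) :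
    HasGraph adj s' := by
  refine ⟨h0.trans h.var0, fun v => ?_, fun v j hj => ?_⟩
  · rw [h1, h.off]
  · rw [h1, h2, h.get]

theorem HasGraph.does_scan {adj : Fin n → List (Fin n)} {s : State} (h : HasGraph adj s) {fl : ℕ}
    {v : Fin n} (hv : s.var 3 = v) :
    Does (scan fl) s (40 * (adj v).length + 20) fun s' => s'.arr = s.arr ∧
      (∀ x, x ≠ 4 → x ≠ 5 → x ≠ 6 → s'.var x = s.var x) ∧
      (s'.var 5, s'.var 6) = lastTwo (((adj v).filter fun w : Fin n => s.arr fl w = 0).map Fin.val) := by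
  have := Algo.does_scan (fl := fl) (s := s) (o := s.arr 0 v) (l := (adj v).map Fin.val)
    (by rw [hv]) (by rw [hv, h.off, List.length_map]) (by
      intro j hj
      rw [h.get v j (by simpa using hj)]
      simp)
  rw [List.length_map, List.filter_map] at this
  exact this

/-- For at most two neighbours, `lastTwo` finds all of them. -/
theorem lastTwo_spec {l : List (Fin n)} (hl : l.Nodup) (h2 : l.length ≤ 2) {a b : ℕ}
    (h : (a, b) = lastTwo (l.map Fin.val)) :
    (a = 0 ∨ ∃ u ∈ l, a = (u : ℕ) + 1) ∧ (b = 0 ∨ ∃ u ∈ l, b = (u : ℕ) + 1) ∧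
      ∀ u : Fin n, (u ∈ l ↔ a = (u : ℕ) + 1 ∨ b = (u : ℕ) + 1) ∧
        ¬(a = (u : ℕ) + 1 ∧ b = (u : ℕ) + 1) := by
  match l, hl, h2 with
  | [], _, _ =>
    simp [lastTwo] at h
    simp [h.1, h.2]
  | [x], _, _ =>
    simp [lastTwo] at h
    simp [h.1, h.2, Fin.ext_iff, eq_comm]
  | [x, y], hl, _ =>
    simp [lastTwo] at h
    have hne : x ≠ y := by simpa using hl
    refine ⟨Or.inr ⟨y, by simp, h.1⟩, Or.inr ⟨x, by simp, h.2⟩, fun u => ⟨?_, ?_⟩⟩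
    · simp [h.1, h.2, Fin.ext_iff, eq_comm, or_comm]
    · rintro ⟨h3, h4⟩
      exact hne (Fin.ext (by omega))
  | _ :: _ :: _ :: _, _, h2 => simp at h2

/-- If the variable `f` holds `u + 1`, treat the vertex `u` as `decPush` does. -/
def decOpt (d q f : ℕ) : Prog :=
  .ite (.eq (.var f) (.const 0)) .skip (.block [.assign 10 (.pred (.var f)), decPush d q 10])

theorem Queue.decOpt {d q f : ℕ} (hdq : d ≠ q) {s : State} {Q : List (Fin n)}
    (hQ : Queue d q s Q) (hf : s.var f = 0 ∨ ∃ u : Fin n, s.var f = u + 1) :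
    (∀ y, y ≠ 8 → y ≠ 10 → ((decOpt d q f).run s).var y = s.var y) ∧
      (∀ a, a ≠ d → a ≠ q → ((decOpt d q f).run s).arr a = s.arr a) ∧
      (∀ v : Fin n, ((decOpt d q f).run s).arr d v =
        if s.var f = v + 1 then s.arr d v - 1 else s.arr d v) ∧
      ∃ R, Queue d q ((decOpt d q f).run s) (Q ++ R) := by
  rcases hf with hf | ⟨u, hf⟩
  · have : (Algo.decOpt d q f).run s = s := by simp [Algo.decOpt, hf]
    rw [this]
    exact ⟨fun _ _ _ => rfl, fun _ _ _ => rfl, by simp [hf], [], by simpa using hQ⟩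
  · have hrun : (Algo.decOpt d q f).run s = (Algo.decPush d q 10).run (s.setVar 10 u) := by
      simp [Algo.decOpt, hf]
    have hQ' : Queue d q (s.setVar 10 u) Q :=
      ⟨hQ.nodup, by simpa using hQ.len, hQ.get, hQ.mem⟩
    obtain ⟨h1, h2, h3, h4⟩ := hQ'.decPush hdq (x := 10) (u := u) (by simp)
    rw [hrun]
    refine ⟨fun y hy hy' => ?_, h2, fun v => ?_, h4⟩
    · rw [h1 y hy]
      simp [hy']
    · rw [h3 v, hf]
      simp only [Nat.add_right_cancel_iff, ← Fin.ext_iff, State.setVar_arr, eq_comm (a := u)]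
      split_ifs with h
      · rw [h]
      · rfl

/-- Take the next vertex out of the queue and mark it as removed. -/
def peelPre : Prog :=
  .block [.assign 3 (.get 9 (.var 7)), .assign 7 (.succ (.var 7)), .store 8 (.var 3) (.const 1)]

/-- Store the neighbours that the scan has found, and decrease their numbers of remaining neighbours. -/
def peelPost : Prog :=
  .block [.store 10 (.var 3) (.var 5), .store 11 (.var 3) (.var 6), decOpt 6 9 5, decOpt 6 9 6]

/-- Repeatedly remove a vertex with at most two remaining neighbours, and store these neighbours,
increased by 1, in the arrays 10 and 11. The array 6 holds the numbers of remaining neighbours, the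
array 8 marks the removed vertices, the array 9 is the queue and variable 7 its head. -/
def peel : Prog :=
  .block [
    fill 6 9,
    .assign 7 (.const 0),
    .loop (.lt (.var 7) (.var 8)) (.block [peelPre, scan 8, peelPost])]

/-- The test whether the vertices in the variables `x`, `y` are adjacent. -/
def adjTest (x y : ℕ) : Test :=
  .neg (.and
    (.and (.neg (.eq (.get 10 (.var x)) (.succ (.var y))))
      (.neg (.eq (.get 11 (.var x)) (.succ (.var y)))))
    (.and (.neg (.eq (.get 10 (.var y)) (.succ (.var x))))
      (.neg (.eq (.get 11 (.var y)) (.succ (.var x))))))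

/-- One of the vertices `v`, `w` is stored for the other. -/
def Stored (s : State) (v w : ℕ) : Prop :=
  (s.arr 10 v = w + 1 ∨ s.arr 11 v = w + 1) ∨ (s.arr 10 w = v + 1 ∨ s.arr 11 w = v + 1)

theorem adjTest_eval {s : State} {x y v w : ℕ} (hx : s.var x = v) (hy : s.var y = w) :
    (adjTest x y).eval s = true ↔ Stored s v w := by
  simp only [adjTest, Stored, Test.eval, Expr.eval, hx, hy, Bool.not_eq_true', Bool.and_eq_false_iff,
    Bool.not_eq_false', decide_eq_true_eq]

open Classical in
/-- The invariant of `peel`: the first `h` elements of the queue `Q` have been removed. -/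
structure PeelInv (G : SimpleGraph (Fin n)) (adj : Fin n → List (Fin n)) (s₀ : State)
    (Q : List (Fin n)) (h : ℕ) (s : State) : Prop where
  queue : Queue 6 9 s Q
  var7 : s.var 7 = h
  graph : HasGraph adj s
  flag : ∀ v : Fin n, s.arr 8 v = if v ∈ Q.take h then 1 else 0
  deg : ∀ v ∉ Q.take h, s.arr 6 v = (Finset.univ.filter fun w => G.Adj v w ∧ w ∉ Q.take h).card
  sound : ∀ v x : Fin n, s.arr 10 v = x + 1 ∨ s.arr 11 v = x + 1 → G.Adj v x
  complete : ∀ v ∈ Q.take h, ∀ w, G.Adj v w → Stored s v w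
  fresh : ∀ v : Fin n, v ∉ Q.take h → s.arr 10 v = 0 ∧ s.arr 11 v = 0
  frame : ∀ a, (a < 6 ∨ a = 7 ∨ 12 ≤ a) → s.arr a = s₀.arr a

section

variable {G : SimpleGraph (Fin n)} {adj : Fin n → List (Fin n)}

open Classical in
theorem length_filter_adj (hadj : IsAdjacencyLists G adj) (v : Fin n) (p : Fin n → Prop)
    [DecidablePred p] :
    ((adj v).filter p).length = (Finset.univ.filter fun w => G.Adj v w ∧ p w).card := by
  rw [← List.toFinset_card_of_nodup ((hadj v).1.filter _)]
  congr 1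
  ext w
  simp [(hadj v).2]

/-- One round of `peel` removes the next vertex of the queue. Its list is scanned completely, but only
the neighbours that are not removed, of which there are at most two, are found. -/
theorem does_peel_step (hadj : IsAdjacencyLists G adj) {s₀ s : State} {Q : List (Fin n)} {h : ℕ}
    (hI : PeelInv G adj s₀ Q h s) (hlt : h < Q.length) :
    Does (.block [peelPre, scan 8, peelPost]) s (40 * (adj Q[h]).length + 100) fun s' =>
      ∃ R, PeelInv G adj s₀ (Q ++ R) (h + 1) s' := by
  classical
  set v := Q[h] with hv
  have hvh : v ∉ Q.take h := by
    intro hm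
    obtain ⟨i, hi, he⟩ := List.mem_take_iff_getElem.1 hm
    have := (hI.queue.nodup.getElem_inj_iff).1 he
    omega
  have htake : Q.take (h + 1) = Q.take h ++ [v] := (List.take_concat_get' Q h hlt).symm
  have hQv : s.arr 9 (s.var 7) = v := by rw [hI.var7, hI.queue.get h hlt]
  refine ((Does.of_run (p := peelPre) (by simp [peelPre]) le_rfl rfl).seq fun s₁ hs₁ =>
    (HasGraph.does_scan (adj := adj) (v := v) ?_ ?_).seq fun s₂ hs₂ =>
    (Does.of_run (p := peelPost) (by simp [peelPost, decOpt, straight_decPush]) le_rfl ?_).seq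
      fun s' hs' => Does.block_nil hs').mono ?_ fun _ h => h
  · subst hs₁
    exact hI.graph.congr (by simp [peelPre]) (by simp [peelPre]) (by simp [peelPre])
  · subst hs₁
    simp [peelPre, hQv]
  · obtain ⟨harr, hvar, h56⟩ := hs₂
    have h1arr : ∀ a, a ≠ 8 → s₁.arr a = s.arr a := by
      subst hs₁
      simp +contextual [peelPre]
    have h1flag : ∀ w : Fin n, s₁.arr 8 w = if w ∈ Q.take (h + 1) then 1 else 0 := by
      intro w
      subst hs₁
      have hm : w ∈ Q.take (h + 1) ↔ w ∈ Q.take h ∨ w = v := by simp [htake]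
      simp only [hm]
      by_cases hw : w = v <;> simp [peelPre, hQv, ← Fin.ext_iff, hI.flag, hw]
    have h1v : ∀ x, x ≠ 3 → x ≠ 7 → s₁.var x = s.var x := by
      subst hs₁
      simp +contextual [peelPre]
    have h13 : s₁.var 3 = v := by
      subst hs₁
      simp [peelPre, hQv]
    have h17 : s₁.var 7 = h + 1 := by
      subst hs₁
      simp [peelPre, hI.var7]
    set l := (adj v).filter fun w : Fin n => s₁.arr 8 w = 0 with hl
    have hlmem : ∀ w, w ∈ l ↔ G.Adj v w ∧ w ∉ Q.take h := by
      intro w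
      have hm : w ∈ Q.take (h + 1) ↔ w ∈ Q.take h ∨ w = v := by simp [htake]
      rw [hl, List.mem_filter, (hadj v).2, h1flag w]
      refine and_congr_right fun hvw => ?_
      have hne : w ≠ v := hvw.ne'
      simp [hm, hne]
    have hlen : l.length ≤ 2 := by
      rw [hl, length_filter_adj hadj v (fun w : Fin n => s₁.arr 8 w = 0)]
      have h2 := (hI.queue.mem v).1 (List.getElem_mem hlt)
      rw [hI.deg v hvh] at h2
      refine le_trans (Finset.card_le_card fun w hw => ?_) h2
      have := (hlmem w).1 (by
        rw [hl, List.mem_filter, (hadj v).2]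
        simpa using hw)
      simpa using this
    obtain ⟨ha, hb, hab⟩ := lastTwo_spec ((hadj v).1.filter _) hlen h56
    set s₃ : State := (s₂.setArr 10 v (s₂.var 5)).setArr 11 v (s₂.var 6) with hs₃
    have hs23 : s₂.var 3 = v := by rw [hvar 3 (by decide) (by decide) (by decide), h13]
    have hrun : peelPost.run s₂ = (decOpt 6 9 6).run ((decOpt 6 9 5).run s₃) := by
      simp only [peelPost, Prog.run, Prog.block, Expr.eval, hs₃, State.setArr_var, hs23]
    have h3arr : ∀ a, a ≠ 8 → a ≠ 10 → a ≠ 11 → s₃.arr a = s.arr a := by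
      intro a h8 h10 h11
      rw [← h1arr a h8, ← harr, hs₃]
      simp [h10, h11]
    have hQ3 : Queue 6 9 s₃ Q := by
      refine ⟨hI.queue.nodup, ?_, ?_, ?_⟩
      · rw [hs₃, State.setArr_var, State.setArr_var, hvar 8 (by decide) (by decide) (by decide),
          h1v 8 (by decide) (by decide), hI.queue.len]
      · rw [h3arr 9 (by decide) (by decide) (by decide)]
        exact hI.queue.get
      · rw [h3arr 6 (by decide) (by decide) (by decide)]
        exact hI.queue.mem
    obtain ⟨h4v, h4a, h4d, R₁, hQ4⟩ := hQ3.decOpt (f := 5) (by decide)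
      (ha.imp id fun ⟨u, _, h⟩ => ⟨u, h⟩)
    set s₄ := (decOpt 6 9 5).run s₃
    have h46 : s₄.var 6 = s₂.var 6 := h4v 6 (by decide) (by decide)
    obtain ⟨h5v, h5a, h5d, R₂, hQ5⟩ := hQ4.decOpt (f := 6) (by decide)
      (by rw [h46]; exact hb.imp id fun ⟨u, _, h⟩ => ⟨u, h⟩)
    rw [hrun]
    set s₅ := (decOpt 6 9 6).run s₄
    have h5arr : ∀ a, a ≠ 6 → a ≠ 9 → s₅.arr a = s₃.arr a := fun a h6 h9 => by
      rw [h5a a h6 h9, h4a a h6 h9]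
    have h5var : ∀ x, x ≠ 4 → x ≠ 5 → x ≠ 6 → x ≠ 8 → x ≠ 10 → s₅.var x = s₁.var x := by
      intro x h4 h5 h6 h8 h10
      rw [h5v x h8 h10, h4v x h8 h10, ← hvar x h4 h5 h6]
      rfl
    have h10 : ∀ w : Fin n, s₅.arr 10 w = if w = v then s₂.var 5 else s.arr 10 w := by
      intro w
      rw [h5arr 10 (by decide) (by decide), ← h1arr 10 (by decide), ← harr, hs₃]
      simp [Function.update_apply, Fin.ext_iff]
    have h11 : ∀ w : Fin n, s₅.arr 11 w = if w = v then s₂.var 6 else s.arr 11 w := by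
      intro w
      rw [h5arr 11 (by decide) (by decide), ← h1arr 11 (by decide), ← harr, hs₃]
      simp [Function.update_apply, Fin.ext_iff]
    have htake' : (Q ++ (R₁ ++ R₂)).take (h + 1) = Q.take h ++ [v] := by
      rw [List.take_append_of_le_length hlt, htake]
    have hmemtake : ∀ w, w ∈ (Q ++ (R₁ ++ R₂)).take (h + 1) ↔ w ∈ Q.take h ∨ w = v := by
      intro w
      rw [htake']
      simp
    refine ⟨R₁ ++ R₂, ?_, ?_, ?_, ?_, ?_, ?_, ?_, ?_, ?_⟩
    · rw [← List.append_assoc]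
      exact hQ5
    · rw [h5var 7 (by decide) (by decide) (by decide) (by decide) (by decide), h17]
    · refine hI.graph.congr ?_ ?_ ?_
      · rw [h5var 0 (by decide) (by decide) (by decide) (by decide) (by decide),
          h1v 0 (by decide) (by decide)]
      · rw [h5arr 0 (by decide) (by decide), h3arr 0 (by decide) (by decide) (by decide)]
      · rw [h5arr 1 (by decide) (by decide), h3arr 1 (by decide) (by decide) (by decide)]
    · intro w
      rw [h5arr 8 (by decide) (by decide), htake', ← htake, ← h1flag w, ← harr]
      rfl
    · intro u hu
      rw [hmemtake, not_or] at hu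
      rw [h5d u, h46, h4d u, show s₃.var 5 = s₂.var 5 from rfl, h3arr 6 (by decide) (by decide) (by decide), hI.deg u hu.1]
      have hcard : (Finset.univ.filter fun w => G.Adj u w ∧
            w ∉ (Q ++ (R₁ ++ R₂)).take (h + 1)) =
          (Finset.univ.filter fun w => G.Adj u w ∧ w ∉ Q.take h).erase v := by
        ext w
        simp only [Finset.mem_filter, Finset.mem_univ, true_and, hmemtake, Finset.mem_erase, not_or]
        tauto
      rw [hcard, Finset.card_erase_eq_ite]
      have h1 := hlmem u
      have h2 := hab u
      have h3 : v ∈ (Finset.univ.filter fun w => G.Adj u w ∧ w ∉ Q.take h) ↔ G.Adj v u := by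
        simp [hvh, G.adj_comm]
      by_cases huv : G.Adj v u
      · rw [if_pos (h3.2 huv)]
        rcases h2.1.1 (h1.2 ⟨huv, hu.1⟩) with h4 | h4
        · rw [if_pos h4, if_neg fun h5 => h2.2 ⟨h4, h5⟩]
        · rw [if_neg fun h5 => h2.2 ⟨h5, h4⟩, if_pos h4]
      · rw [if_neg (mt h3.1 huv)]
        have h4 : u ∉ l := fun h => huv (h1.1 h).1
        rw [h2.1, not_or] at h4
        rw [if_neg h4.1, if_neg h4.2]
    · intro w x
      rw [h10, h11]
      split_ifs with hwv
      · intro hx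
        rw [hwv]
        exact ((hlmem x).1 ((hab x).1.2 hx)).1
      · exact hI.sound w x
    · intro w hw x hwx
      rw [hmemtake] at hw
      have hmono : Stored s w x → Stored s₅ w x := by
        have hf := hI.fresh v hvh
        unfold Stored
        rw [h10, h11, h10, h11]
        split_ifs with h1 h2 h2
        · exact absurd (h1.trans h2.symm) hwx.ne
        · rw [h1]
          omega
        · rw [h2]
          omega
        · exact id
      by_cases hwh : w ∈ Q.take h
      · exact hmono (hI.complete w hwh x hwx)
      · have hwv := hw.resolve_left hwh
        subst hwv
        by_cases hxh : x ∈ Q.take h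
        · exact hmono (Or.symm (hI.complete x hxh v hwx.symm))
        · left
          rw [h10, h11, if_pos rfl, if_pos rfl]
          exact (hab x).1.1 ((hlmem x).2 ⟨hwx, hxh⟩)
    · intro w hw
      rw [hmemtake, not_or] at hw
      rw [h10, h11, if_neg hw.2, if_neg hw.2]
      exact hI.fresh w hw.1
    · intro a ha
      rw [h5arr a (by omega) (by omega), h3arr a (by omega) (by omega) (by omega), hI.frame a ha]
  · simp [peelPre, peelPost, decOpt]
    have := bound_decPush 6 9 10
    omega

theorem Queue.congr {d q : ℕ} {s s' : State} {Q : List (Fin n)} (h : Queue d q s Q)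
    (h8 : s'.var 8 = s.var 8) (hd : s'.arr d = s.arr d) (hq : s'.arr q = s.arr q) :
    Queue d q s' Q :=
  ⟨h.nodup, h8.trans h.len, by rw [hq]; exact h.get, by rw [hd]; exact h.mem⟩

/-- The sum of `g` over the elements of a duplicate-free list that are not among the first `h`
decreases by `g Q[h]` in the next step, also if the list is extended. -/
theorem sum_filter_take_succ {α : Type*} [Fintype α] [DecidableEq α] (g : α → ℕ) {Q R : List α}
    (hQ : Q.Nodup) {h : ℕ} (hlt : h < Q.length) :
    (∑ v with v ∉ (Q ++ R).take (h + 1), g v) + g Q[h] = ∑ v with v ∉ Q.take h, g v := by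
  have hvh : Q[h] ∉ Q.take h := by
    intro hm
    obtain ⟨i, hi, he⟩ := List.mem_take_iff_getElem.1 hm
    have := (hQ.getElem_inj_iff).1 he
    omega
  rw [← Finset.sum_erase_add _ _ (show Q[h] ∈ Finset.univ.filter (· ∉ Q.take h) by simpa using hvh)]
  congr 1
  refine Finset.sum_congr ?_ fun _ _ => rfl
  ext w
  have : w ∈ Q.take (h + 1) ↔ w ∈ Q.take h ∨ w = Q[h] := by
    rw [← List.take_concat_get' Q h hlt, List.mem_append, List.mem_singleton]
  rw [List.take_append_of_le_length hlt]
  simp [and_comm, this]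

open Classical in
/-- After `peel`, one of any two adjacent vertices is stored for the other, so that adjacency can be
tested in constant time. The total length of the adjacency lists pays for the scans. -/
theorem does_peel (hadj : IsAdjacencyLists G adj) {r₀ r₁ : Fin n}
    (E : EarSystem Set.univ G.Adj r₀ r₁) {s : State} (hg : HasGraph adj s)
    (h6 : ∀ v : Fin n, s.arr 6 v = (adj v).length) (h8 : ∀ i, s.arr 8 i = 0)
    (h10 : ∀ i, s.arr 10 i = 0) (h11 : ∀ i, s.arr 11 i = 0) :
    Does peel s (∑ v, (40 * (adj v).length + 104) + 30 * n + 50) fun s' =>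
      HasGraph adj s' ∧ (∀ v w : Fin n, Stored s' v w ↔ G.Adj v w) ∧
        ∀ a, (a < 6 ∨ a = 7 ∨ 12 ≤ a) → s'.arr a = s.arr a := by
  have hloop := Does.loop (b := .lt (.var 7) (.var 8)) (p := .block [peelPre, scan 8, peelPost])
    (fun (a : List (Fin n) × ℕ) s' => PeelInv G adj s a.1 a.2 s')
    (fun a => ∑ v with v ∉ a.1.take a.2, (40 * (adj v).length + 104)) (by
      rintro ⟨Q, h⟩ s' hI hb
      have hlt : h < Q.length := by
        simpa [hI.var7, hI.queue.len] using hb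
      refine ⟨_, (does_peel_step hadj hI hlt).mono le_rfl ?_⟩
      rintro s₁ ⟨R, hR⟩
      refine ⟨(Q ++ R, h + 1), hR, ?_⟩
      rw [← sum_filter_take_succ _ hI.queue.nodup hlt (R := R)]
      simp
      omega)
  refine ((does_fill (n := n) (d := 6) (q := 9) (by decide) hg.var0).seq fun s₁ hs₁ =>
    (Does.of_run (p := .assign 7 (.const 0)) trivial le_rfl rfl).seq fun s₂ hs₂ => ?_).mono
      (c := 30 * n + 20 + (2 + (∑ v, (40 * (adj v).length + 104) + 3 + 1 + 1))) (by omega)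
      fun _ h => h
  obtain ⟨harr, hvar, Q, hQ⟩ := hs₁
  have h2arr : s₂.arr = s₁.arr := by
    subst hs₂
    rfl
  have h2var : ∀ x, x ≠ 7 → s₂.var x = s₁.var x := by
    subst hs₂
    simp +contextual
  have hinit : PeelInv G adj s Q 0 s₂ := by
    refine ⟨hQ.congr (h2var 8 (by decide)) (by rw [h2arr]) (by rw [h2arr]), ?_,
      hg.congr ?_ ?_ ?_, ?_, ?_, ?_, ?_, ?_, ?_⟩
    · subst hs₂
      simp
    · rw [h2var 0 (by decide), hvar 0 (by decide) (by decide)]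
    · rw [h2arr, harr 0 (by decide)]
    · rw [h2arr, harr 1 (by decide)]
    · simp [h2arr, harr 8, h8]
    · intro v _
      rw [h2arr, harr 6 (by decide), h6]
      have := length_filter_adj hadj v fun _ => True
      simpa using this
    · simp [h2arr, harr 10, harr 11, h10, h11]
    · simp
    · simp [h2arr, harr 10, harr 11, h10, h11]
    · intro a ha
      rw [h2arr, harr a (by omega)]
  refine ((hloop (Q, 0) s₂ hinit).seq fun s₃ hs₃ => Does.block_nil ?_).mono (by simp) fun _ h => h
  obtain ⟨⟨Q', h⟩, hI, hb⟩ := hs₃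
  have hge : Q'.length ≤ h := by
    simpa [hI.var7, hI.queue.len] using hb
  have htake : Q'.take h = Q' := List.take_of_length_le hge
  refine ⟨hI.graph, fun v w => ⟨?_, fun hvw => ?_⟩, hI.frame⟩
  · rintro (h | h)
    · exact hI.sound v w h
    · exact (hI.sound w v h).symm
  -- A vertex of maximal rank among those left would have at most two neighbours left.
  have hall : ∀ v, v ∈ Q' := by
    by_contra! hex
    obtain ⟨v, hv, hmax⟩ := (Finset.univ.filter fun v => v ∉ Q').exists_max_image E.rk
      (by obtain ⟨v, hv⟩ := hex; exact ⟨v, by simpa using hv⟩)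
    have hv' : v ∉ Q' := by simpa using hv
    apply hv'
    rw [hI.queue.mem v, hI.deg v (by rwa [htake]), htake]
    refine le_trans (Finset.card_le_card fun w hw => ?_) (E.card_nbr_le_two v)
    simp only [Finset.mem_filter, Finset.mem_univ, true_and] at hw ⊢
    exact ⟨hw.1, hmax w (by simpa using hw.2)⟩
  exact hI.complete v (by rw [htake]; exact hall v) w hvw

end

end Algo

namespace EarSystem

section Emission

variable {V : Type u} {G : SimpleGraph V} {r₀ r₁ : V}

/-! ### Removing the ears one after the other -/

/-- The ears `Em` have been removed, in this order, and the vertices `P` have been processed: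
a vertex is processed only after all ears attached at it have been removed, and an ear is removed
when its last inner vertex is processed. -/
structure Removal (E : EarSystem Set.univ G.Adj r₀ r₁) (P : Set V) (Em : List ℕ) : Prop where
  nodup : Em.Nodup
  range : ∀ i ∈ Em, 1 ≤ i ∧ i ≤ E.k
  attached : ∀ i c, E.Ori i c → c 0 ∈ P → i ∈ Em
  inner : ∀ i c t, E.Ori i c → i ∈ Em → 0 < t → t < E.len i → c t ∈ P
  not_full : ∀ i c, E.Ori i c → i ∉ Em → ∃ t, 0 < t ∧ t < E.len i ∧ c t ∉ P
  order : ∀ e (he : e < Em.length) i c, E.Ori i c → E.rk (c 0) = Em[e] → i ∈ Em.take e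

variable {E : EarSystem Set.univ G.Adj r₀ r₁} {P : Set V} {Em : List ℕ} {i : ℕ} {c : ℕ → V}

theorem Removal.empty : E.Removal ∅ [] where
  nodup := List.nodup_nil
  range := by simp
  attached := by simp
  inner := by simp
  not_full i c hc _ := ⟨1, by omega, by have := hc.two_le; omega, by simp⟩
  order := by simp

/-- The ends of a remaining ear are inner vertices of remaining ears, or roots. -/
theorem Removal.rk_notMem (hR : E.Removal P Em) (hc : E.Ori i c) (hi : i ∉ Em) {t : ℕ}
    (ht : t ≤ E.len i) : E.rk (c t) ∉ Em := by
  have key : ∀ c, E.Ori i c → E.rk (c 0) ∉ Em := by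
    intro c hc hm
    obtain ⟨e, he, h⟩ := List.getElem_of_mem hm
    exact hi (List.mem_of_mem_take (hR.order e he i c hc h.symm))
  rcases Nat.eq_zero_or_pos t with rfl | h0
  · exact key c hc
  · rcases ht.eq_or_lt with rfl | h1
    · simpa using key _ hc.rev
    · rwa [hc.rk_inner h0 h1]

theorem Removal.fst_notMem (hR : E.Removal P Em) (hc : E.Ori i c) (hi : i ∉ Em) : c 0 ∉ P :=
  fun h => hi (hR.attached i c hc h)

theorem Ori.ne_pred_succ (hc : E.Ori i c) {t : ℕ} (h0 : 0 < t) (ht : t < E.len i) :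
    c (t - 1) ≠ c (t + 1) := by
  intro h
  have := hc.inj (by omega) (by omega) h
  omega

/-- A vertex that has only two neighbours on the remaining ears is attached to no other remaining
ear. -/
theorem Removal.attached_of_card (hR : E.Removal P Em) (hc : E.Ori i c) (hi : i ∉ Em) {t : ℕ}
    (h0 : 0 < t) (ht : t < E.len i)
    (hcard : ∀ a b d, G.Adj (c t) a → G.Adj (c t) b → G.Adj (c t) d → E.rk a ∉ Em → E.rk b ∉ Em →
      E.rk d ∉ Em → a = b ∨ a = d ∨ b = d) {i' : ℕ} {c' : ℕ → V} (hc' : E.Ori i' c')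
    (h : c' 0 = c t) : i' ∈ Em := by
  by_contra hi'
  have hr' := hc'.rk_inner (t := 1) (by omega) (by have := hc'.two_le; omega)
  have hlt := hc'.rk_fst
  rw [h, hc.rk_inner h0 ht] at hlt
  have h1 := hc'.adj_succ (t := 0) (by have := hc'.two_le; omega)
  rw [h] at h1
  rcases hcard (c (t - 1)) (c (t + 1)) (c' 1) (hc.adj_pred h0 ht.le) (hc.adj_succ ht) h1
    (hR.rk_notMem hc hi (by omega)) (hR.rk_notMem hc hi (by omega)) (by rwa [hr']) with h | h | h
  · exact hc.ne_pred_succ h0 ht h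
  · have := hc.rk_le (t := t - 1) (by omega)
    rw [h, hr'] at this
    omega
  · have := hc.rk_le (t := t + 1) (by omega)
    rw [h, hr'] at this
    omega

/-- If no remaining ears are attached at an inner vertex of a remaining ear, then its remaining
neighbours are those on its ear. -/
theorem Removal.adj_rk_notMem_iff (hR : E.Removal P Em) (hc : E.Ori i c) (hi : i ∉ Em) {t : ℕ}
    (h0 : 0 < t) (ht : t < E.len i) (hatt : ∀ i' c', E.Ori i' c' → c' 0 = c t → i' ∈ Em) {w : V} :
    G.Adj (c t) w ∧ E.rk w ∉ Em ↔ w = c (t - 1) ∨ w = c (t + 1) := by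
  constructor
  · rintro ⟨h, hw⟩
    rcases hc.nbr h0 ht h with h | h | ⟨i', c', -, hc', h1, h2⟩
    · exact Or.inl h
    · exact Or.inr h
    · refine absurd (hatt i' c' hc' h1) ?_
      rwa [h2, hc'.rk_inner (t := 1) (by omega) (by have := hc'.two_le; omega)] at hw
  · rintro (rfl | rfl)
    · exact ⟨hc.adj_pred h0 ht.le, hR.rk_notMem hc hi (by omega)⟩
    · exact ⟨hc.adj_succ ht, hR.rk_notMem hc hi (by omega)⟩

/-- Process a vertex that is not the last one of its ear. -/
theorem Removal.process (hR : E.Removal P Em) (hc : E.Ori i c) {t : ℕ}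
    (h0 : 0 < t) (ht : t < E.len i) (hatt : ∀ i' c', E.Ori i' c' → c' 0 = c t → i' ∈ Em)
    (hfull : ∃ t', 0 < t' ∧ t' < E.len i ∧ c t' ∉ insert (c t) P) :
    E.Removal (insert (c t) P) Em where
  nodup := hR.nodup
  range := hR.range
  attached i' c' hc' h := h.elim (hatt i' c' hc') (hR.attached i' c' hc')
  inner i' c' t' hc' hi' h0' ht' := Or.inr (hR.inner i' c' t' hc' hi' h0' ht')
  order := hR.order
  not_full i' c' hc' hi' := by
    by_cases hii : i' = i
    · subst hii
      obtain ⟨t', h0', ht', h⟩ := hfull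
      rcases hc'.eq_or_rev hc with he | he
      · exact ⟨t', h0', ht', by rwa [← he t' ht'.le]⟩
      · exact ⟨E.len i' - t', by omega, by omega, by rwa [← he t' ht'.le]⟩
    · obtain ⟨t', h0', ht', h⟩ := hR.not_full i' c' hc' hi'
      refine ⟨t', h0', ht', ?_⟩
      rintro (h' | h')
      · have := hc'.rk_inner h0' ht'
        rw [h', hc.rk_inner h0 ht] at this
        exact hii this.symm
      · exact h h'

/-- Process the last vertex of an ear. -/
theorem Removal.process_last (hR : E.Removal P Em) (hc : E.Ori i c) (hi : i ∉ Em) {t : ℕ}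
    (h0 : 0 < t) (ht : t < E.len i) (hatt : ∀ i' c', E.Ori i' c' → c' 0 = c t → i' ∈ Em)
    (hfull : ∀ t', 0 < t' → t' < E.len i → c t' ∈ insert (c t) P) :
    E.Removal (insert (c t) P) (Em ++ [i]) := by
  have hatt' : ∀ i' c', E.Ori i' c' → c' 0 ∈ insert (c t) P → i' ∈ Em := fun i' c' hc' h =>
    h.elim (hatt i' c' hc') (hR.attached i' c' hc')
  have hfull' : ∀ c', E.Ori i c' → ∀ t', 0 < t' → t' < E.len i → c' t' ∈ insert (c t) P := by
    intro c' hc' t' h0' ht'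
    rcases hc.eq_or_rev hc' with he | he
    · rw [he t' ht'.le]
      exact hfull t' h0' ht'
    · rw [he t' ht'.le]
      exact hfull _ (by omega) (by omega)
  refine ⟨?_, ?_, fun i' c' hc' h => List.mem_append_left _ (hatt' i' c' hc' h), ?_, ?_, ?_⟩
  · rw [List.nodup_append]
    refine ⟨hR.nodup, by simp, ?_⟩
    rintro a ha b hb rfl
    rw [List.mem_singleton] at hb
    exact hi (hb ▸ ha)
  · intro j hj
    rcases List.mem_append.1 hj with hj | hj
    · exact hR.range j hj
    · rw [List.mem_singleton] at hj
      rw [hj]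
      exact ⟨hc.1, hc.2.1⟩
  · intro i' c' t' hc' hi' h0' ht'
    rcases List.mem_append.1 hi' with hi' | hi'
    · exact Or.inr (hR.inner i' c' t' hc' hi' h0' ht')
    · rw [List.mem_singleton] at hi'
      subst hi'
      exact hfull' c' hc' t' h0' ht'
  · intro i' c' hc' hi'
    rw [List.mem_append, List.mem_singleton, not_or] at hi'
    obtain ⟨t', h0', ht', h⟩ := hR.not_full i' c' hc' hi'.1
    refine ⟨t', h0', ht', ?_⟩
    rintro (h' | h')
    · have := hc'.rk_inner h0' ht'
      rw [h', hc.rk_inner h0 ht] at this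
      exact hi'.2 this.symm
    · exact h h'
  · intro e he i' c' hc' h
    rcases Nat.lt_or_ge e Em.length with he' | he'
    · rw [List.getElem_append_left he'] at h
      rw [List.take_append_of_le_length he'.le]
      exact hR.order e he' i' c' hc' h
    · have : e = Em.length := by simp at he; omega
      subst this
      rw [List.getElem_concat_length rfl] at h
      rw [List.take_left' rfl]
      have hpos := hc.1
      obtain ⟨c'', t'', hc'', h0'', ht'', h'⟩ := E.exists_ori_of_rk_ne (v := c' 0) (by omega)
      rw [h] at hc'' ht''
      refine hatt' i' c' hc' ?_
      rw [h']
      exact hfull' c'' hc'' t'' h0'' ht''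

/-- If every vertex with just two neighbours on the remaining ears has been processed, no ears
remain: consider the last one. -/
theorem Removal.mem_of_complete (hR : E.Removal P Em)
    (h : ∀ i c t, E.Ori i c → i ∉ Em → 0 < t → t < E.len i →
      (∀ w, G.Adj (c t) w ∧ E.rk w ∉ Em ↔ w = c (t - 1) ∨ w = c (t + 1)) → c t ∈ P) :
    ∀ i, 1 ≤ i → i ≤ E.k → i ∈ Em := by
  suffices ∀ m i, E.k - i ≤ m → 1 ≤ i → i ≤ E.k → i ∈ Em from fun i => this _ i le_rfl
  intro m
  induction m using Nat.strong_induction_on with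
  | _ m ih =>
    intro i hm h1 h2
    by_contra hi
    obtain ⟨t, h0, ht, hP⟩ := hR.not_full i _ (E.ori_pt h1 h2) hi
    refine hP (h i _ t (ori_pt h1 h2) hi h0 ht fun w =>
      hR.adj_rk_notMem_iff (ori_pt h1 h2) hi h0 ht fun i' c' hc' h' => ?_)
    have := hc'.rk_fst
    rw [h', (ori_pt h1 h2).rk_inner h0 ht] at this
    exact ih (E.k - i') (by have := hc'.2.1; omega) i' le_rfl hc'.1 hc'.2.1

/-- The edges between the inner vertices of an ear and the vertices of smaller rank. -/
theorem Ori.adj_rk_iff (hc : E.Ori i c) {v w : V} (hv : E.rk v < i) :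
    G.Adj v w ∧ E.rk w = i ↔ (v = c 0 ∧ w = c 1) ∨ (v = c (E.len i) ∧ w = c (E.len i - 1)) := by
  have h2 := hc.two_le
  constructor
  · rintro ⟨h, hw⟩
    rcases E.adj_cases_max h with h | ⟨c', t, hc', ht, hx, hy⟩
    · have := hc.1
      omega
    · rw [show max (E.rk v) (E.rk w) = i by omega] at hc' ht
      have ht0 : t = 0 := by
        by_contra h0
        have := hc'.rk_inner (by omega) ht
        rw [← hx] at this
        omega
      subst ht0
      rcases hc.eq_or_rev hc' with he | he
      · rw [he _ (by omega)] at hx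
        rw [he _ (by omega)] at hy
        exact Or.inl ⟨hx, hy⟩
      · rw [he _ (by omega)] at hx
        rw [he _ (by omega)] at hy
        exact Or.inr ⟨by simpa using hx, by simpa using hy⟩
  · rintro (⟨rfl, rfl⟩ | ⟨rfl, rfl⟩)
    · exact ⟨hc.adj_succ (by omega), hc.rk_inner (by omega) (by omega)⟩
    · exact ⟨hc.adj_pred (by omega) le_rfl, hc.rk_inner (by omega) (by omega)⟩

/-- The inner vertices of an ear with the numbers from `a` to `b` form a maximal interval of
vertices in `P`. -/
structure Run (E : EarSystem Set.univ G.Adj r₀ r₁) (P : Set V) (i : ℕ) (c : ℕ → V) (a b : ℕ) :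
    Prop where
  ori : E.Ori i c
  pos : 0 < a
  le : a ≤ b
  lt : b < E.len i
  mem : ∀ t, a ≤ t → t ≤ b → c t ∈ P
  left : c (a - 1) ∉ P
  right : c (b + 1) ∉ P

theorem Run.rev {a b : ℕ} (h : E.Run P i c a b) :
    E.Run P i (fun t => c (E.len i - t)) (E.len i - b) (E.len i - a) := by
  have h1 := h.pos
  have h2 := h.le
  have h3 := h.lt
  refine ⟨h.ori.rev, by omega, by omega, by omega, fun t ht ht' => h.mem _ (by omega) (by omega),
    ?_, ?_⟩
  · have := h.right
    rwa [show b + 1 = E.len i - (E.len i - b - 1) by omega] at this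
  · have := h.left
    rwa [show a - 1 = E.len i - (E.len i - a + 1) by omega] at this

theorem Run.congr {a b : ℕ} (h : E.Run P i c a b) {c' : ℕ → V} (hc' : E.Ori i c')
    (he : ∀ t ≤ E.len i, c' t = c t) : E.Run P i c' a b := by
  have h1 := h.pos
  have h2 := h.le
  have h3 := h.lt
  refine ⟨hc', h1, h2, h3, fun t ht ht' => ?_, ?_, ?_⟩
  · rw [he t (by omega)]
    exact h.mem t ht ht'
  · rw [he _ (by omega)]
    exact h.left
  · rw [he _ (by omega)]
    exact h.right

/-- The interval of vertices in `P` that ends before an inner vertex outside `P`. -/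
theorem Removal.exists_left (hR : E.Removal P Em) (hc : E.Ori i c) (hi : i ∉ Em) {t : ℕ}
    (h0 : 0 < t) : ∃ a, 0 < a ∧ a ≤ t ∧ (∀ s, a ≤ s → s < t → c s ∈ P) ∧ c (a - 1) ∉ P := by
  classical
  have hex : ∃ a, 0 < a ∧ a ≤ t ∧ ∀ s, a ≤ s → s < t → c s ∈ P :=
    ⟨t, h0, le_rfl, fun s h h' => absurd h' (by omega)⟩
  obtain ⟨h1, h2, h3⟩ := Nat.find_spec hex
  refine ⟨Nat.find hex, h1, h2, h3, fun hP => ?_⟩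
  have hpos : 0 < Nat.find hex - 1 := by
    by_contra h
    rw [show Nat.find hex - 1 = 0 by omega] at hP
    exact hR.fst_notMem hc hi hP
  refine Nat.find_min hex (m := Nat.find hex - 1) (by omega) ⟨hpos, by omega, fun s hs hs' => ?_⟩
  rcases hs.eq_or_lt with h | h
  · rwa [← h]
  · exact h3 s (by omega) hs'

/-- A maximal interval after the vertex `c t` has been added to `P` is the one around `c t`, or a
maximal interval from before. -/
theorem Run.of_insert {a b a' b' t : ℕ} (hab : E.Run (insert (c t) P) i c a b) (hat : a ≤ t)
    (htb : t ≤ b) (h : E.Run (insert (c t) P) i c a' b') :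
    (a' = a ∧ b' = b) ∨
      E.Run P i c a' b' ∧ a' ≠ a ∧ a' ≠ b ∧ b' ≠ a ∧ b' ≠ b := by
  have h1 := hab.lt
  have h2 := h.pos
  have h3 := h.le
  have h4 := h.lt
  have h5 := hab.pos
  by_cases hov : a' ≤ b ∧ a ≤ b'
  · left
    have e1 : ¬a < a' := fun hlt => h.left (hab.mem _ (by omega) (by omega))
    have e2 : ¬a' < a := fun hlt => hab.left (h.mem _ (by omega) (by omega))
    have e3 : ¬b < b' := fun hlt => hab.right (h.mem _ (by omega) (by omega))
    have e4 : ¬b' < b := fun hlt => h.right (hab.mem _ (by omega) (by omega))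
    omega
  · right
    refine ⟨⟨h.ori, h2, h3, h4, fun s hs hs' => ?_, fun hP => h.left (Or.inr hP),
      fun hP => h.right (Or.inr hP)⟩, by omega, by omega, by omega, by omega⟩
    refine (h.mem s hs hs').resolve_left fun he => ?_
    have := h.ori.inj (by omega) (by omega) he
    omega

end Emission

end EarSystem

namespace Algo

variable {n : ℕ}

/-! ### Computing the ears -/

/-- Follow an interval of processed vertices that starts at the neighbour in the variable `f` of the
vertex in variable 3: `p` becomes its last vertex, and `x` the next vertex on the ear. If the
neighbour is not processed, the interval is empty. -/
def side (f x p : ℕ) : Prog :=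
  .ite (.eq (.get 14 (.var f)) (.const 1))
    (.block [.assign p (.get 17 (.var f)),
      .ite (.eq (.get 14 (.get 15 (.var p))) (.const 1)) (.assign x (.get 16 (.var p)))
        (.assign x (.get 15 (.var p)))])
    (.block [.assign p (.var 3), .assign x (.var f)])

/-- Take the next vertex out of the queue. -/
def emitPre : Prog :=
  .block [.assign 3 (.get 13 (.var 7)), .assign 7 (.succ (.var 7)), .store 14 (.var 3) (.const 1)]

/-- Store the neighbours of the vertex in the arrays 15 and 16. -/
def linkEnds : Prog :=
  .block [.assign 5 (.pred (.var 5)), .assign 6 (.pred (.var 6)), .store 15 (.var 3) (.var 5),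
    .store 16 (.var 3) (.var 6)]

/-- Join the vertex with the intervals on both sides; in the array 17 the two ends of an interval
point to each other. -/
def link : Prog :=
  .block [linkEnds, side 5 10 11, side 6 12 13, .store 17 (.var 11) (.var 13),
    .store 17 (.var 13) (.var 11)]

theorem run_side {s : State} {f x p w p₀ x₀ : ℕ} (hf : s.var f = w) (hxp : x ≠ p)
    (hpf : p ≠ f)
    (h1 : s.arr 14 w = 1 → s.arr 17 w = p₀ ∧
      ((s.arr 14 (s.arr 15 p₀) = 1 ∧ s.arr 16 p₀ = x₀) ∨
        (s.arr 14 (s.arr 15 p₀) ≠ 1 ∧ s.arr 15 p₀ = x₀)))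
    (h2 : s.arr 14 w ≠ 1 → s.var 3 = p₀ ∧ w = x₀) :
    ((side f x p).run s).arr = s.arr ∧
      (∀ y, y ≠ x → y ≠ p → ((side f x p).run s).var y = s.var y) ∧
      ((side f x p).run s).var x = x₀ ∧ ((side f x p).run s).var p = p₀ := by
  by_cases h : s.arr 14 w = 1
  · obtain ⟨hp, ⟨h3, h4⟩ | ⟨h3, h4⟩⟩ := h1 h
    · simp +contextual [side, hf, h, hp, h3, h4, hxp.symm]
    · subst h4
      simp +contextual [side, hf, h, hp, h3, hxp.symm]
  · obtain ⟨h3, h4⟩ := h2 h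
    subst h4
    simp +contextual [side, hf, h, h3, hxp.symm, hpf.symm]

variable {G : SimpleGraph (Fin n)} {adj : Fin n → List (Fin n)} {r₀ r₁ : Fin n}
  {E : EarSystem Set.univ G.Adj r₀ r₁}

open Classical in
/-- Before the vertex `c t`, there is an interval of processed vertices with the numbers from `a` to
`t - 1`, which may be empty (`a = t`); `side` finds its end `c a` and the next vertex `c (a - 1)`. -/
theorem run_side_interval {P : Set (Fin n)} {Em : List ℕ} (hR : E.Removal P Em) {i : ℕ}
    {c : ℕ → Fin n} (hc : E.Ori i c) (hi : i ∉ Em) {t : ℕ} (h0 : 0 < t) (ht : t < E.len i)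
    (htP : c t ∉ P) {s : State} {f x p : ℕ}
    (hflag : ∀ v : Fin n, s.arr 14 v = if v ∈ insert (c t) P then 1 else 0)
    (hends : ∀ u, 0 < u → u < E.len i → c u ∈ P →
      (s.arr 15 (c u) = c (u - 1) ∧ s.arr 16 (c u) = c (u + 1)) ∨
        (s.arr 15 (c u) = c (u + 1) ∧ s.arr 16 (c u) = c (u - 1)))
    (hopp : ∀ c a b, E.Run P i c a b → s.arr 17 (c a) = c b) (h3 : s.var 3 = c t)
    (hf : s.var f = c (t - 1)) (hxp : x ≠ p) (hpf : p ≠ f) :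
    ∃ a, 0 < a ∧ a ≤ t ∧ (∀ s, a ≤ s → s < t → c s ∈ P) ∧ c (a - 1) ∉ P ∧
      ((side f x p).run s).arr = s.arr ∧
      (∀ y, y ≠ x → y ≠ p → ((side f x p).run s).var y = s.var y) ∧
      ((side f x p).run s).var x = c (a - 1) ∧ ((side f x p).run s).var p = c a := by
  obtain ⟨a, ha0, hat, hmem, hleft⟩ := hR.exists_left hc hi h0
  refine ⟨a, ha0, hat, hmem, hleft, run_side hf hxp hpf ?_ ?_⟩
  · intro h
    have hne : c (t - 1) ≠ c t := (hc.adj_pred h0 ht.le).ne'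
    have hlt : a < t := by
      by_contra hge
      rw [show t = a by omega] at h hne hflag
      rw [hflag, if_neg (by simp [hne, hleft])] at h
      exact absurd h (by decide)
    have hrun : E.Run P i c a (t - 1) := ⟨hc, ha0, by omega, by omega,
      fun s hs hs' => hmem s hs (by omega), hleft, by rwa [Nat.sub_add_cancel h0]⟩
    have hopp' := hopp _ _ _ hrun.rev
    simp only [Nat.sub_sub_self (show t - 1 ≤ E.len i by omega),
      Nat.sub_sub_self (show a ≤ E.len i by omega)] at hopp'
    refine ⟨hopp', ?_⟩
    have hne' : c (a - 1) ≠ c t := fun h => by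
      have := hc.inj (by omega) (by omega) h
      omega
    have hin : c (a + 1) ∈ insert (c t) P := by
      rcases (show a + 1 ≤ t from hlt).eq_or_lt with h | h
      · rw [h]
        exact Set.mem_insert _ _
      · exact Or.inr (hmem _ (by omega) h)
    rcases hends a ha0 (by omega) (hmem a le_rfl hlt) with ⟨e1, e2⟩ | ⟨e1, e2⟩
    · right
      rw [e1, hflag, if_neg (by simp [hne', hleft])]
      simp
    · left
      rw [e1, hflag, if_pos hin]
      exact ⟨rfl, e2⟩
  · intro h
    have hat' : a = t := by
      by_contra hne
      exact h (by rw [hflag, if_pos (Set.mem_insert_of_mem _ (hmem _ (by omega) (by omega)))])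
    subst hat'
    exact ⟨h3, rfl⟩

open Classical in
/-- What the memory holds while the ears are computed, when the vertices in `P` have been processed
and the ears `Em` removed: in array 7 the degrees in the remaining graph (increased by 2 for the
roots, which are never processed), in array 12 marks for the first inner vertices of the removed
ears, in array 14 marks for the processed vertices, in the arrays 15 and 16 their neighbours, in
array 17 the pointers between the ends of intervals, and in the arrays 18, 19, 20 the first, the
second and the last vertex of each removed ear. -/
structure EmitMem (E : EarSystem Set.univ G.Adj r₀ r₁) (adj : Fin n → List (Fin n)) (s₀ : State)
    (P : Set (Fin n)) (Em : List ℕ) (s : State) : Prop where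
  var9 : s.var 9 = Em.length
  graph : HasGraph adj s
  stored : ∀ v w : Fin n, Stored s v w ↔ G.Adj v w
  flag : ∀ v : Fin n, s.arr 14 v = if v ∈ P then 1 else 0
  deg : ∀ v : Fin n, E.rk v ∉ Em → s.arr 7 v =
    (Finset.univ.filter fun w => G.Adj v w ∧ E.rk w ∉ Em).card + if E.rk v = 0 then 2 else 0
  ends : ∀ i c t, E.Ori i c → 0 < t → t < E.len i → c t ∈ P →
    (s.arr 15 (c t) = c (t - 1) ∧ s.arr 16 (c t) = c (t + 1)) ∨
      (s.arr 15 (c t) = c (t + 1) ∧ s.arr 16 (c t) = c (t - 1))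
  opp : ∀ i c a b, i ∉ Em → E.Run P i c a b → s.arr 17 (c a) = c b
  em_one : ∀ i c, E.Ori i c → i ∈ Em → s.arr 12 (c 1) = 1
  em_rk : ∀ v : Fin n, s.arr 12 v ≠ 0 → E.rk v ∈ Em
  record : ∀ e (he : e < Em.length), ∃ c, E.Ori Em[e] c ∧ s.arr 18 e = c 0 ∧ s.arr 19 e = c 1 ∧
    s.arr 20 e = c (E.len Em[e])
  frame : ∀ a < 6, s.arr a = s₀.arr a

/-- The two neighbours that scanning the list of a vertex finds. -/
theorem exists_ori_of_scan (hadj : IsAdjacencyLists G adj) {v : Fin n} (hv : E.rk v ≠ 0)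
    {p : Fin n → Prop} [DecidablePred p] {a b : ℕ}
    (hp : ∀ c t, E.Ori (E.rk v) c → 0 < t → t < E.len (E.rk v) → v = c t → ∀ w,
      G.Adj v w ∧ p w ↔ w = c (t - 1) ∨ w = c (t + 1))
    (h : (a, b) = lastTwo (((adj v).filter p).map Fin.val)) :
    ∃ c t, E.Ori (E.rk v) c ∧ 0 < t ∧ t < E.len (E.rk v) ∧ v = c t ∧ a = (c (t - 1) : ℕ) + 1 ∧
      b = (c (t + 1) : ℕ) + 1 := by
  classical
  obtain ⟨c, t, hc, h0, ht, hvt⟩ := E.exists_ori_of_rk_ne hv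
  have hiff := hp c t hc h0 ht hvt
  have hlen : ((adj v).filter p).length ≤ 2 := by
    rw [length_filter_adj hadj]
    refine (Finset.card_le_card (t := {c (t - 1), c (t + 1)}) fun w hw => ?_).trans
      Finset.card_le_two
    simpa using (hiff w).1 (by simpa using hw)
  have hmem : ∀ w, w ∈ (adj v).filter p ↔ w = c (t - 1) ∨ w = c (t + 1) := by
    intro w
    rw [← hiff, List.mem_filter, (hadj v).2]
    simp
  obtain ⟨-, -, hab⟩ := lastTwo_spec ((hadj v).1.filter _) hlen h
  have e1 := (hab (c (t - 1))).1.1 ((hmem _).2 (Or.inl rfl))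
  have e2 := (hab (c (t + 1))).1.1 ((hmem _).2 (Or.inr rfl))
  have hne : (c (t - 1) : ℕ) ≠ c (t + 1) := fun h => hc.ne_pred_succ h0 ht (Fin.ext h)
  by_cases ha : a = (c (t - 1) : ℕ) + 1
  · exact ⟨c, t, hc, h0, ht, hvt, ha, by omega⟩
  · refine ⟨_, E.len (E.rk v) - t, hc.rev, by omega, by omega, ?_, ?_, ?_⟩
    · simpa [Nat.sub_sub_self ht.le] using hvt
    · simp only [show E.len (E.rk v) - (E.len (E.rk v) - t - 1) = t + 1 by omega]
      omega
    · simp only [show E.len (E.rk v) - (E.len (E.rk v) - t + 1) = t - 1 by omega]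
      omega

open Classical in
/-- The next vertex `c t` of the queue is an inner vertex of a remaining ear `i` to which all attached
ears have been removed. It is processed and joined with the intervals on both sides to the interval
from `c a` to `c b`. -/
theorem does_link (hadj : IsAdjacencyLists G adj) {s₀ s : State} {P : Set (Fin n)} {Em : List ℕ}
    {Q : List (Fin n)} {h : ℕ} (hR : E.Removal P Em) (hM : EmitMem E adj s₀ P Em s)
    (hQ : Queue 7 13 s Q) (hP : P = {v | v ∈ Q.take h}) (h7 : s.var 7 = h) (hlt : h < Q.length) :
    Does (.block [emitPre, scan 12, link]) s (40 * (adj Q[h]).length + 200) fun s' =>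
      ∃ i c t a b, i ∉ Em ∧ 0 < t ∧ t < E.len i ∧ c t = Q[h] ∧
        (∀ i' c', E.Ori i' c' → c' 0 = c t → i' ∈ Em) ∧
        E.Run (insert (c t) P) i c a b ∧ a ≤ t ∧ t ≤ b ∧
        EmitMem E adj s₀ (insert (c t) P) Em s' ∧ Queue 7 13 s' Q ∧ s'.var 7 = h + 1 ∧
        s'.var 10 = c (a - 1) ∧ s'.var 11 = c a ∧ s'.var 12 = c (b + 1) ∧ s'.var 13 = c b := by
  set v := Q[h] with hv
  have hvP : v ∉ P := by
    rw [hP]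
    intro hm
    obtain ⟨i, hi, he⟩ := List.mem_take_iff_getElem.1 hm
    have := (hQ.nodup.getElem_inj_iff).1 he
    omega
  have hdle := (hQ.mem v).1 (List.getElem_mem hlt)
  have hrk : E.rk v ∉ Em := by
    intro hm
    have := (hR.range _ hm).1
    obtain ⟨c, t, hc, h0, ht, hvt⟩ := E.exists_ori_of_rk_ne (v := v) (by omega)
    exact hvP (hvt ▸ hR.inner _ c t hc hm h0 ht)
  rw [hM.deg v hrk] at hdle
  -- A root has the other root as a remaining neighbour, so its entry in array 7 is at least 3.
  have hrk0 : E.rk v ≠ 0 := by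
    intro h0
    have hroot := E.adj_root
    rw [if_pos h0] at hdle
    have hex : ∃ w, G.Adj v w ∧ E.rk w = 0 := by
      rcases E.root_of_rk_eq_zero h0 with h | h
      · exact ⟨r₁, by rw [h]; exact hroot, E.rk_root₁⟩
      · exact ⟨r₀, by rw [h]; exact hroot.symm, E.rk_root₀⟩
    obtain ⟨w, hw, hw0⟩ := hex
    have : 0 < (Finset.univ.filter fun w => G.Adj v w ∧ E.rk w ∉ Em).card :=
      Finset.card_pos.2 ⟨w, by simp [hw, hw0, ← h0, hrk]⟩
    omega
  rw [if_neg hrk0, add_zero] at hdle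
  have hcard : ∀ a b d, G.Adj v a → G.Adj v b → G.Adj v d → E.rk a ∉ Em → E.rk b ∉ Em →
      E.rk d ∉ Em → a = b ∨ a = d ∨ b = d := by
    intro a b d ha hb hd ha' hb' hd'
    by_contra! hne
    have : ({a, b, d} : Finset (Fin n)).card ≤
        (Finset.univ.filter fun w => G.Adj v w ∧ E.rk w ∉ Em).card := by
      refine Finset.card_le_card fun w hw => ?_
      simp only [Finset.mem_insert, Finset.mem_singleton] at hw
      simp only [Finset.mem_filter, Finset.mem_univ, true_and]
      rcases hw with rfl | rfl | rfl
      exacts [⟨ha, ha'⟩, ⟨hb, hb'⟩, ⟨hd, hd'⟩]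
    rw [Finset.card_eq_three.2 ⟨a, b, d, hne.1, hne.2.1, hne.2.2, rfl⟩] at this
    omega
  have hatt : ∀ i' c', E.Ori i' c' → c' 0 = v → i' ∈ Em := by
    intro i' c' hc' h'
    obtain ⟨c, t, hc, h0, ht, hvt⟩ := E.exists_ori_of_rk_ne hrk0
    exact hR.attached_of_card hc hrk h0 ht (hvt ▸ hcard) hc' (hvt ▸ h')
  have hQv : s.arr 13 (s.var 7) = v := by rw [h7, hQ.get h hlt]
  refine ((Does.of_run (p := emitPre) (by simp [emitPre]) le_rfl rfl).seq fun s₁ hs₁ =>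
    (HasGraph.does_scan (adj := adj) (v := v) ?_ ?_).seq fun s₂ hs₂ =>
    (Does.of_run (p := link) (by simp [link, linkEnds, side]) le_rfl ?_).seq
      fun s' hs' => Does.block_nil hs').mono ?_ fun _ h => h
  · subst hs₁
    exact hM.graph.congr (by simp [emitPre]) (by simp [emitPre]) (by simp [emitPre])
  · subst hs₁
    simp [emitPre, hQv]
  · obtain ⟨harr, hvar, h56⟩ := hs₂
    have h1arr : ∀ a, a ≠ 14 → s₁.arr a = s.arr a := by
      subst hs₁
      simp +contextual [emitPre]
    have h1flag : ∀ w : Fin n, s₁.arr 14 w = if w ∈ insert v P then 1 else 0 := by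
      intro w
      subst hs₁
      by_cases hw : w = v <;> simp [emitPre, hQv, ← Fin.ext_iff, hM.flag, hw]
    have h1v : ∀ x, x ≠ 3 → x ≠ 7 → s₁.var x = s.var x := by
      subst hs₁
      simp +contextual [emitPre]
    have h13 : s₁.var 3 = v := by
      subst hs₁
      simp [emitPre, hQv]
    have h17 : s₁.var 7 = h + 1 := by
      subst hs₁
      simp [emitPre, h7]
    obtain ⟨c, t, hc, h0, ht, hvt, h5, h6⟩ := exists_ori_of_scan (E := E) hadj hrk0 (by
      intro c t hc h0 ht hvt w
      rw [← hR.adj_rk_notMem_iff hc hrk h0 ht (hvt ▸ hatt), ← hvt]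
      refine and_congr_right fun hvw => ?_
      rw [h1arr 12 (by decide)]
      constructor
      · intro hw hm
        rw [hvt] at hvw
        rcases hc.nbr h0 ht hvw with h | h | ⟨i', c', -, hc', e1, e2⟩
        · exact hR.rk_notMem hc hrk (t := t - 1) (by omega) (h ▸ hm)
        · exact hR.rk_notMem hc hrk (t := t + 1) (by omega) (h ▸ hm)
        · have := hM.em_one i' c' hc' (hatt i' c' hc' (e1.trans hvt.symm))
          rw [e2] at hw
          omega
      · intro hw
        by_contra hne
        exact hw (hM.em_rk w hne)) h56
    set i := E.rk v with hidef
    have hs23 : s₂.var 3 = v := by rw [hvar 3 (by decide) (by decide) (by decide), h13]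
    set s₃ := linkEnds.run s₂ with hs₃
    have h3arr : ∀ a, a ≠ 14 → a ≠ 15 → a ≠ 16 → s₃.arr a = s.arr a := by
      intro a h14 h15 h16
      rw [← h1arr a h14, ← harr, hs₃]
      simp [linkEnds, h15, h16]
    have h3flag : ∀ w : Fin n, s₃.arr 14 w = if w ∈ insert (c t) P then 1 else 0 := by
      intro w
      rw [← hvt, ← h1flag, ← harr, hs₃]
      simp [linkEnds]
    have h3_15 : ∀ w : Fin n, s₃.arr 15 w = if w = v then (c (t - 1) : ℕ) else s.arr 15 w := by
      intro w
      rw [← h1arr 15 (by decide), ← harr, hs₃]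
      simp [linkEnds, hs23, h5, Function.update_apply, ← Fin.ext_iff]
    have h3_16 : ∀ w : Fin n, s₃.arr 16 w = if w = v then (c (t + 1) : ℕ) else s.arr 16 w := by
      intro w
      rw [← h1arr 16 (by decide), ← harr, hs₃]
      simp [linkEnds, hs23, h6, Function.update_apply, ← Fin.ext_iff]
    have h3var : ∀ x, x ≠ 4 → x ≠ 5 → x ≠ 6 → s₃.var x = s₁.var x := by
      intro x h4 h5 h6
      rw [← hvar x h4 h5 h6, hs₃]
      simp [linkEnds, h5, h6]
    have h35 : s₃.var 5 = c (t - 1) := by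
      rw [hs₃]
      simp [linkEnds, h5]
    have h36 : s₃.var 6 = c (t + 1) := by
      rw [hs₃]
      simp [linkEnds, h6]
    have h33 : s₃.var 3 = c t := by
      rw [h3var 3 (by decide) (by decide) (by decide), h13, hvt]
    have htP : c t ∉ P := hvt ▸ hvP
    have h3ends : ∀ i' c' t', E.Ori i' c' → 0 < t' → t' < E.len i' → c' t' ∈ insert (c t) P →
        (s₃.arr 15 (c' t') = c' (t' - 1) ∧ s₃.arr 16 (c' t') = c' (t' + 1)) ∨
          (s₃.arr 15 (c' t') = c' (t' + 1) ∧ s₃.arr 16 (c' t') = c' (t' - 1)) := by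
      intro i' c' t' hc' h0' ht' hm
      rw [h3_15, h3_16]
      rcases hm with hm | hm
      · have hii : i' = i := by
          rw [← hc'.rk_inner h0' ht', hm, hc.rk_inner h0 ht]
        subst hii
        rw [if_pos (hm.trans hvt.symm), if_pos (hm.trans hvt.symm)]
        rcases hc.eq_or_rev hc' with he | he
        · rw [he _ ht'.le] at hm
          have := hc.inj (by omega) (by omega) hm
          subst this
          rw [he _ (by omega), he _ (by omega)]
          exact Or.inl ⟨rfl, rfl⟩
        · rw [he _ ht'.le] at hm
          have := hc.inj (by omega) (by omega) hm
          rw [he _ (by omega), he _ (by omega),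
            show E.len i - (t' + 1) = t - 1 by omega, show E.len i - (t' - 1) = t + 1 by omega]
          exact Or.inr ⟨rfl, rfl⟩
      · have hne : c' t' ≠ v := fun h => hvP (h ▸ hm)
        rw [if_neg hne, if_neg hne]
        exact hM.ends i' c' t' hc' h0' ht' hm
    have h3opp : ∀ c' a b, E.Run P i c' a b → s₃.arr 17 (c' a) = c' b := by
      intro c' a b hrun
      rw [h3arr 17 (by decide) (by decide) (by decide)]
      exact hM.opp i c' a b hrk hrun
    obtain ⟨a, ha0, hat, hamem, haleft, h4arr, h4var, h4x, h4p⟩ := run_side_interval hR hc hrk h0 ht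
      htP (f := 5) (x := 10) (p := 11) h3flag
      (fun u hu hu' hm => h3ends i c u hc hu hu' (Or.inr hm)) h3opp h33 h35 (by decide) (by decide)
    set s₄ := (side 5 10 11).run s₃ with hs₄
    -- The other side is treated in the reverse direction of the ear.
    have htt : E.len i - (E.len i - t) = t := by omega
    obtain ⟨a', ha0', hat', hamem', haleft', h5arr, h5var, h5x, h5p⟩ := run_side_interval hR
      hc.rev hrk (t := E.len i - t) (by omega) (by omega) (by rw [htt]; exact htP) (s := s₄)
      (f := 6) (x := 12) (p := 13) (by rw [htt, h4arr]; exact h3flag)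
      (fun u hu hu' hm => by
        rw [h4arr]
        exact h3ends i _ u hc.rev hu hu' (Or.inr hm))
      (by rw [h4arr]; exact h3opp)
      (by rw [h4var 3 (by decide) (by decide), htt, h33])
      (by rw [h4var 6 (by decide) (by decide), h36,
        show E.len i - (E.len i - t - 1) = t + 1 by omega])
      (by decide) (by decide)
    set s₅ := (side 6 12 13).run s₄ with hs₅
    set b := E.len i - a' with hb
    have hrun5 : link.run s₂ = (s₅.setArr 17 (s₅.var 11) (s₅.var 13)).setArr 17 (s₅.var 13)
        (s₅.var 11) := by
      simp only [link, Prog.run, Prog.block, Expr.eval, State.setArr_var]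
      rfl
    have e10 : s₅.var 10 = c (a - 1) := by rw [h5var 10 (by decide) (by decide), h4x]
    have e11 : s₅.var 11 = c a := by rw [h5var 11 (by decide) (by decide), h4p]
    have e12 : s₅.var 12 = c (b + 1) := by
      rw [h5x, show E.len i - (a' - 1) = b + 1 by omega]
    have e13 : s₅.var 13 = c b := h5p
    have hvar5 : ∀ x, x ≠ 3 → x ≠ 4 → x ≠ 5 → x ≠ 6 → x ≠ 7 → x < 10 → s₅.var x = s.var x := by
      intro x h3 h4 h5 h6 h7 hx
      rw [h5var x (by omega) (by omega), h4var x (by omega) (by omega), h3var x h4 h5 h6,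
        h1v x h3 h7]
    have harr5 : ∀ a, s₅.arr a = s₃.arr a := fun a => by rw [h5arr, h4arr]
    have hrunab : E.Run (insert (c t) P) i c a b := by
      refine ⟨hc, ha0, by omega, by omega, fun u hu hu' => ?_, ?_, ?_⟩
      · rcases lt_trichotomy u t with h | h | h
        · exact Or.inr (hamem u hu h)
        · exact Or.inl (by rw [h])
        · have := hamem' (E.len i - u) (by omega) (by omega)
          simp only [show E.len i - (E.len i - u) = u by omega] at this
          exact Or.inr this
      · rintro (h | h)
        · have := hc.inj (by omega) (by omega) h
          omega
        · exact haleft h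
      · rintro (h | h)
        · have := hc.inj (by omega) (by omega) h
          omega
        · refine haleft' ?_
          rwa [show E.len i - (a' - 1) = b + 1 by omega]
    have hab := hrunab.le
    rw [hrun5]
    set s₆ := (s₅.setArr 17 (s₅.var 11) (s₅.var 13)).setArr 17 (s₅.var 13) (s₅.var 11) with hs₆
    have h6arr : ∀ x, x ≠ 17 → s₆.arr x = s₃.arr x := by
      intro x hx
      rw [← harr5, hs₆]
      simp [hx]
    have h6arr' : ∀ x, x ≠ 14 → x ≠ 15 → x ≠ 16 → x ≠ 17 → s₆.arr x = s.arr x := by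
      intro x h1 h2 h3 h4
      rw [h6arr x h4, h3arr x h1 h2 h3]
    have h6_17 : ∀ w : Fin n, s₆.arr 17 w =
        if w = c b then (c a : ℕ) else if w = c a then (c b : ℕ) else s.arr 17 w := by
      intro w
      rw [← h3arr 17 (by decide) (by decide) (by decide), ← harr5, hs₆]
      simp [e11, e13, Function.update_apply, ← Fin.ext_iff]
    refine ⟨i, c, t, a, b, hrk, h0, ht, hvt.symm, hvt ▸ hatt, hrunab, hat, by omega,
      ⟨?_, ?_, ?_, ?_, ?_, ?_, ?_, ?_, ?_, ?_, ?_⟩, hQ.congr ?_ ?_ ?_, ?_, e10, e11, e12, e13⟩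
    · rw [← hM.var9]
      exact hvar5 9 (by decide) (by decide) (by decide) (by decide) (by decide) (by decide)
    · exact hM.graph.congr
        (hvar5 0 (by decide) (by decide) (by decide) (by decide) (by decide) (by decide))
        (h6arr' 0 (by decide) (by decide) (by decide) (by decide))
        (h6arr' 1 (by decide) (by decide) (by decide) (by decide))
    · intro x y
      rw [← hM.stored]
      unfold Stored
      rw [h6arr' 10 (by decide) (by decide) (by decide) (by decide),
        h6arr' 11 (by decide) (by decide) (by decide) (by decide)]
    · intro w
      rw [h6arr 14 (by decide), h3flag w]
      congr
    · rw [h6arr' 7 (by decide) (by decide) (by decide) (by decide)]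
      exact hM.deg
    · rw [h6arr 15 (by decide), h6arr 16 (by decide)]
      exact h3ends
    · intro i' c' a₁ b₁ hi' hrun
      rw [h6_17]
      by_cases hii : i' = i
      · subst hii
        have key : ∀ a₁ b₁, E.Run (insert (c t) P) i c a₁ b₁ →
            (if c a₁ = c b then (c a : ℕ) else if c a₁ = c a then (c b : ℕ) else s.arr 17 (c a₁)) =
              c b₁ ∧
            (if c b₁ = c b then (c a : ℕ) else if c b₁ = c a then (c b : ℕ) else s.arr 17 (c b₁)) =
              c a₁ := by
          intro a₁ b₁ hrun
          rcases hrunab.of_insert hat (by omega) hrun with ⟨ha₁, hb₁⟩ | ⟨hrun', n1, n2, n3, n4⟩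
          · rw [ha₁, hb₁]
            by_cases hab' : c a = c b
            · simp [hab']
            · simp [hab']
          · have q1 := hrun'.lt
            have q2 := hrun'.le
            have hne : ∀ x y, x ≤ E.len i → y ≤ E.len i → x ≠ y → c x ≠ c y :=
              fun x y hx hy hxy h => hxy (hc.inj hx hy h)
            rw [if_neg (hne _ _ (by omega) (by omega) n2), if_neg (hne _ _ (by omega) (by omega) n1),
              if_neg (hne _ _ (by omega) (by omega) n4), if_neg (hne _ _ (by omega) (by omega) n3)]
            refine ⟨hM.opp i c a₁ b₁ hrk hrun', ?_⟩
            have := hM.opp i _ _ _ hrk hrun'.rev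
            simpa only [Nat.sub_sub_self (show b₁ ≤ E.len i by omega),
              Nat.sub_sub_self (show a₁ ≤ E.len i by omega)] using this
        have q1 := hrun.lt
        have q2 := hrun.le
        rcases hc.eq_or_rev hrun.ori with he | he
        · have := (key a₁ b₁ (hrun.congr hc fun u hu => (he u hu).symm)).1
          rw [he _ (by omega), he _ (by omega)]
          exact this
        · have := (key _ _ (hrun.rev.congr hc fun u hu => by
            rw [he _ (by omega), Nat.sub_sub_self hu])).2
          rw [he _ (by omega), he _ (by omega)]
          exact this
      · have q1 := hrun.lt
        have q2 := hrun.le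
        have q3 := hrun.pos
        have hrk' := hrun.ori.rk_inner (t := a₁) (by omega) (by omega)
        have n1 : c' a₁ ≠ c b := fun h => hii (by
          rw [← hrk', h, hc.rk_inner (by omega) (by omega)])
        have n2 : c' a₁ ≠ c a := fun h => hii (by
          rw [← hrk', h, hc.rk_inner (by omega) (by omega)])
        rw [if_neg n1, if_neg n2]
        refine hM.opp i' c' a₁ b₁ hi' ⟨hrun.ori, q3, q2, q1, fun u hu hu' => ?_,
          fun h => hrun.left (Or.inr h), fun h => hrun.right (Or.inr h)⟩
        refine (hrun.mem u hu hu').resolve_left fun h => hii ?_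
        rw [← hrun.ori.rk_inner (t := u) (by omega) (by omega), h, hc.rk_inner h0 ht]
    · rw [h6arr' 12 (by decide) (by decide) (by decide) (by decide)]
      exact hM.em_one
    · rw [h6arr' 12 (by decide) (by decide) (by decide) (by decide)]
      exact hM.em_rk
    · rw [h6arr' 18 (by decide) (by decide) (by decide) (by decide),
        h6arr' 19 (by decide) (by decide) (by decide) (by decide),
        h6arr' 20 (by decide) (by decide) (by decide) (by decide)]
      exact hM.record
    · intro x hx
      rw [h6arr' x (by omega) (by omega) (by omega) (by omega)]
      exact hM.frame x hx
    · exact hvar5 8 (by decide) (by decide) (by decide) (by decide) (by decide) (by decide)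
    · exact h6arr' 7 (by decide) (by decide) (by decide) (by decide)
    · exact h6arr' 13 (by decide) (by decide) (by decide) (by decide)
    · rw [hs₆, State.setArr_var, State.setArr_var, h5var 7 (by decide) (by decide),
        h4var 7 (by decide) (by decide), h3var 7 (by decide) (by decide) (by decide), h17]
  · simp [emitPre, link, linkEnds, side]
    omega

end Algo

namespace EarSystem

open Classical in
/-- Removing an ear decreases the degrees of its ends by one. -/
theorem Removal.card_remaining {V : Type u} [Fintype V] {G : SimpleGraph V} {r₀ r₁ : V}
    {E : EarSystem Set.univ G.Adj r₀ r₁} {P : Set V} {Em : List ℕ} {i : ℕ} {c : ℕ → V}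
    (hR : E.Removal P (Em ++ [i])) (hc : E.Ori i c) (hi : i ∉ Em) {v : V} (hv : E.rk v ∉ Em ++ [i]) :
    (Finset.univ.filter fun w => G.Adj v w ∧ E.rk w ∉ Em).card =
      (Finset.univ.filter fun w => G.Adj v w ∧ E.rk w ∉ Em ++ [i]).card +
        if v = c 0 ∨ v = c (E.len i) then 1 else 0 := by
  have hK : (Finset.univ.filter fun w => G.Adj v w ∧ E.rk w = i).card =
      if v = c 0 ∨ v = c (E.len i) then 1 else 0 := by
    have h2 := hc.two_le
    have hne : c 0 ≠ c (E.len i) := hc.ends_adj.ne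
    rcases lt_or_ge (E.rk v) i with hlt | hge
    · simp only [hc.adj_rk_iff hlt]
      by_cases h0 : v = c 0
      · rw [if_pos (Or.inl h0), Finset.card_eq_one]
        exact ⟨c 1, by ext w; simp [h0, hne]⟩
      · by_cases h1 : v = c (E.len i)
        · rw [if_pos (Or.inr h1), Finset.card_eq_one]
          exact ⟨c (E.len i - 1), by ext w; simp [h1, hne.symm]⟩
        · simp [h0, h1]
    · have h0 : v ≠ c 0 := by
        rintro rfl
        exact absurd hc.rk_fst (by omega)
      have h1 : v ≠ c (E.len i) := by
        rintro rfl
        exact absurd hc.rk_lst (by omega)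
      rw [if_neg (by simp [h0, h1]), Finset.card_eq_zero, Finset.filter_eq_empty_iff]
      rintro w - ⟨hw, hwi⟩
      have hne : E.rk v ≠ i := fun h => hv (by simp [h])
      obtain ⟨c', t', hc', -, -, -⟩ := E.exists_ori_of_rk_ne (v := v) (by have := hc.1; omega)
      have hwP : w ∈ P := by
        obtain ⟨c'', t'', hc'', h0'', ht'', hw''⟩ := E.exists_ori_of_rk_ne (v := w)
          (by have := hc.1; omega)
        rw [hw'']
        exact hR.inner _ c'' t'' hc'' (by simp [hwi]) h0'' ht''
      rcases (hc'.adj_rk_iff (v := w) (w := v) (by omega)).1 ⟨hw.symm, rfl⟩ with ⟨h, -⟩ | ⟨h, -⟩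
      · exact hv (hR.attached _ c' hc' (h ▸ hwP))
      · exact hv (hR.attached _ _ hc'.rev (by simpa [← h] using hwP))
  rw [← hK, ← Finset.card_union_of_disjoint]
  · congr 1
    ext w
    simp only [Finset.mem_filter, Finset.mem_univ, true_and, Finset.mem_union, List.mem_append,
      List.mem_singleton, not_or]
    by_cases hw : E.rk w = i
    · simp [hw, hi]
    · simp [hw]
  · rw [Finset.disjoint_left]
    intro w
    simp only [Finset.mem_filter, Finset.mem_univ, true_and, List.mem_append, List.mem_singleton]
    tauto

end EarSystem

namespace Algo

variable {n : ℕ}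

/-- If the ends of the interval in the variables 11 and 13 are next to the two ends of the ear,
remove the ear. -/
def emitEar : Prog :=
  .ite (adjTest 10 12)
    (.block [
      .store 12 (.var 11) (.const 1),
      .store 12 (.var 13) (.const 1),
      .store 18 (.var 9) (.var 10),
      .store 19 (.var 9) (.var 11),
      .store 20 (.var 9) (.var 12),
      .assign 9 (.succ (.var 9)),
      decPush 7 13 10,
      decPush 7 13 12])
    .skip

variable {G : SimpleGraph (Fin n)} {adj : Fin n → List (Fin n)} {r₀ r₁ : Fin n}
  {E : EarSystem Set.univ G.Adj r₀ r₁}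

open Classical in
/-- The two vertices next to an interval of the ear are adjacent only if they are the ends of the ear.
Then all inner vertices have been processed, and the ear is removed. -/
theorem run_emitEar {s₀ s : State} {P : Set (Fin n)} {Em : List ℕ} {Q : List (Fin n)} {h : ℕ}
    (hR : E.Removal P Em) {i : ℕ} {c : ℕ → Fin n} {t a b : ℕ} (hi : i ∉ Em) (h0 : 0 < t)
    (ht : t < E.len i) (hatt : ∀ i' c', E.Ori i' c' → c' 0 = c t → i' ∈ Em)
    (hrun : E.Run (insert (c t) P) i c a b)
    (hM : EmitMem E adj s₀ (insert (c t) P) Em s) (hQ : Queue 7 13 s Q) (h7 : s.var 7 = h)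
    (h10 : s.var 10 = c (a - 1)) (h11 : s.var 11 = c a) (h12 : s.var 12 = c (b + 1))
    (h13 : s.var 13 = c b) :
    ∃ R Em', EmitMem E adj s₀ (insert (c t) P) Em' (emitEar.run s) ∧
      E.Removal (insert (c t) P) Em' ∧ Queue 7 13 (emitEar.run s) (Q ++ R) ∧
      (emitEar.run s).var 7 = h := by
  have hc := hrun.ori
  have ha0 := hrun.pos
  have hab := hrun.le
  have hbl := hrun.lt
  have htest : (adjTest 10 12).eval s = true ↔ G.Adj (c (a - 1)) (c (b + 1)) := by
    rw [adjTest_eval h10 h12, hM.stored]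
  by_cases hadj : G.Adj (c (a - 1)) (c (b + 1))
  · have hbl' : b + 1 = E.len i ∧ a = 1 := by
      rcases hc.adj_imp (a := a - 1) (b := b + 1) (by omega) (by omega) hadj with h | h <;> omega
    obtain ⟨hbl', rfl⟩ := hbl'
    simp only [Nat.sub_self] at h10
    rw [hbl'] at h12
    have hR' := hR.process_last hc hi h0 ht hatt fun t' h0' ht' => hrun.mem t' h0' (by omega)
    have hne : c 0 ≠ c (E.len i) := hc.ends_adj.ne
    set s₁ : State := (((((s.setArr 12 (s.var 11) 1).setArr 12 (s.var 13) 1).setArr 18 (s.var 9)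
      (s.var 10)).setArr 19 (s.var 9) (s.var 11)).setArr 20 (s.var 9) (s.var 12)).setVar 9
      (s.var 9 + 1) with hs₁
    have hrun' : emitEar.run s = (decPush 7 13 12).run ((decPush 7 13 10).run s₁) := by
      unfold emitEar
      rw [Prog.run, if_pos (htest.2 hadj)]
      rfl
    have h1arr : ∀ x, x ≠ 12 → x ≠ 18 → x ≠ 19 → x ≠ 20 → s₁.arr x = s.arr x := by
      intro x e1 e2 e3 e4
      simp [hs₁, e1, e2, e3, e4]
    have h1var : ∀ x, x ≠ 9 → s₁.var x = s.var x := by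
      intro x hx
      simp [hs₁, hx]
    have hQ1 : Queue 7 13 s₁ Q := hQ.congr (h1var 8 (by decide))
      (h1arr 7 (by decide) (by decide) (by decide) (by decide))
      (h1arr 13 (by decide) (by decide) (by decide) (by decide))
    obtain ⟨h2v, h2a, h2d, R₁, hQ2⟩ := hQ1.decPush (x := 10) (u := c 0) (by decide)
      (by rw [h1var 10 (by decide), h10])
    set s₂ := (decPush 7 13 10).run s₁
    obtain ⟨h3v, h3a, h3d, R₂, hQ3⟩ := hQ2.decPush (x := 12) (u := c (E.len i)) (by decide)
      (by rw [h2v 12 (by decide), h1var 12 (by decide), h12])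
    rw [hrun']
    set s₃ := (decPush 7 13 12).run s₂
    have h3arr' : ∀ x, x ≠ 7 → x ≠ 13 → s₃.arr x = s₁.arr x := fun x e1 e2 => by
      rw [h3a x e1 e2, h2a x e1 e2]
    have h3arr : ∀ x, x ≠ 7 → x ≠ 13 → x ≠ 12 → x ≠ 18 → x ≠ 19 → x ≠ 20 →
        s₃.arr x = s.arr x := fun x e1 e2 e3 e4 e5 e6 => by
      rw [h3arr' x e1 e2, h1arr x e3 e4 e5 e6]
    have h3var : ∀ x, x ≠ 8 → x ≠ 9 → s₃.var x = s.var x := fun x e1 e2 => by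
      rw [h3v x e1, h2v x e1, h1var x e2]
    have e12 : ∀ w : Fin n, s₃.arr 12 w = if w = c b ∨ w = c 1 then 1 else s.arr 12 w := by
      intro w
      rw [h3arr' 12 (by decide) (by decide), hs₁]
      by_cases e1 : w = c b <;> by_cases e2 : w = c 1 <;>
        simp [h11, h13, Function.update_apply, ← Fin.ext_iff, e1, e2]
    have erec : ∀ x y, x ≠ 7 → x ≠ 13 → x ≠ 12 → ((x = 18 ∧ y = 10) ∨ (x = 19 ∧ y = 11) ∨
        (x = 20 ∧ y = 12)) → ∀ e, s₃.arr x e = if e = Em.length then s.var y else s.arr x e := by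
      intro x y e1 e2 e3 hxy e
      rw [h3arr' x e1 e2, hs₁]
      rcases hxy with ⟨rfl, rfl⟩ | ⟨rfl, rfl⟩ | ⟨rfl, rfl⟩ <;>
        simp [hM.var9, Function.update_apply]
    refine ⟨R₁ ++ R₂, Em ++ [i], ⟨?_, ?_, ?_, ?_, ?_, ?_, ?_, ?_, ?_, ?_, ?_⟩, hR', ?_, ?_⟩
    · rw [h3v 9 (by decide), h2v 9 (by decide), hs₁]
      simp [hM.var9]
    · exact hM.graph.congr (h3var 0 (by decide) (by decide))
        (h3arr 0 (by decide) (by decide) (by decide) (by decide) (by decide) (by decide))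
        (h3arr 1 (by decide) (by decide) (by decide) (by decide) (by decide) (by decide))
    · intro x y
      rw [← hM.stored]
      unfold Stored
      rw [h3arr 10 (by decide) (by decide) (by decide) (by decide) (by decide) (by decide),
        h3arr 11 (by decide) (by decide) (by decide) (by decide) (by decide) (by decide)]
    · rw [h3arr 14 (by decide) (by decide) (by decide) (by decide) (by decide) (by decide)]
      exact hM.flag
    · intro v hv
      have hv' : E.rk v ∉ Em := fun h => hv (List.mem_append_left _ h)
      have hd := hM.deg v hv'
      rw [hR'.card_remaining hc hi hv] at hd
      rw [h3d, h2d, h2d, h1arr 7 (by decide) (by decide) (by decide) (by decide), if_neg hne.symm]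
      by_cases e1 : v = c (E.len i)
      · rw [if_pos e1, ← e1, hd, if_pos (Or.inr e1)]
        omega
      · rw [if_neg e1]
        by_cases e2 : v = c 0
        · rw [if_pos e2, ← e2, hd, if_pos (Or.inl e2)]
          omega
        · rw [if_neg e2, hd, if_neg (by simp [e1, e2])]
          omega
    · rw [h3arr 15 (by decide) (by decide) (by decide) (by decide) (by decide) (by decide),
        h3arr 16 (by decide) (by decide) (by decide) (by decide) (by decide) (by decide)]
      exact hM.ends
    · rw [h3arr 17 (by decide) (by decide) (by decide) (by decide) (by decide) (by decide)]
      exact fun i' c' a' b' hi' hr => hM.opp i' c' a' b' (fun h => hi' (List.mem_append_left _ h)) hr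
    · intro i' c' hc' hi'
      rw [e12]
      rcases List.mem_append.1 hi' with hi' | hi'
      · rw [hM.em_one i' c' hc' hi']
        simp
      · rw [List.mem_singleton] at hi'
        subst hi'
        rw [if_pos]
        rcases hc.eq_or_rev hc' with he | he
        · exact Or.inr (he 1 (by omega))
        · left
          rw [he 1 (by omega), ← hbl', Nat.add_sub_cancel]
    · intro v
      rw [e12]
      split_ifs with hv
      · intro _
        rcases hv with rfl | rfl
        · simp [hc.rk_inner (t := b) (by omega) (by omega)]
        · simp [hc.rk_inner (t := 1) (by omega) (by omega)]
      · exact fun h => List.mem_append_left _ (hM.em_rk v h)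
    · intro e he
      rw [erec 18 10 (by decide) (by decide) (by decide) (by simp),
        erec 19 11 (by decide) (by decide) (by decide) (by simp),
        erec 20 12 (by decide) (by decide) (by decide) (by simp)]
      by_cases he' : e = Em.length
      · subst he'
        simp only [if_true, List.getElem_concat_length]
        exact ⟨c, hc, h10, h11, h12⟩
      · have hlt : e < Em.length := by
          simp only [List.length_append, List.length_singleton] at he
          omega
        simp only [if_neg he', List.getElem_append_left hlt]
        exact hM.record e hlt
    · intro x hx
      rw [h3arr x (by omega) (by omega) (by omega) (by omega) (by omega) (by omega)]
      exact hM.frame x hx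
    · rw [← List.append_assoc]
      exact hQ3
    · rw [h3var 7 (by decide) (by decide), h7]
  · have hrun' : emitEar.run s = s := by
      unfold emitEar
      rw [Prog.run, if_neg (mt htest.1 hadj), Prog.run]
    rw [hrun']
    refine ⟨[], Em, hM, hR.process hc h0 ht hatt ?_, by simpa using hQ, h7⟩
    by_contra! hfull
    have ha1 : a - 1 = 0 := by
      by_contra h
      exact hrun.left (hfull _ (by omega) (by omega))
    have hb1 : b + 1 = E.len i := by
      by_contra h
      exact hrun.right (hfull _ (by omega) (by omega))
    rw [ha1, hb1] at hadj
    exact hadj hc.ends_adj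

theorem straight_emitEar : emitEar.Straight := by
  simp [emitEar, straight_decPush]

theorem bound_emitEar : emitEar.bound ≤ 100 := by
  simp [emitEar, adjTest]
  have := bound_decPush 7 13 10
  have := bound_decPush 7 13 12
  omega

/-- Remove the ears one after the other. The roots get a larger degree, so that they are never
processed. -/
def emit : Prog :=
  .block [
    .assign 10 (.get 1 (.get 0 (.const 0))),
    .store 7 (.const 0) (.succ (.succ (.get 7 (.const 0)))),
    .store 7 (.var 10) (.succ (.succ (.get 7 (.var 10)))),
    fill 7 13,
    .assign 7 (.const 0),
    .assign 9 (.const 0),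
    .loop (.lt (.var 7) (.var 8)) (.block [.block [emitPre, scan 12, link], emitEar])]

open Classical in
/-- `emit` removes all ears: an inner vertex of the last remaining ear would be in the queue. -/
theorem does_emit (hadj : IsAdjacencyLists G adj) {s : State} (hg : HasGraph adj s)
    (h00 : s.arr 1 (s.arr 0 0) = r₁) (hr₀ : (r₀ : ℕ) = 0)
    (hst : ∀ v w : Fin n, Stored s v w ↔ G.Adj v w)
    (h7 : ∀ v : Fin n, s.arr 7 v = (adj v).length) (h12 : ∀ i, s.arr 12 i = 0)
    (h14 : ∀ i, s.arr 14 i = 0) :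
    Does emit s (∑ v, (40 * (adj v).length + 310) + 30 * n + 100) fun s' =>
      ∃ Em P, EmitMem E adj s P Em s' ∧ E.Removal P Em ∧ ∀ i, 1 ≤ i → i ≤ E.k → i ∈ Em := by
  have hloop := Does.loop (b := .lt (.var 7) (.var 8))
    (p := .block [.block [emitPre, scan 12, link], emitEar])
    (fun (a : List (Fin n) × ℕ) s' => ∃ Em, EmitMem E adj s {v | v ∈ a.1.take a.2} Em s' ∧
      E.Removal {v | v ∈ a.1.take a.2} Em ∧ Queue 7 13 s' a.1 ∧ s'.var 7 = a.2)
    (fun a => ∑ v with v ∉ a.1.take a.2, (40 * (adj v).length + 310)) (by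
      rintro ⟨Q, h⟩ s₁ ⟨Em, hM, hR, hQ, hv7⟩ hb
      have hlt : h < Q.length := by
        simpa [hv7, hQ.len] using hb
      refine ⟨40 * (adj Q[h]).length + 305, ((does_link hadj hR hM hQ rfl hv7 hlt).seq fun s₂ hs₂ =>
        ?_).mono (c := 40 * (adj Q[h]).length + 200 + (100 + 1)) (by omega) fun _ h => h⟩
      obtain ⟨i, c, t, a, b, hi, h0, ht, htQ, hatt, hrun, -, -, hM', hQ', hv7', h10, h11, h12, h13⟩ :=
        hs₂
      refine (Does.of_run straight_emitEar bound_emitEar ?_).seq fun s₃ hs₃ => Does.block_nil hs₃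
      obtain ⟨R, Em', hM₁, hR₁, hQ₁, hv7₁⟩ := run_emitEar hR hi h0 ht hatt hrun hM' hQ' hv7' h10 h11
        h12 h13
      have hset : insert (c t) {v | v ∈ Q.take h} = {v | v ∈ (Q ++ R).take (h + 1)} := by
        rw [List.take_append_of_le_length hlt, ← List.take_concat_get' Q h hlt, htQ]
        ext w
        simp only [Set.mem_insert_iff, Set.mem_ofPred_eq, List.mem_append, List.mem_singleton]
        exact or_comm
      rw [hset] at hM₁ hR₁
      refine ⟨(Q ++ R, h + 1), ⟨Em', hM₁, hR₁, hQ₁, hv7₁⟩, ?_⟩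
      · rw [← sum_filter_take_succ _ hQ.nodup hlt (R := R)]
        simp
        omega)
  refine ((Does.of_run (p := .assign 10 (.get 1 (.get 0 (.const 0)))) trivial le_rfl rfl).seq
    fun s₁ hs₁ => (Does.of_run (p := .store 7 (.const 0) (.succ (.succ (.get 7 (.const 0)))))
      trivial le_rfl rfl).seq
    fun s₂ hs₂ => (Does.of_run (p := .store 7 (.var 10) (.succ (.succ (.get 7 (.var 10)))))
      trivial le_rfl rfl).seq
    fun s₃ hs₃ => (does_fill (n := n) (d := 7) (q := 13) (by decide) ?_).seq fun s₄ hs₄ =>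
    (Does.of_run (p := .assign 7 (.const 0)) trivial le_rfl rfl).seq fun s₅ hs₅ =>
    (Does.of_run (p := .assign 9 (.const 0)) trivial le_rfl rfl).seq fun s₆ hs₆ => ?_).mono
      (c := 4 + (6 + (6 + (30 * n + 20 + (2 + (2 +
        (∑ v, (40 * (adj v).length + 310) + 3 + 1 + 1))))))) (by omega)
      fun _ h => h
  · subst hs₃ hs₂ hs₁
    simpa using hg.var0
  have e10 : s₃.var 10 = r₁ := by
    subst hs₃ hs₂ hs₁
    simp [h00]
  have hne : r₀ ≠ r₁ := E.root_ne
  have hne' : (r₁ : ℕ) ≠ 0 := fun h => hne (Fin.ext (hr₀.trans h.symm))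
  have h3var : ∀ x, x ≠ 10 → s₃.var x = s.var x := by
    subst hs₃ hs₂ hs₁
    simp +contextual
  have h3arr : ∀ x, x ≠ 7 → s₃.arr x = s.arr x := by
    subst hs₃ hs₂ hs₁
    simp +contextual
  have h3d : ∀ v : Fin n, s₃.arr 7 v = (adj v).length + if E.rk v = 0 then 2 else 0 := by
    intro v
    have hrk : E.rk v = 0 ↔ v = r₀ ∨ v = r₁ :=
      ⟨E.root_of_rk_eq_zero, by rintro (rfl | rfl); exacts [E.rk_root₀, E.rk_root₁]⟩
    have hv0 : (v : ℕ) = 0 ↔ v = r₀ := by rw [Fin.ext_iff, hr₀]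
    subst hs₃ hs₂ hs₁
    rw [← h7]
    simp only [hrk]
    by_cases e1 : v = r₁
    · subst e1
      simp [h00, hne', hne.symm]
    · by_cases e2 : v = r₀
      · subst e2
        simp [h00, hr₀, hne'.symm]
      · simp [h00, Function.update_apply, ← Fin.ext_iff, e1, e2, hv0]
  obtain ⟨harr, hvar, Q, hQ⟩ := hs₄
  have h6arr : s₆.arr = s₄.arr := by
    subst hs₆ hs₅
    rfl
  have h6var : ∀ x, x ≠ 7 → x ≠ 9 → s₆.var x = s₄.var x := by
    subst hs₆ hs₅
    simp +contextual
  have h6arr' : ∀ x, x ≠ 7 → x ≠ 13 → s₆.arr x = s.arr x := fun x e1 e2 => by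
    rw [h6arr, harr x e2, h3arr x e1]
  have hinit : EmitMem E adj s {v | v ∈ Q.take 0} [] s₆ := by
    refine ⟨?_, hg.congr ?_ (h6arr' 0 (by decide) (by decide)) (h6arr' 1 (by decide) (by decide)),
      ?_, ?_, ?_, ?_, ?_, ?_, ?_, ?_, fun x hx => h6arr' x (by omega) (by omega)⟩
    · subst hs₆
      simp
    · rw [h6var 0 (by decide) (by decide), hvar 0 (by decide) (by decide), h3var 0 (by decide)]
    · intro x y
      rw [← hst]
      unfold Stored
      rw [h6arr' 10 (by decide) (by decide), h6arr' 11 (by decide) (by decide)]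
    · simp [h6arr' 14, h14]
    · intro v _
      rw [h6arr, harr 7 (by decide), h3d]
      have := length_filter_adj hadj v fun _ => True
      simpa using this
    · simp
    · intro i c a b _ hrun
      exact absurd (hrun.mem a le_rfl hrun.le) (by simp)
    · simp
    · simp [h6arr' 12, h12]
    · simp
  refine ((hloop (Q, 0) s₆ ⟨[], hinit, by simpa using EarSystem.Removal.empty,
    hQ.congr (h6var 8 (by decide) (by decide)) (by rw [h6arr]) (by rw [h6arr]), ?_⟩).seq fun s₇ hs₇ => Does.block_nil ?_).mono (by simp) fun _ h => h
  · subst hs₆ hs₅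
    simp
  obtain ⟨⟨Q', h⟩, ⟨Em, hM, hR, hQ', hv7⟩, hb⟩ := hs₇
  have hge : Q'.length ≤ h := by
    simpa [hv7, hQ'.len] using hb
  refine ⟨Em, _, hM, hR, hR.mem_of_complete fun i c t hc hi h0 ht hiff => ?_⟩
  rw [List.take_of_length_le hge]
  have hrk := hc.rk_inner h0 ht
  rw [Set.mem_ofPred_eq, hQ'.mem, hM.deg _ (by rwa [hrk]), if_neg (by have := hc.1; omega), add_zero]
  refine (Finset.card_le_card (t := {c (t - 1), c (t + 1)}) fun w hw => ?_).trans Finset.card_le_two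
  simpa using (hiff w).1 (by simpa using hw)

end Algo

namespace Algo

/-! ### Writing the output -/

/-- The lists `L` are stored one after the other in `d`, with the offsets `o`. -/
def Holds (o d : ℕ → ℕ) (L : List (List ℕ)) : Prop :=
  ∀ i (hi : i < L.length), o (i + 1) = o i + L[i].length ∧
    ∀ j (hj : j < L[i].length), d (o i + j) = L[i][j]

theorem Holds.lists_eq {s : State} {x o d : ℕ} {L : List (List ℕ)} (h : Holds (s.arr o) (s.arr d) L)
    (hx : s.var x = L.length) : s.lists x o d = L := by
  refine List.ext_getElem (by simp [State.lists, hx]) fun i hi hi' => ?_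
  obtain ⟨h1, h2⟩ := h i hi'
  refine List.ext_getElem (by simp [State.lists, h1]) fun j hj hj' => ?_
  simp [State.lists, h2 j hj']

theorem Holds.le {o d : ℕ → ℕ} {L : List (List ℕ)} (h : Holds o d L) {i j : ℕ} (hij : i ≤ j)
    (hj : j ≤ L.length) : o i ≤ o j := by
  induction j, hij using Nat.le_induction with
  | base => exact le_rfl
  | succ j hij ih =>
    rw [(h j (by omega)).1]
    exact (ih (by omega)).trans (Nat.le_add_right _ _)

theorem Holds.append {o d o' d' : ℕ → ℕ} {L : List (List ℕ)} (h : Holds o d L) {l : List ℕ}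
    (ho : ∀ i ≤ L.length, o' i = o i) (hd : ∀ x < o L.length, d' x = d x)
    (hend : o' (L.length + 1) = o L.length + l.length)
    (hl : ∀ j (hj : j < l.length), d' (o L.length + j) = l[j]) : Holds o' d' (L ++ [l]) := by
  intro i hi
  rcases Nat.lt_or_ge i L.length with hlt | hge
  · simp only [List.getElem_append_left hlt]
    obtain ⟨h1, h2⟩ := h i hlt
    rw [ho i hlt.le, ho (i + 1) hlt]
    refine ⟨h1, fun j hj => ?_⟩
    rw [hd _ (lt_of_lt_of_le (by omega) (h.le (i := i + 1) hlt le_rfl)), h2 j hj]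
  · have hi' : i = L.length := by
      simp only [List.length_append, List.length_singleton] at hi
      omega
    subst hi'
    simp only [List.getElem_concat_length, ho _ le_rfl]
    exact ⟨hend, hl⟩

/-- Write the vertex in variable 14 into both output arrays. -/
def outPush : Prog :=
  .block [.store 3 (.var 16) (.var 14), .store 5 (.var 16) (.var 14), .assign 16 (.succ (.var 16))]

/-- Walk one step along an ear, from the vertex in variable 14 to the one in variable 15. -/
def outStep : Prog :=
  .block [outPush, .assign 13 (.var 14), .assign 14 (.var 15),
    .ite (.eq (.get 15 (.var 14)) (.var 13)) (.assign 15 (.get 16 (.var 14)))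
      (.assign 15 (.get 15 (.var 14)))]

theorem run_outStep (s : State) : outStep.run s = (((((s.setArr 3 (s.var 16) (s.var 14)).setArr 5
    (s.var 16) (s.var 14)).setVar 16 (s.var 16 + 1)).setVar 13 (s.var 14)).setVar 14
    (s.var 15)).setVar 15 (if s.arr 15 (s.var 15) = s.var 14 then s.arr 16 (s.var 15) else
      s.arr 15 (s.var 15)) := by
  simp [outStep, outPush]
  split_ifs <;> rfl

/-- The loop of `output` walks along an ear `c 0, …, c l` whose inner vertices have their neighbours
stored in the arrays 15 and 16, and writes all vertices but the last. -/
theorem does_outWalk {s : State} {c : ℕ → ℕ} {l : ℕ} (h14 : s.var 14 = c 0) (h15 : s.var 15 = c 1)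
    (h12 : s.var 12 = c l) (hinj : ∀ t < l, c t ≠ c l)
    (hends : ∀ t, 0 < t → t < l → c (t - 1) ≠ c (t + 1) ∧
      ((s.arr 15 (c t) = c (t - 1) ∧ s.arr 16 (c t) = c (t + 1)) ∨
        (s.arr 15 (c t) = c (t + 1) ∧ s.arr 16 (c t) = c (t - 1)))) :
    Does (.loop (.neg (.eq (.var 14) (.var 12))) outStep) s (50 * l + 5) fun s' =>
      (∀ x, x ≠ 13 → x ≠ 14 → x ≠ 15 → x ≠ 16 → s'.var x = s.var x) ∧ s'.var 14 = c l ∧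
      s'.var 16 = s.var 16 + l ∧ (∀ a, a ≠ 3 → a ≠ 5 → s'.arr a = s.arr a) ∧
      ∀ a, a = 3 ∨ a = 5 → (∀ x < s.var 16, s'.arr a x = s.arr a x) ∧
        ∀ j < l, s'.arr a (s.var 16 + j) = c j := by
  have hloop := Does.loop (b := .neg (.eq (.var 14) (.var 12))) (p := outStep)
    (fun (t : ℕ) s' => t ≤ l ∧ (∀ x, x ≠ 13 → x ≠ 14 → x ≠ 15 → x ≠ 16 → s'.var x = s.var x) ∧
      s'.var 14 = c t ∧ (t < l → s'.var 15 = c (t + 1)) ∧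
      s'.var 16 = s.var 16 + t ∧ (∀ a, a ≠ 3 → a ≠ 5 → s'.arr a = s.arr a) ∧
      ∀ a, a = 3 ∨ a = 5 → (∀ x < s.var 16, s'.arr a x = s.arr a x) ∧
        ∀ j < t, s'.arr a (s.var 16 + j) = c j)
    (fun t => 50 * (l - t)) (by
      rintro t s' ⟨ht, hvar, h14', h15', h16', harr, hout⟩ hb
      have h12' : s'.var 12 = c l := by
        rw [hvar 12 (by decide) (by decide) (by decide) (by decide), h12]
      have hlt : t < l := by
        refine lt_of_le_of_ne ht fun h => ?_
        simp [h14', h12', h] at hb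
      refine ⟨40, Does.of_run (by simp [outStep, outPush]) (by simp [outStep, outPush])
        ⟨t + 1, ⟨hlt, ?_, ?_, ?_, ?_, ?_, ?_⟩, by simp; omega⟩⟩
      · intro x e1 e2 e3 e4
        rw [← hvar x e1 e2 e3 e4, run_outStep]
        simp [e1, e2, e3, e4]
      · simp [run_outStep, h15' hlt]
      · intro hlt'
        obtain ⟨hne, ⟨e1, e2⟩ | ⟨e1, e2⟩⟩ := hends (t + 1) (by omega) hlt'
        · rw [Nat.add_sub_cancel] at e1
          simp [run_outStep, h14', h15' hlt, harr, e1, e2]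
        · rw [Nat.add_sub_cancel] at hne
          simp [run_outStep, h14', h15' hlt, harr, e1, hne.symm]
      · simp [run_outStep, h16', Nat.add_assoc]
      · intro a e1 e2
        rw [← harr a e1 e2, run_outStep]
        simp [e1, e2]
      · intro a ha
        have hrun : (outStep.run s').arr a =
            Function.update (s'.arr a) (s'.var 16) (s'.var 14) := by
          rw [run_outStep]
          rcases ha with rfl | rfl <;> simp
        rw [hrun, h16', h14']
        obtain ⟨k1, k2⟩ := hout a ha
        refine ⟨fun x hx => ?_, fun j hj => ?_⟩
        · rw [Function.update_of_ne (by omega), k1 x hx]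
        · rcases Nat.lt_succ_iff_lt_or_eq.1 hj with h | rfl
          · rw [Function.update_of_ne (by omega), k2 j h]
          · rw [Function.update_self])
  refine (hloop 0 s ⟨Nat.zero_le _, fun _ _ _ _ _ => rfl, h14, fun _ => h15, rfl,
    fun _ _ _ => rfl, fun a _ => ⟨fun _ _ => rfl, by simp⟩⟩).mono (by simp) ?_
  rintro s' ⟨t, ⟨ht, hvar, h14', -, h16', harr, hout⟩, hb⟩
  have h12' : s'.var 12 = c l := by
    rw [hvar 12 (by decide) (by decide) (by decide) (by decide), h12]
  have htl : t = l := by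
    by_contra hne
    have := hinj t (by omega)
    simp [h14', h12', this] at hb
  subst htl
  exact ⟨hvar, h14', h16', harr, hout⟩

/-- Fetch the ear that was removed last among those that have not been written. -/
def outPre : Prog :=
  .block [.assign 9 (.pred (.var 9)), .assign 14 (.get 18 (.var 9)), .assign 15 (.get 19 (.var 9)),
    .assign 12 (.get 20 (.var 9))]

/-- Finish the lists of vertices of an ear and of its cycle. -/
def outPost : Prog :=
  .block [outPush, .assign 1 (.succ (.var 1)), .assign 2 (.succ (.var 2)),
    .store 2 (.var 1) (.var 16), .store 4 (.var 2) (.var 16)]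

/-- Write the root edge. -/
def outInit : Prog :=
  .block [
    .store 3 (.const 0) (.const 0),
    .store 3 (.const 1) (.get 1 (.get 0 (.const 0))),
    .store 2 (.const 0) (.const 0),
    .store 2 (.const 1) (.const 2),
    .store 4 (.const 0) (.const 2),
    .assign 1 (.const 1),
    .assign 2 (.const 0),
    .assign 16 (.const 2)]

/-- Write the root edge and then the ears, in the reverse of the order in which they were removed.
Every ear is also the vertex sequence of an induced cycle. -/
def output : Prog :=
  .block [outInit, .loop (.lt (.const 0) (.var 9)) (.block [outPre,
    .loop (.neg (.eq (.var 14) (.var 12))) outStep, outPost])]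

variable {n : ℕ}

/-- The vertices of an ear of length `l`, as numbers. -/
def earList (c : ℕ → Fin n) (l : ℕ) : List ℕ := (List.range (l + 1)).map fun t => (c t : ℕ)

/-- The invariant of `output`: the lists `L` have been written, as ears after the list `l₀`, and as
cycles; the number `r` of lists remains. -/
structure OutInv (s₀ : State) (l₀ : List ℕ) (L : List (List ℕ)) (r : ℕ) (s : State) : Prop where
  var9 : s.var 9 = r
  var1 : s.var 1 = L.length + 1
  var2 : s.var 2 = L.length
  last2 : s.arr 2 (L.length + 1) = s.var 16
  last4 : s.arr 4 L.length = s.var 16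
  ears : Holds (s.arr 2) (s.arr 3) (l₀ :: L)
  cycles : Holds (s.arr 4) (s.arr 5) L
  frame : ∀ a, 15 ≤ a → s.arr a = s₀.arr a

theorem does_output_step {s₀ s : State} {l₀ : List ℕ} {L : List (List ℕ)} {r : ℕ} {c : ℕ → Fin n}
    {l : ℕ} (hI : OutInv s₀ l₀ L (r + 1) s) (h18 : s₀.arr 18 r = c 0) (h19 : s₀.arr 19 r = c 1)
    (h20 : s₀.arr 20 r = c l) (hinj : ∀ t < l, c t ≠ c l)
    (hends : ∀ t, 0 < t → t < l → c (t - 1) ≠ c (t + 1) ∧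
      ((s₀.arr 15 (c t) = c (t - 1) ∧ s₀.arr 16 (c t) = c (t + 1)) ∨
        (s₀.arr 15 (c t) = c (t + 1) ∧ s₀.arr 16 (c t) = c (t - 1)))) :
    Does (.block [outPre, .loop (.neg (.eq (.var 14) (.var 12))) outStep, outPost]) s
      (50 * l + 100) (OutInv s₀ l₀ (L ++ [earList c l]) r) := by
  refine ((Does.of_run (p := outPre) (by simp [outPre]) le_rfl rfl).seq fun s₁ hs₁ =>
    (does_outWalk (c := fun t => (c t : ℕ)) (l := l) ?_ ?_ ?_ ?_ ?_).seq fun s₂ hs₂ =>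
    (Does.of_run (p := outPost) (by simp [outPost, outPush]) le_rfl ?_).seq
      fun s' hs' => Does.block_nil hs').mono ?_ fun _ h => h
  · subst hs₁
    simp [outPre, hI.var9, hI.frame, h18]
  · subst hs₁
    simp [outPre, hI.var9, hI.frame, h19]
  · subst hs₁
    simp [outPre, hI.var9, hI.frame, h20]
  · exact fun t ht h => hinj t ht (Fin.ext h)
  · intro t h0 ht
    have h1 : s₁.arr = s.arr := by
      subst hs₁
      simp [outPre]
    rw [h1, hI.frame 15 le_rfl, hI.frame 16 (by decide)]
    exact ⟨fun h => (hends t h0 ht).1 (Fin.ext h), (hends t h0 ht).2⟩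
  · obtain ⟨hvar, h14, h16, harr, hout⟩ := hs₂
    have h1arr : s₁.arr = s.arr := by
      subst hs₁
      simp [outPre]
    have h1var : ∀ x, x ≠ 9 → x ≠ 12 → x ≠ 14 → x ≠ 15 → s₁.var x = s.var x := by
      subst hs₁
      simp +contextual [outPre]
    have h19' : s₁.var 9 = r := by
      subst hs₁
      simp [outPre, hI.var9]
    have e1 : s₂.var 1 = L.length + 1 := by
      rw [hvar 1 (by decide) (by decide) (by decide) (by decide),
        h1var 1 (by decide) (by decide) (by decide) (by decide), hI.var1]
    have e2 : s₂.var 2 = L.length := by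
      rw [hvar 2 (by decide) (by decide) (by decide) (by decide),
        h1var 2 (by decide) (by decide) (by decide) (by decide), hI.var2]
    have e16 : s₁.var 16 = s.var 16 := h1var 16 (by decide) (by decide) (by decide) (by decide)
    rw [e16] at h16 hout
    rw [h1arr] at harr hout
    set s₃ := outPost.run s₂ with hs₃
    have f16 : s₃.var 16 = s.var 16 + l + 1 := by
      simp [hs₃, outPost, outPush, h16]
    have f2 : s₃.arr 2 = Function.update (s.arr 2) (L.length + 2) (s.var 16 + l + 1) := by
      simp [hs₃, outPost, outPush, h16, e1, harr]
    have f4 : s₃.arr 4 = Function.update (s.arr 4) (L.length + 1) (s.var 16 + l + 1) := by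
      simp [hs₃, outPost, outPush, h16, e2, harr]
    have f35 : ∀ a, a = 3 ∨ a = 5 → (∀ x < s.var 16, s₃.arr a x = s.arr a x) ∧
        ∀ j (hj : j < (earList c l).length), s₃.arr a (s.var 16 + j) = (earList c l)[j] := by
      intro a ha
      have hrun : s₃.arr a = Function.update (s₂.arr a) (s.var 16 + l) (c l : ℕ) := by
        rw [← h16, ← h14, hs₃]
        rcases ha with rfl | rfl <;> simp [outPost, outPush]
      obtain ⟨k1, k2⟩ := hout a ha
      rw [hrun]
      refine ⟨fun x hx => ?_, fun j hj => ?_⟩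
      · rw [Function.update_of_ne (by omega), k1 x hx]
      · have hj' : j < l + 1 := by simpa [earList] using hj
        rcases Nat.lt_succ_iff_lt_or_eq.1 hj' with h | rfl
        · rw [Function.update_of_ne (by omega), k2 j h]
          simp [earList]
        · rw [Function.update_self]
          simp [earList]
    have hlen : (earList c l).length = l + 1 := by simp [earList]
    refine ⟨?_, ?_, ?_, ?_, ?_, ?_, ?_, ?_⟩
    · rw [← h19', ← hvar 9 (by decide) (by decide) (by decide) (by decide), hs₃]
      simp [outPost, outPush]
    · rw [hs₃]
      simp [outPost, outPush, e1]
    · rw [hs₃]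
      simp [outPost, outPush, e2]
    · rw [f2, f16]
      simp
    · rw [f4, f16]
      simp
    · rw [← List.cons_append]
      have hL : s.arr 2 (l₀ :: L).length = s.var 16 := hI.last2
      refine hI.ears.append (fun i hi => ?_) (fun x hx => ?_) ?_ (fun j hj => ?_)
      · rw [f2, Function.update_of_ne]
        simp only [List.length_cons] at hi
        omega
      · exact (f35 3 (Or.inl rfl)).1 x (hL ▸ hx)
      · rw [hL, f2, hlen]
        simp [Nat.add_assoc]
      · rw [hL]
        exact (f35 3 (Or.inl rfl)).2 j hj
    · have hL : s.arr 4 L.length = s.var 16 := hI.last4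
      refine hI.cycles.append (fun i hi => ?_) (fun x hx => ?_) ?_ (fun j hj => ?_)
      · rw [f4, Function.update_of_ne]
        omega
      · exact (f35 5 (Or.inr rfl)).1 x (hL ▸ hx)
      · rw [hL, f4, hlen]
        simp [Nat.add_assoc]
      · rw [hL]
        exact (f35 5 (Or.inr rfl)).2 j hj
    · intro a ha
      rw [← hI.frame a ha, ← harr a (by omega) (by omega), hs₃]
      simp [outPost, outPush, show a ≠ 2 by omega, show a ≠ 3 by omega, show a ≠ 4 by omega,
        show a ≠ 5 by omega]
  · simp [outPre, outPost, outPush]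
    omega

/-- The ears and cycles share the contents of the output arrays from the cell 2 on; the cells 0 and 1
of array 3 hold the root edge. -/
theorem does_output {s : State} {m r₁ : ℕ} {c : Fin m → ℕ → Fin n} {l : Fin m → ℕ}
    (h1 : s.arr 1 (s.arr 0 0) = r₁) (h9 : s.var 9 = m)
    (hrec : ∀ e : Fin m, s.arr 18 (e.rev : ℕ) = c e 0 ∧ s.arr 19 (e.rev : ℕ) = c e 1 ∧
      s.arr 20 (e.rev : ℕ) = c e (l e))
    (hinj : ∀ e, ∀ t < l e, c e t ≠ c e (l e))
    (hends : ∀ e t, 0 < t → t < l e → c e (t - 1) ≠ c e (t + 1) ∧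
      ((s.arr 15 (c e t) = c e (t - 1) ∧ s.arr 16 (c e t) = c e (t + 1)) ∨
        (s.arr 15 (c e t) = c e (t + 1) ∧ s.arr 16 (c e t) = c e (t - 1)))) :
    Does output s (∑ e, (50 * l e + 110) + 100) fun s' =>
      s'.lists 1 2 3 = [0, r₁] :: List.ofFn (fun e => earList (c e) (l e)) ∧
      s'.lists 2 4 5 = List.ofFn (fun e => earList (c e) (l e)) := by
  set F := List.ofFn (fun e => earList (c e) (l e)) with hF
  set K := List.ofFn (fun e => 50 * l e + 110) with hK
  have hFl : F.length = m := by simp [hF]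
  have hKl : K.length = m := by simp [hK]
  have hloop := Does.loop (b := .lt (.const 0) (.var 9)) (p := .block [outPre,
      .loop (.neg (.eq (.var 14) (.var 12))) outStep, outPost])
    (fun (e : ℕ) s' => e ≤ m ∧ OutInv s [0, r₁] (F.take e) (m - e) s')
    (fun e => (K.drop e).sum) (by
      rintro e s' ⟨he, hI⟩ hb
      have hlt : e < m := by
        have : 0 < m - e := by simpa [hI.var9] using hb
        omega
      rw [show m - e = m - (e + 1) + 1 by omega] at hI
      obtain ⟨q1, q2, q3⟩ := hrec ⟨e, hlt⟩
      rw [Fin.val_rev] at q1 q2 q3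
      refine ⟨_, (does_output_step hI q1 q2 q3 (hinj _) (hends _)).mono le_rfl fun s₁ hs₁ =>
        ⟨e + 1, ⟨hlt, ?_⟩, ?_⟩⟩
      · have : F.take (e + 1) = F.take e ++ [earList (c ⟨e, hlt⟩) (l ⟨e, hlt⟩)] := by
          rw [← List.take_concat_get' F e (by omega)]
          simp [hF]
        rwa [this]
      · rw [List.drop_eq_getElem_cons (show e < K.length by omega)]
        simp [hK]
        omega)
  refine ((Does.of_run (p := outInit) (by simp [outInit]) le_rfl rfl).seq fun s₁ hs₁ =>
    (hloop 0 s₁ ⟨Nat.zero_le _, ?_⟩).seq fun s₂ hs₂ => Does.block_nil ?_).mono ?_ fun _ h => h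
  · rw [List.take_zero, Nat.sub_zero]
    subst hs₁
    refine ⟨by simpa [outInit] using h9, by simp [outInit], by simp [outInit], by simp [outInit],
      by simp [outInit], ?_, ?_, fun a ha => ?_⟩
    · intro i hi
      have hi' : i = 0 := by simpa using hi
      subst hi'
      refine ⟨by simp [outInit], fun j hj => ?_⟩
      have hj' : j = 0 ∨ j = 1 := by
        simp at hj
        omega
      rcases hj' with rfl | rfl <;> simp [outInit, h1]
    · intro i hi
      simp at hi
    · simp [outInit, show a ≠ 2 by omega, show a ≠ 3 by omega, show a ≠ 4 by omega]
  · obtain ⟨e, ⟨he, hI⟩, hb⟩ := hs₂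
    have hem : e = m := by
      have : m ≤ e := by simpa [hI.var9] using hb
      omega
    subst hem
    rw [List.take_of_length_le hFl.le] at hI
    exact ⟨hI.ears.lists_eq (by simpa using hI.var1), hI.cycles.lists_eq hI.var2⟩
  · simp [outInit, hK, List.sum_ofFn]
    omega

end Algo

theorem IsPolygonal2Tree.exists_adj_left {V : Type u} {G : SimpleGraph V} (hG : IsPolygonal2Tree G)
    (v : V) : ∃ w, G.Adj v w := by
  obtain ⟨a, b, hab⟩ := hG.exists_adj
  obtain ⟨E⟩ := hG.nonempty_earSystem hab
  by_cases ha : v = a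
  · exact ⟨b, ha ▸ hab⟩
  by_cases hb : v = b
  · exact ⟨a, hb ▸ hab.symm⟩
  obtain ⟨i, c, t, hc, -, ht, rfl⟩ := E.exists_ori_of_ne ha hb
  exact ⟨_, hc.adj_succ ht⟩

namespace Algo

/-! ### The input -/

section Input

variable {n : ℕ} {G : SimpleGraph (Fin n)} {adj : Fin n → List (Fin n)}

theorem getElem?_flatten {α : Type*} (L : List (List α)) {i j : ℕ} (hi : i < L.length)
    (hj : j < L[i].length) : L.flatten[(L.take i).flatten.length + j]? = some L[i][j] := by
  have h : L.flatten = (L.take i).flatten ++ (L[i] ++ (L.drop (i + 1)).flatten) := by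
    rw [← List.flatten_cons, ← List.drop_eq_getElem_cons hi, ← List.flatten_append,
      List.take_append_drop]
  rw [h, List.getElem?_append_right (Nat.le_add_right _ _), Nat.add_sub_cancel_left,
    List.getElem?_append_left hj, List.getElem?_eq_getElem hj]

theorem inputState_arr_zero {i : ℕ} (hi : i ≤ n) :
    (inputState adj).arr 0 i = ((List.ofFn adj).take i).flatten.length := by
  simp [inputState, hi]

theorem inputState_arr_one (j : ℕ) :
    (inputState adj).arr 1 j = ((List.ofFn adj).flatten.map Fin.val).getD j 0 := rfl

theorem hasGraph_inputState (adj : Fin n → List (Fin n)) : HasGraph adj (inputState adj) where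
  var0 := rfl
  off v := by
    rw [inputState_arr_zero v.isLt, inputState_arr_zero v.isLt.le,
      ← List.take_concat_get' _ _ (by simp : (v : ℕ) < (List.ofFn adj).length)]
    simp
  get v j hj := by
    rw [inputState_arr_zero v.isLt.le, inputState_arr_one, List.getD_eq_getElem?_getD,
      List.getElem?_map, getElem?_flatten _ (by simp) (by simpa using hj)]
    simp

theorem sum_length_adj : (List.ofFn adj).flatten.length = ∑ v, (adj v).length := by
  rw [List.length_flatten, List.map_ofFn, List.sum_ofFn]
  rfl

/-- By symmetry, a vertex occurs in the adjacency lists as often as its own list is long. -/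
theorem count_flatten_adj (hadj : IsAdjacencyLists G adj) (w : Fin n) :
    ((List.ofFn adj).flatten.map Fin.val).count (w : ℕ) = (adj w).length := by
  classical
  rw [List.count_map_of_injective _ _ Fin.val_injective, List.count_flatten, List.map_ofFn,
    List.sum_ofFn]
  have h1 := length_filter_adj hadj w fun _ => True
  have h2 : ∀ v, (List.count w ∘ adj) v = if G.Adj w v then 1 else 0 := by
    intro v
    rw [Function.comp_apply, (hadj v).1.count]
    simp [(hadj v).2, G.adj_comm]
  rw [Finset.sum_congr rfl fun v _ => h2 v, ← Finset.card_filter]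
  simpa using h1.symm

end Input

/-! ### The complete algorithm -/

/-- The algorithm: make adjacency tests possible, remove the ears one after the other, and write them
in the reverse order. -/
def main : Prog :=
  .block [countDegrees, peel, emit, output]

variable {n : ℕ} {G : SimpleGraph (Fin n)} {adj : Fin n → List (Fin n)} {r₀ r₁ : Fin n}

open Classical in
theorem sum_length_adj_le (E : EarSystem Set.univ G.Adj r₀ r₁) (hadj : IsAdjacencyLists G adj) :
    ∑ v, (adj v).length ≤ 4 * n := by
  refine le_trans (Finset.sum_le_sum fun v _ => ?_) (E.sum_degree_le.trans (by simp))
  have := length_filter_adj hadj v fun _ => True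
  simp at this
  exact this.le

/-- The ears and the cycles that the algorithm writes, when it removes the ears in the order
`Em`. -/
theorem outputs_of_removal {E : EarSystem Set.univ G.Adj r₀ r₁} {P : Set (Fin n)} {Em : List ℕ}
    (hR : E.Removal P Em) (hall : ∀ i, 1 ≤ i → i ≤ E.k → i ∈ Em) (hr₀ : (r₀ : ℕ) = 0)
    {c : Fin Em.length → ℕ → Fin n} (hc : ∀ e, E.Ori Em[e.rev] (c e)) {s : State}
    (hears : s.lists 1 2 3 = [0, (r₁ : ℕ)] ::
      List.ofFn (fun e : Fin Em.length => earList (c e) (E.len Em[e.rev])))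
    (hcycles : s.lists 2 4 5 = List.ofFn (fun e : Fin Em.length => earList (c e) (E.len Em[e.rev]))) :
    (∃ (k : ℕ) (D : Fin (k + 1) → Ear G), IsLongNestedEarDecomposition D ∧ OutputsEars s D) ∧
      OutputsCycles s (inducedCycles G) := by
  have hinj : Function.Injective fun e : Fin Em.length => Em[e.rev] := by
    intro e e' h
    have := hR.nodup.getElem_inj_iff.1 h
    exact Fin.rev_injective (Fin.ext this)
  have hsurj : ∀ i, 1 ≤ i → i ≤ E.k → ∃ e : Fin Em.length, Em[e.rev] = i := by
    intro i h1 h2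
    obtain ⟨j, hj, h⟩ := List.getElem_of_mem (hall i h1 h2)
    exact ⟨(⟨j, hj⟩ : Fin Em.length).rev, by simpa using h⟩
  have hlist : ∀ e, (hc e).walk.support.map Fin.val = earList (c e) (E.len Em[e.rev]) := by
    intro e
    rw [(hc e).support_walk, List.map_map]
    rfl
  refine ⟨⟨Em.length, E.earSeq hc, EarSystem.isLongNested_earSeq hc hinj hsurj ?_, ?_⟩,
    Em.length, fun e => E.cyc Em[e.rev], fun e => (hc e).walk.support, ?_, ?_, ?_, ?_⟩
  · have key : ∀ (e e' : Fin Em.length) c, E.Ori Em[e.rev] c → E.rk (c 0) = Em[e'.rev] →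
        e' < e := by
      intro e e' c hc h
      obtain ⟨j, hj, hj'⟩ := List.mem_take_iff_getElem.1 (hR.order _ e'.rev.isLt _ c hc h)
      have := hR.nodup.getElem_inj_iff.1 hj'
      rw [← Fin.rev_lt_rev, Fin.lt_def, ← this]
      omega
    rintro e e' (h | h)
    · exact key e e' _ (hc e) h
    · exact key e e' _ (hc e).rev (by simpa using h)
  · rw [OutputsEars, hears, List.ofFn_succ]
    congr 1
    · simp [EarSystem.earSeq_zero, EarSystem.rootEar, hr₀]
    · congr 1
      funext e
      exact (hlist e).symm
  · intro e e' h
    exact hinj (EarSystem.cyc_injOn ⟨(hc e).1, (hc e).2.1⟩ ⟨(hc e').1, (hc e').2.1⟩ h)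
  · rw [E.inducedCycles_eq]
    ext C
    constructor
    · rintro ⟨e, rfl⟩
      exact ⟨_, ⟨(hc e).1, (hc e).2.1⟩, rfl⟩
    · rintro ⟨i, ⟨h1, h2⟩, rfl⟩
      obtain ⟨e, rfl⟩ := hsurj i h1 h2
      exact ⟨e, rfl⟩
  · intro e
    exact ⟨_, (hc e).closed, (hc e).isCycle_closed, (hc e).cyc_eq, rfl⟩
  · rw [hcycles]
    congr 1
    funext e
    exact (hlist e).symm

theorem does_main (hadj : IsAdjacencyLists G adj) (E : EarSystem Set.univ G.Adj r₀ r₁)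
    (hr₀ : (r₀ : ℕ) = 0) (hr₁ : (inputState adj).arr 1 ((inputState adj).arr 0 0) = r₁) :
    Does main (inputState adj) (2000 * n) fun s =>
      (∃ (k : ℕ) (D : Fin (k + 1) → Ear G), IsLongNestedEarDecomposition D ∧ OutputsEars s D) ∧
        OutputsCycles s (inducedCycles G) := by
  have hpos : 0 < n := r₀.pos
  have hD := sum_length_adj_le E hadj
  have hg := hasGraph_inputState adj
  have hzero : ∀ a, 2 ≤ a → ∀ i, (inputState adj).arr a i = 0 := by
    intro a ha i
    simp [inputState, show a ≠ 0 by omega, show a ≠ 1 by omega]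
  set F := (List.ofFn adj).flatten.map Fin.val with hF
  have hFl : F.length = ∑ v, (adj v).length := by rw [hF, List.length_map, sum_length_adj]
  refine ((does_countDegrees (F := F) ?_ ?_ (hzero 6 (by decide)) (hzero 7 (by decide))).seq
    fun s₁ hs₁ => (does_peel hadj E (hg.congr ?_ ?_ ?_) ?_ ?_ ?_ ?_).seq fun s₂ hs₂ =>
    (does_emit (E := E) hadj hs₂.1 ?_ hr₀ hs₂.2.1 ?_ ?_ ?_).seq
    (d := 110 * (3 * n) + 100 + 1) fun s₃ hs₃ => ?_).mono ?_ fun _ h => h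
  · rw [hg.var0, inputState_arr_zero le_rfl, List.take_of_length_le (by simp), hF, List.length_map]
  · intro j hj
    rw [inputState_arr_one, List.getD_eq_getElem _ _ hj]
  · exact hs₁.2.1 0 (by decide)
  · exact hs₁.1 0 (by decide) (by decide)
  · exact hs₁.1 1 (by decide) (by decide)
  · intro v
    rw [hs₁.2.2.1, count_flatten_adj hadj]
  · rw [hs₁.1 8 (by decide) (by decide)]
    exact hzero 8 (by decide)
  · rw [hs₁.1 10 (by decide) (by decide)]
    exact hzero 10 (by decide)
  · rw [hs₁.1 11 (by decide) (by decide)]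
    exact hzero 11 (by decide)
  · rw [hs₂.2.2 0 (by decide), hs₂.2.2 1 (by decide), hs₁.1 0 (by decide) (by decide),
      hs₁.1 1 (by decide) (by decide), hr₁]
  · intro v
    rw [hs₂.2.2 7 (by decide), hs₁.2.2.2, count_flatten_adj hadj]
  · rw [hs₂.2.2 12 (by decide), hs₁.1 12 (by decide) (by decide)]
    exact hzero 12 (by decide)
  · rw [hs₂.2.2 14 (by decide), hs₁.1 14 (by decide) (by decide)]
    exact hzero 14 (by decide)
  · obtain ⟨Em, P, hM, hR, hall⟩ := hs₃
    choose c hc h18 h19 h20 using fun e : Fin Em.length => hM.record e.rev e.rev.isLt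
    have hsum : ∑ e : Fin Em.length, (E.len Em[e.rev] + 1) ≤ 3 * n := by
      have hinj : Function.Injective fun e : Fin Em.length => Em[e.rev] := by
        intro e e' h
        exact Fin.rev_injective (Fin.ext (hR.nodup.getElem_inj_iff.1 h))
      have := E.sum_len_add_one_le
      rw [Fintype.card_fin] at this
      refine le_trans (le_of_eq_of_le ?_ (Finset.sum_le_sum_of_subset
        (s := Finset.univ.image fun e : Fin Em.length => Em[e.rev]) ?_)) this
      · rw [Finset.sum_image fun e _ e' _ h => hinj h]
      · intro i hi
        obtain ⟨e, -, rfl⟩ := Finset.mem_image.1 hi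
        exact Finset.mem_Icc.2 ⟨(hc e).1, (hc e).2.1⟩
    refine ((does_output (r₁ := r₁) (c := c) (l := fun e => E.len Em[e.rev]) ?_ hM.var9
      (fun e => ⟨h18 e, h19 e, h20 e⟩) ?_ ?_).seq fun s₄ hs₄ => Does.block_nil
        (outputs_of_removal hR hall hr₀ hc hs₄.1 hs₄.2)).mono ?_ fun _ h => h
    · rw [hM.frame 0 (by decide), hM.frame 1 (by decide), hs₂.2.2 0 (by decide),
        hs₂.2.2 1 (by decide), hs₁.1 0 (by decide) (by decide), hs₁.1 1 (by decide) (by decide), hr₁]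
    · intro e t ht h
      exact ht.ne ((hc e).inj ht.le le_rfl h)
    · intro e t h0 ht
      exact ⟨(hc e).ne_pred_succ h0 ht, hM.ends _ _ t (hc e) h0 ht
        (hR.inner _ _ t (hc e) (List.getElem_mem _) h0 ht)⟩
    · have : ∑ e : Fin Em.length, (50 * E.len Em[e.rev] + 110) ≤
          ∑ e : Fin Em.length, 110 * (E.len Em[e.rev] + 1) :=
        Finset.sum_le_sum fun e _ => by omega
      rw [← Finset.mul_sum] at this
      omega
  · rw [hFl, Finset.sum_add_distrib, Finset.sum_add_distrib, ← Finset.mul_sum]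
    simp
    omega

end Algo

end PolyTree

theorem mainTheorem6 :
    (∀ (V : Type u) (G : SimpleGraph V), PolyTree.IsPolygonal2Tree G →
      ∀ (k : ℕ) (D : Fin (k + 1) → PolyTree.Ear G),
        PolyTree.IsLongNestedEarDecomposition D → PolyTree.IsNiceEarDecomposition D) ∧
    (∃ (p : PolyTree.Prog) (c : ℕ), ∀ (n : ℕ) (G : SimpleGraph (Fin n)),
      PolyTree.IsPolygonal2Tree G →
      ∀ adj : Fin n → List (Fin n), PolyTree.IsAdjacencyLists G adj →
        ∃ (s : PolyTree.State) (t : ℕ),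
          PolyTree.Exec p (PolyTree.inputState adj) s t ∧ t ≤ c * n ∧
          (∃ (k : ℕ) (D : Fin (k + 1) → PolyTree.Ear G),
            PolyTree.IsLongNestedEarDecomposition D ∧ PolyTree.OutputsEars s D) ∧
          PolyTree.OutputsCycles s (PolyTree.inducedCycles G)) ∧
    (∃ c : ℕ, ∀ (V : Type u) [Fintype V] (G : SimpleGraph V), PolyTree.IsPolygonal2Tree G →
      PolyTree.size (PolyTree.inducedCycles G) ≤ c * Fintype.card V) := by
  refine ⟨fun V G hG k D hD => hD.isNice hG, ⟨PolyTree.Algo.main, 2000, ?_⟩,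
    3, fun V _ G hG => hG.size_inducedCycles_le⟩
  intro n G hG adj hadj
  -- The ear structure is rooted at the vertex 0 and the first vertex of its list.
  obtain ⟨r₀, hr₀⟩ : ∃ r₀ : Fin n, (r₀ : ℕ) = 0 := by
    obtain ⟨a, -⟩ := hG.exists_adj
    exact ⟨⟨0, a.pos⟩, rfl⟩
  obtain ⟨w, hw⟩ := hG.exists_adj_left r₀
  have hlen : 0 < (adj r₀).length := List.length_pos_of_mem (((hadj r₀).2 w).2 hw)
  have hr₁ := (PolyTree.Algo.hasGraph_inputState adj).get r₀ 0 hlen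
  rw [hr₀, Nat.add_zero] at hr₁
  obtain ⟨E⟩ := hG.nonempty_earSystem (((hadj r₀).2 _).1 (List.getElem_mem hlen))
  exact PolyTree.Algo.does_main hadj E hr₀ hr₁
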